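/- **Notation.** Let $n,N$ be natural numbers, $\alpha>0$ real, and $\mathbf m=(m_1\ge m_2\ge\dots\ge m_N)\in\mathbb Z^N$. Let $\mathcal H=\mathbb C[z_1^{\pm1},\dots,z_N^{\pm1}]\otimes(\mathbb C^n)^{\otimes N}$; $K_{i,j}$ exchanges the variables $z_i,z_j$, $P_{i,j}$ exchanges the $i$-th and $j$-th factors of $(\mathbb C^n)^{\otimes N}$, and $E^{(i)}_{a,b}$ is the matrix unit $E_{a,b}$ acting in the $i$-th factor. Put $\mathcal H^{(+)}=\bigcap_{i=1}^{N-1}\ker(K_{i,i+1}P_{i,i+1}-1)$. The Dunkl operators are $$d_i=\alpha z_i\frac{\partial}{\partial z_i}-i+\sum_{j>i}\frac{z_j}{z_j-z_i}(K_{i,j}-1)-\sum_{j<i}\frac{z_i}{z_i-z_j}(K_{i,j}-1).$$ The Yangian $Y(\mathfrak{gl}_n)$ is the unital associative $\mathbb C$-algebra generated by $T^{(s)}_{a,b}$ ($1\le a,b\le n$, $s\ge1$) with $T^{(0)}_{a,b}=\delta_{a,b}$ and relations $[T_{a,b}^{(r)},T_{c,d}^{(s+1)}]-[T_{a,b}^{(r+1)},T_{c,d}^{(s)}]=T_{c,b}^{(r)}T_{a,d}^{(s)}-T_{c,b}^{(s)}T_{a,d}^{(r)}$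 ($r,s\ge0$); write $T_{a,b}(u)=\sum_{s\ge0}u^{-s}T^{(s)}_{a,b}$. Let $S^{\mathbf m}$ be the set of permutations $\sigma$ of $\{1,\dots,N\}$ with $\sigma(i)=\#\{j\le i: m_{\sigma(j)}\ge m_{\sigma(i)}\}+\#\{j>i: m_{\sigma(j)}>m_{\sigma(i)}\}$ for all $i$, and let $\xi_i(\sigma)=\alpha m_{\sigma(i)}-\sigma(i)$. For $\sigma\in S^{\mathbf m}$ the non-symmetric Jack polynomial $\Phi^{\mathbf m}_\sigma$ is the Laurent polynomial with $d_i\Phi^{\mathbf m}_\sigma=\xi_i(\sigma)\Phi^{\mathbf m}_\sigma$ for all $i$ of the form $z_1^{m_{\sigma(1)}}\cdots z_N^{m_{\sigma(N)}}$ plus a linear combination of monomials $z_1^{\tilde m_{\tilde\sigma(1)}}\cdots z_N^{\tilde m_{\tilde\sigma(N)}}$ ($\tilde{\mathbf m}$ weakly decreasing, $\tilde\sigma\in S^{\tilde{\mathbf m}}$) where either $\tilde{\mathbf m}<\mathbf m$ strictly in the dominance order, or $\tilde{\mathbf m}=\mathbf m$ and the last non-zero entry of $(m_{\sigma(k)}-m_{\tilde\sigma(k)})_k$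 is negative. Let $E^{\mathbf m}$ be the span of the $\Phi_\sigma^{\mathbf m}$, $\sigma\in S^{\mathbf m}$, and $$B^{\mathbf m}=\bigl(E^{\mathbf m}\otimes(\mathbb C^n)^{\otimes N}\bigr)\cap\mathcal H^{(+)},\qquad W^{\mathbf m}_{(+)}=\bigcap_{i:\,m_i=m_{i+1}}\ker(P_{i,i+1}-1)\subset(\mathbb C^n)^{\otimes N}.$$ With $\check R_{i,i+1}(u)=u^{-1}+P_{i,i+1}$, operators $\check{\mathbb R}(\sigma)$ on $(\mathbb C^n)^{\otimes N}$ ($\sigma\in S^{\mathbf m}$) are defined by $\check{\mathbb R}(\mathrm{id})=1$ and $\check{\mathbb R}(\sigma(i,i+1))=\check R_{i,i+1}(-\xi_i(\sigma)+\xi_{i+1}(\sigma))\check{\mathbb R}(\sigma)$ whenever $m_{\sigma(i)}>m_{\sigma(i+1)}$. Put $U^{\mathbf m}_{(+)}v=\sum_{\sigma\in S^{\mathbf m}}\Phi^{\mathbf m}_\sigma\otimes\check{\mathbb R}(\sigma)v$ for $v\in(\mathbb C^n)^{\otimes N}$. *Yangian actions.* On $B^{\mathbf m}$, $T_{a,b}(u)$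 acts by the restriction of the $(a,b)$ entry of $\prod_{i=1}^{N}\bigl(1+\frac{P_{0,i}}{u-d_i}\bigr)$ (factors in increasing order of $i$), where $P_{0,i}=\sum_{a,b}E_{a,b}\otimes E^{(i)}_{b,a}$, expanded in $u^{-1}$. Let $p_1,\dots,p_M$ be the multiplicities of the distinct entries of $\mathbf m$ in decreasing order and $h^{(s)}=-\xi_{1+p_1+\dots+p_{s-1}}(\mathrm{id})$. Then $W^{\mathbf m}_{(+)}=V^{p_1}(h^{(1)})\otimes\cdots\otimes V^{p_M}(h^{(M)})$, where $V^p(h)$ is the symmetric power $\mathrm{Sym}^p\mathbb C^n\subset(\mathbb C^n)^{\otimes p}$ on which $T_{a,b}(u)$ acts as $\delta_{a,b}+E_{b,a}(u+h)^{-1}$, and $Y(\mathfrak{gl}_n)$ acts on the tensor product through the coproduct $\Delta(T_{a,b}(u))=\sum_cT_{a,c}(u)\otimes T_{c,b}(u)$. **Theorem.** The polynomials $\Phi^{\mathbf m}_\sigma$ ($\sigma\in S^{\mathbf m}$) and the operators $\check{\mathbb R}(\sigma)$ ($\sigma\in S^{\mathbf m}$) exist and are uniquely determined by the conditions above; the above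 formulas define $Y(\mathfrak{gl}_n)$-module structures on $W^{\mathbf m}_{(+)}$ and on $B^{\mathbf m}$; and $U^{\mathbf m}_{(+)}$ maps $W^{\mathbf m}_{(+)}$ into $B^{\mathbf m}$ and restricts to an isomorphism of $Y(\mathfrak{gl}_n)$-modules $W^{\mathbf m}_{(+)}\to B^{\mathbf m}$. -/

import Mathlib

open scoped TensorProduct

namespace SpinCS

noncomputable section

/-! ### The Yangian of `gl_n` -/

/-- Free generator `T_{a,b}^{(s)}`; the index `s = k + 1 ≥ 1` is a generator,
while `T_{a,b}^{(0)} = δ_{a,b}`. -/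
def freeT (n : ℕ) (a b : Fin n) : ℕ → FreeAlgebra ℂ (Fin n × Fin n × ℕ)
  | 0 => if a = b then 1 else 0
  | k + 1 => FreeAlgebra.ι ℂ (a, b, k)

/-- The defining relations
`[T_{ab}^{(r)}, T_{cd}^{(s+1)}] - [T_{ab}^{(r+1)}, T_{cd}^{(s)}]
  = T_{cb}^{(r)} T_{ad}^{(s)} - T_{cb}^{(s)} T_{ad}^{(r)}`. -/
inductive YangianRel (n : ℕ) :
    FreeAlgebra ℂ (Fin n × Fin n × ℕ) → FreeAlgebra ℂ (Fin n × Fin n × ℕ) → Prop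
  | rel (a b c d : Fin n) (r s : ℕ) : YangianRel n
      ((freeT n a b r * freeT n c d (s + 1) - freeT n c d (s + 1) * freeT n a b r) -
        (freeT n a b (r + 1) * freeT n c d s - freeT n c d s * freeT n a b (r + 1)))
      (freeT n c b r * freeT n a d s - freeT n c b s * freeT n a d r)

/-- The Yangian `Y(gl_n)`. -/
abbrev Yangian (n : ℕ) : Type := RingQuot (YangianRel n)

/-- The element `T_{a,b}^{(s)}` of the Yangian (`s ≥ 0`). -/
def yangianT (n : ℕ) (a b : Fin n) (s : ℕ) : Yangian n :=
  RingQuot.mkAlgHom ℂ (YangianRel n) (freeT n a b s)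

/-- The algebra homomorphism `ρ` makes the subspace `S ⊆ V` a `Y(gl_n)`-module on which
`T_{a,b}(u) = ∑_s u^{-s} T_{a,b}^{(s)}` acts by the restriction of `T a b`. In all
power series of this file the formal variable stands for `u⁻¹`. -/
def IsYangianAction {n : ℕ} {V : Type} [AddCommGroup V] [Module ℂ V] (S : Submodule ℂ V)
    (T : Matrix (Fin n) (Fin n) (PowerSeries (Module.End ℂ V)))
    (ρ : Yangian n →ₐ[ℂ] Module.End ℂ S) : Prop :=
  ∀ (a b : Fin n) (s : ℕ) (w : S),
    ((ρ (yangianT n a b s) w : S) : V) = PowerSeries.coeff s (T a b) (w : V)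

/-- The expansion `(u - d)⁻¹ = ∑_{k ≥ 0} d ^ k u^{-(k+1)}` as a power series in `u⁻¹`. -/
def resolventSeries {A : Type} [Ring A] (d : A) : PowerSeries A :=
  PowerSeries.mk fun s => match s with
    | 0 => 0
    | k + 1 => d ^ k

/-- The matrix with entries `T_{a,b}(u) = δ_{a,b} + e_{b,a} (u - d)⁻¹`. -/
def lMatrix {n : ℕ} {A : Type} [Ring A] (e : Fin n → Fin n → A) (d : A) :
    Matrix (Fin n) (Fin n) (PowerSeries A) :=
  Matrix.of fun a b => (if a = b then 1 else 0) + PowerSeries.C (e b a) * resolventSeries d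

/-! ### Laurent polynomials and Dunkl operators -/

/-- `ℂ[z_1^{±1}, …, z_N^{±1}]`: the group algebra of `ℤ^N`. -/
abbrev Laurent (N : ℕ) : Type := AddMonoidAlgebra ℂ (Fin N → ℤ)

/-- The monomial `z^a`. -/
def mono {N : ℕ} (a : Fin N → ℤ) : Laurent N := AddMonoidAlgebra.single a 1

/-- The variable `z_i`. -/
def zvar {N : ℕ} (i : Fin N) : Laurent N := mono (Pi.single i 1)

/-- The linear operator with prescribed values on the monomials. -/
def ofMono {N : ℕ} (f : (Fin N → ℤ) → Laurent N) : Laurent N →ₗ[ℂ] Laurent N :=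
  (AddMonoidAlgebra.basis (Fin N → ℤ) ℂ).constr ℂ f

/-- `K_{i,j}`, exchanging the variables `z_i` and `z_j`. -/
def Kop {N : ℕ} (i j : Fin N) : Laurent N →ₗ[ℂ] Laurent N :=
  ofMono fun a => mono (a ∘ Equiv.swap i j)

/-- `z_i ∂/∂z_i`. -/
def eulerOp {N : ℕ} (i : Fin N) : Laurent N →ₗ[ℂ] Laurent N :=
  ofMono fun a => (a i : ℂ) • mono a

/-- The divided difference `f ↦ (z_j - z_i)⁻¹ (K_{i,j} f - f)`, written out on monomials;
see `divDiff_spec`. -/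
def divDiff {N : ℕ} (i j : Fin N) : Laurent N →ₗ[ℂ] Laurent N :=
  ofMono fun a =>
    (∑ k ∈ Finset.range (a i - a j).toNat,
      mono (Function.update (Function.update a i (a i - 1 - k)) j (a j + k))) -
    ∑ k ∈ Finset.range (a j - a i).toNat,
      mono (Function.update (Function.update a i (a j - 1 - k)) j (a i + k))

lemma ofMono_mono {N : ℕ} (f : (Fin N → ℤ) → Laurent N) (a : Fin N → ℤ) :
    ofMono f (mono a) = f a := by
  have h := (AddMonoidAlgebra.basis (Fin N → ℤ) ℂ).constr_basis ℂ f a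
  rwa [AddMonoidAlgebra.basis_apply] at h

lemma mono_mul {N : ℕ} (a b : Fin N → ℤ) : mono a * mono b = mono (a + b) := by
  simp [mono, AddMonoidAlgebra.single_mul_single]

lemma divDiff_aux {N : ℕ} {i j : Fin N} (hij : i ≠ j) (a : Fin N → ℤ) (x y : ℤ) (n : ℕ) :
    (zvar j - zvar i) * ∑ k ∈ Finset.range n,
      mono (Function.update (Function.update a i (x - 1 - k)) j (y + k)) =
    mono (Function.update (Function.update a i (x - n)) j (y + n)) -
      mono (Function.update (Function.update a i x) j y) := by
  induction n with
  | zero => simp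
  | succ n ih =>
    rw [Finset.sum_range_succ, mul_add, ih, sub_mul, zvar, zvar, mono_mul, mono_mul]
    have h1 : (Pi.single j 1 : Fin N → ℤ) +
        Function.update (Function.update a i (x - 1 - n)) j (y + n) =
        Function.update (Function.update a i (x - (n + 1 : ℕ))) j (y + (n + 1 : ℕ)) := by
      ext t
      by_cases h : t = j
      · subst h; simp; ring
      · by_cases h' : t = i
        · subst h'; simp [h]; ring
        · simp [h, h']
    have h2 : (Pi.single i 1 : Fin N → ℤ) +
        Function.update (Function.update a i (x - 1 - n)) j (y + n) =
        Function.update (Function.update a i (x - n)) j (y + n) := by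
      ext t
      by_cases h : t = j
      · subst h; simp [hij.symm]
      · by_cases h' : t = i
        · subst h'; simp [h]; ring
        · simp [h, h']
    rw [h1, h2]
    ring

theorem divDiff_spec {N : ℕ} {i j : Fin N} (hij : i ≠ j) (f : Laurent N) :
    (zvar j - zvar i) * divDiff i j f = Kop i j f - f := by
  have key : LinearMap.mulLeft ℂ (zvar j - zvar i) ∘ₗ divDiff i j =
      Kop i j - LinearMap.id := by
    refine (AddMonoidAlgebra.basis (Fin N → ℤ) ℂ).ext fun a => ?_
    rw [AddMonoidAlgebra.basis_apply]
    change (zvar j - zvar i) * divDiff i j (mono a) = Kop i j (mono a) - mono a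
    rw [divDiff, Kop, ofMono_mono, ofMono_mono, mul_sub, divDiff_aux hij, divDiff_aux hij]
    have hs : a ∘ Equiv.swap i j = Function.update (Function.update a i (a j)) j (a i) := by
      ext t
      by_cases h : t = j
      · subst h; simp
      · by_cases h' : t = i
        · subst h'; simp [h]
        · simp [h, h', Equiv.swap_apply_of_ne_of_ne h' h]
    have ha : Function.update (Function.update a i (a i)) j (a j) = a := by simp
    rw [hs]
    rcases le_total (a i) (a j) with h | h
    · have e1 : (a i - a j).toNat = 0 := by omega
      have e2 : ((a j - a i).toNat : ℤ) = a j - a i := by omega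
      rw [e1, e2]
      have e3 : a j - (a j - a i) = a i := by ring
      have e4 : a i + (a j - a i) = a j := by ring
      rw [e3, e4, ha]; simp
    · have e1 : (a j - a i).toNat = 0 := by omega
      have e2 : ((a i - a j).toNat : ℤ) = a i - a j := by omega
      rw [e1, e2]
      have e3 : a i - (a i - a j) = a j := by ring
      have e4 : a j + (a i - a j) = a i := by ring
      rw [e3, e4, ha]; simp
  exact LinearMap.congr_fun key f

/-- The Dunkl operator
`d_i = α z_i ∂_i - i + ∑_{j > i} z_j/(z_j - z_i) (K_{ij} - 1) - ∑_{j < i} z_i/(z_i - z_j) (K_{ij} - 1)`,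
where the position of `i : Fin N`, counted from `1`, is `i + 1`. -/
def dunkl {N : ℕ} (α : ℝ) (i : Fin N) : Laurent N →ₗ[ℂ] Laurent N :=
  (α : ℂ) • eulerOp i - (((i : ℕ) : ℂ) + 1) • LinearMap.id
    + ∑ j ∈ Finset.Ioi i, LinearMap.mulLeft ℂ (zvar j) ∘ₗ divDiff i j
    - ∑ j ∈ Finset.Iio i, LinearMap.mulLeft ℂ (zvar i) ∘ₗ divDiff j i

/-! ### Non-symmetric Jack polynomials -/

/-- `S^m`: the permutations `σ` with
`σ(i) = #{j ≤ i | m_{σ(j)} ≥ m_{σ(i)}} + #{j > i | m_{σ(j)} > m_{σ(i)}}` (positions from `1`). -/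
def sortSet {N : ℕ} (m : Fin N → ℤ) : Finset (Equiv.Perm (Fin N)) :=
  Finset.univ.filter fun σ => ∀ i : Fin N,
    ((σ i : Fin N) : ℕ) + 1 =
      (Finset.univ.filter fun j : Fin N => j ≤ i ∧ m (σ i) ≤ m (σ j)).card +
      (Finset.univ.filter fun j : Fin N => i < j ∧ m (σ i) < m (σ j)).card

/-- `σ ≻ σ'`: the last non-zero entry of `(m_{σ(k)} - m_{σ'(k)})_k` is negative. -/
def PermGT {N : ℕ} (m : Fin N → ℤ) (σ σ' : Equiv.Perm (Fin N)) : Prop :=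
  ∃ k : Fin N, m (σ k) - m (σ' k) < 0 ∧ ∀ j : Fin N, k < j → m (σ j) - m (σ' j) = 0

/-- Strict dominance order `m > m'`. -/
def DomGT {N : ℕ} (m m' : Fin N → ℤ) : Prop :=
  m ≠ m' ∧ ∑ i, m i = ∑ i, m' i ∧
    ∀ k : Fin N, ∑ i ∈ Finset.Iic k, m' i ≤ ∑ i ∈ Finset.Iic k, m i

/-- `(m, σ) > (m', σ')`. -/
def PairGT {N : ℕ} (m : Fin N → ℤ) (σ : Equiv.Perm (Fin N)) (m' : Fin N → ℤ)
    (σ' : Equiv.Perm (Fin N)) : Prop :=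
  DomGT m m' ∨ (m = m' ∧ PermGT m σ σ')

/-- `ξ_i^m(σ) = α m_{σ(i)} - σ(i)`. -/
def xi {N : ℕ} (α : ℝ) (m : Fin N → ℤ) (σ : Equiv.Perm (Fin N)) (i : Fin N) : ℂ :=
  (α : ℂ) * (m (σ i) : ℂ) - ((((σ i : Fin N) : ℕ) : ℂ) + 1)

/-- `Φ` is the non-symmetric Jack polynomial `Φ_σ^m`: a joint eigenvector of the Dunkl operators
with eigenvalues `ξ_i^m(σ)`, of the form `z^{σ.m}` plus a combination of monomials `z^{σ'.m'}`
with `(m', σ') < (m, σ)`. -/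
def IsNonsymJack {N : ℕ} (α : ℝ) (m : Fin N → ℤ) (σ : Equiv.Perm (Fin N))
    (Φ : Laurent N) : Prop :=
  (∀ i : Fin N, dunkl α i Φ = xi α m σ i • Φ) ∧
  Φ.coeff (m ∘ σ) = 1 ∧
  ∀ a : Fin N → ℤ, Φ.coeff a ≠ 0 → a = m ∘ σ ∨
    ∃ (m' : Fin N → ℤ) (σ' : Equiv.Perm (Fin N)),
      Antitone m' ∧ σ' ∈ sortSet m' ∧ PairGT m σ m' σ' ∧ a = m' ∘ σ'

/-- `Φ_σ^m`. Its existence and uniqueness is part of the theorem. -/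
def nonsymJack {N : ℕ} (α : ℝ) (m : Fin N → ℤ) (σ : Equiv.Perm (Fin N)) : Laurent N :=
  Classical.epsilon (IsNonsymJack α m σ)

/-- `E^m`, the span of the `Φ_σ^m`, `σ ∈ S^m`. -/
def Espace {N : ℕ} (α : ℝ) (m : Fin N → ℤ) : Submodule ℂ (Laurent N) :=
  Submodule.span ℂ (Set.range fun σ : sortSet m => nonsymJack α m σ.1)

/-! ### Spins and the space of states -/

/-- `⊗^N ℂ^n`. -/
abbrev Spins (n N : ℕ) : Type := ⨂[ℂ] _ : Fin N, (Fin n → ℂ)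

/-- `H = ℂ[z_1^{±1}, …, z_N^{±1}] ⊗ (⊗^N ℂ^n)`. -/
abbrev States (n N : ℕ) : Type := Laurent N ⊗[ℂ] Spins n N

/-- `P_{i,j}`, exchanging the `i`-th and the `j`-th tensor factors. -/
def Pop (n : ℕ) {N : ℕ} (i j : Fin N) : Module.End ℂ (Spins n N) :=
  (PiTensorProduct.reindex ℂ (fun _ : Fin N => (Fin n → ℂ)) (Equiv.swap i j)).toLinearMap

/-- The matrix unit `E_{a,b}` acting in the `i`-th tensor factor. -/
def siteE {n N : ℕ} (i : Fin N) (a b : Fin n) : Module.End ℂ (Spins n N) :=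
  PiTensorProduct.map
    (Function.update (fun _ : Fin N => (LinearMap.id : (Fin n → ℂ) →ₗ[ℂ] (Fin n → ℂ))) i
      (Matrix.toLin' (Matrix.single a b (1 : ℂ))))

/-- Operators on the first tensor factor of `H`. -/
def onPoly (n : ℕ) {N : ℕ} (f : Laurent N →ₗ[ℂ] Laurent N) : Module.End ℂ (States n N) :=
  LinearMap.rTensor (Spins n N) f

/-- Operators on the second tensor factor of `H`. -/
def onSpin {n N : ℕ} (g : Module.End ℂ (Spins n N)) : Module.End ℂ (States n N) :=
  LinearMap.lTensor (Laurent N) g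

/-- `j` is the position following `i`. -/
def Adj {N : ℕ} (i j : Fin N) : Prop := (i : ℕ) + 1 = (j : ℕ)

/-- The bosonic space of states `H^{(+)} = ⋂_i Ker (K_{i,i+1} P_{i,i+1} - 1)`. -/
def Hplus (n N : ℕ) : Submodule ℂ (States n N) :=
  ⨅ (i : Fin N) (j : Fin N) (_ : Adj i j),
    LinearMap.ker (onPoly n (Kop i j) * onSpin (Pop n i j) - 1)

/-- `B^m = (E^m ⊗ (⊗^N ℂ^n)) ∩ H^{(+)}`. -/
def Bspace (n : ℕ) {N : ℕ} (α : ℝ) (m : Fin N → ℤ) : Submodule ℂ (States n N) :=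
  LinearMap.range (LinearMap.rTensor (Spins n N) (Espace α m).subtype) ⊓ Hplus n N

/-- The bosonic monodromy matrix: the product over `i = 1, …, N`, in this order, of
`1 + P_{0,i} (u - d_i)⁻¹`, where `P_{0,i} = ∑_{a,b} E_{a,b} ⊗ E_{b,a}^{(i)}`. -/
def monodromyH (n N : ℕ) (α : ℝ) :
    Matrix (Fin n) (Fin n) (PowerSeries (Module.End ℂ (States n N))) :=
  (List.ofFn fun i : Fin N =>
    lMatrix (fun a b => onSpin (siteE i a b)) (onPoly n (dunkl α i))).prod

/-! ### The module `W^m` -/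

/-- `W^m = ⋂_{i : m_i = m_{i+1}} Ker (P_{i,i+1} - 1)`. If `m` takes its distinct values with
multiplicities `p_1, …, p_M`, this is `Sym^{p_1} ⊗ ⋯ ⊗ Sym^{p_M}` inside `⊗^N ℂ^n`. -/
def Wspace (n : ℕ) {N : ℕ} (m : Fin N → ℤ) : Submodule ℂ (Spins n N) :=
  ⨅ (i : Fin N) (j : Fin N) (_ : Adj i j ∧ m i = m j), LinearMap.ker (Pop n i j - 1)

/-- The distinct values of `m` in decreasing order; the `s`-th value belongs to the `s`-th block
of positions, whose length is `p_s`. -/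
def blockValues {N : ℕ} (m : Fin N → ℤ) : List ℤ :=
  (Finset.univ.image m).sort (· ≥ ·)

/-- `h^{(s)} = -ξ_{1 + p_1 + ⋯ + p_{s-1}}^m(id)`, for the block on which `m` has the value `c`:
here `p_1 + ⋯ + p_{s-1} = #{i | m_i > c}`. -/
def blockShift {N : ℕ} (α : ℝ) (m : Fin N → ℤ) (c : ℤ) : ℂ :=
  -((α : ℂ) * (c : ℂ) - (1 + ((Finset.univ.filter fun i : Fin N => c < m i).card : ℂ)))

/-- The action of `gl_n` on the tensor factors of the block on which `m` has the value `c`. -/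
def blockE {n N : ℕ} (m : Fin N → ℤ) (c : ℤ) (a b : Fin n) : Module.End ℂ (Spins n N) :=
  ∑ i ∈ Finset.univ.filter (fun i : Fin N => m i = c), siteE i a b

/-- The action of `T_{a,b}(u)` on `V^{p_1}(h^{(1)}) ⊗ ⋯ ⊗ V^{p_M}(h^{(M)})`: on `V^p(h)` it is
`T_{a,b}(u) = δ_{a,b} + E_{b,a} (u + h)⁻¹`, and the coproduct
`Δ(T_{a,b}(u)) = ∑_c T_{a,c}(u) ⊗ T_{c,b}(u)` makes the action on the tensor product the matrix
product of the actions on the factors. -/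
def monodromyW (n : ℕ) {N : ℕ} (α : ℝ) (m : Fin N → ℤ) :
    Matrix (Fin n) (Fin n) (PowerSeries (Module.End ℂ (Spins n N))) :=
  ((blockValues m).map fun c =>
    lMatrix (blockE m c) (algebraMap ℂ (Module.End ℂ (Spins n N)) (-blockShift α m c))).prod

/-! ### The intertwiner -/

/-- `Ř_{i,j}(u) = u⁻¹ + P_{i,j}`. -/
def Rcheck (n : ℕ) {N : ℕ} (i j : Fin N) (u : ℂ) : Module.End ℂ (Spins n N) :=
  algebraMap ℂ (Module.End ℂ (Spins n N)) u⁻¹ + Pop n i j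

/-- The recursion for `σ ↦ Ř^{(+)}(σ)`, `σ ∈ S^m`: `Ř(id) = 1` and, if `m_{σ(i)} > m_{σ(i+1)}`,
`Ř(σ (i,i+1)) = Ř_{i,i+1}(-ξ_i(σ) + ξ_{i+1}(σ)) Ř(σ)`. -/
def IsRFamily (n : ℕ) {N : ℕ} (α : ℝ) (m : Fin N → ℤ)
    (R : sortSet m → Module.End ℂ (Spins n N)) : Prop :=
  (∀ σ : sortSet m, σ.1 = 1 → R σ = 1) ∧
  ∀ (σ τ : sortSet m) (i j : Fin N), Adj i j → m (σ.1 j) < m (σ.1 i) →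
    τ.1 = σ.1 * Equiv.swap i j →
    R τ = Rcheck n i j (-xi α m σ.1 i + xi α m σ.1 j) * R σ

/-- The operators `Ř^{(+)}(σ)`. That the recursion has exactly one solution is part of the
theorem. -/
def Rfamily (n : ℕ) {N : ℕ} (α : ℝ) (m : Fin N → ℤ) :
    sortSet m → Module.End ℂ (Spins n N) :=
  Classical.epsilon (IsRFamily n α m)

/-- `U^m v = ∑_{σ ∈ S^m} Φ_σ^m ⊗ Ř^{(+)}(σ) v`. -/
def Umap (n : ℕ) {N : ℕ} (α : ℝ) (m : Fin N → ℤ) : Spins n N →ₗ[ℂ] States n N :=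
  ∑ σ : sortSet m,
    TensorProduct.mk ℂ (Laurent N) (Spins n N) (nonsymJack α m σ.1) ∘ₗ Rfamily n α m σ

end

end SpinCS

open scoped TensorProduct

namespace SpinCS

noncomputable section

/-! ### Operators on the tensor power of `ℂ^n` -/

/-! Everything rests on joint eigenvectors of the Dunkl operators. On monomials the `d_i` are
triangular for the given order, with diagonal entries `spec α a i` (`dunkl_mono_mem`). As `α > 0`, a
composition can be read off from its spectrum (`spec_eq`). Hence a non-zero joint eigenvector has
one leading monomial above all its others and is determined by its leading coefficient
(`IsEig.leading`, `IsEig.eq_zero`). Existence does not use that the `d_i` commute: starting from the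
constant `1`, the intertwiners `K_{i,i+1} + c` permute the spectrum, the shift operator rotates a
composition and raises one entry, and these moves connect all compositions (`hasEig`).

Comparing spectra and leading coefficients shows that `K_{i,i+1}` fixes `Φ_σ` or mixes it with
`Φ_{σ(i,i+1)}` only (`Kop_nonsymJack`). Therefore `∑ Φ_σ ⊗ v_σ` is bosonic exactly when the `v_σ`
obey the recursion of the `Ř(σ)` and are symmetric in neighbouring positions with equal entries
(`jackSum_mem_Hplus_iff`). Such a family is determined by `v_id`, which lies in `W`. Conversely, the
operators `Ř(σ)` are well defined by the Yang–Baxter equation (`Rperm_step`), and `Ř(σ) w` has the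
required symmetry for `w ∈ W` (`Pop_Rfamily`). So `U` is a linear isomorphism.

On `Φ_σ ⊗ v` the operators `d_i` act as the numbers `ξ_i(σ)`, and the monodromy matrix becomes a
product of `L`-operators with scalar parameters. Each factor of `Ř(σ)` exchanges two neighbouring
parameters (`prefixMonodromy_intertwining`), so every component reduces to the parameters `ξ(id)`.
Inside a block of equal entries these decrease by one from position to position, and on symmetric
vectors the product fuses into a single evaluation `L`-operator (`prefixMonodromy_fusion`); this is
the action on `W`. The Yangian relations on `W` follow from the evaluation homomorphism
(`isRTT_lMatrix`) and the coproduct (`IsRTT.mul`); those on `B` are transported along `U`. -/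

/-- The action of the symmetric group on `⊗^N ℂ^n` by permutations of the factors. -/
def spinPerm (n N : ℕ) : Equiv.Perm (Fin N) →* Module.End ℂ (Spins n N) where
  toFun e := (PiTensorProduct.reindex ℂ (fun _ : Fin N => (Fin n → ℂ)) e).toLinearMap
  map_one' := PiTensorProduct.ext <| MultilinearMap.ext fun v =>
    PiTensorProduct.reindex_tprod (R := ℂ) (s := fun _ : Fin N => (Fin n → ℂ)) 1 v
  map_mul' e f := PiTensorProduct.ext <| MultilinearMap.ext fun v => by
    change PiTensorProduct.reindex ℂ (fun _ : Fin N => (Fin n → ℂ)) (e * f)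
      (PiTensorProduct.tprod ℂ v) = PiTensorProduct.reindex ℂ (fun _ : Fin N => (Fin n → ℂ)) e
        (PiTensorProduct.reindex ℂ (fun _ : Fin N => (Fin n → ℂ)) f (PiTensorProduct.tprod ℂ v))
    rw [PiTensorProduct.reindex_tprod, PiTensorProduct.reindex_tprod,
      PiTensorProduct.reindex_tprod]
    rfl

lemma spinPerm_tprod {n N : ℕ} (e : Equiv.Perm (Fin N)) (v : Fin N → Fin n → ℂ) :
    spinPerm n N e (PiTensorProduct.tprod ℂ v) =
      PiTensorProduct.tprod ℂ (fun i => v (e.symm i)) :=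
  PiTensorProduct.reindex_tprod _ _

lemma Pop_eq {n N : ℕ} (i j : Fin N) : Pop n i j = spinPerm n N (Equiv.swap i j) := rfl

lemma siteE_tprod {n N : ℕ} (i : Fin N) (a b : Fin n) (v : Fin N → Fin n → ℂ) :
    siteE i a b (PiTensorProduct.tprod ℂ v) =
      PiTensorProduct.tprod ℂ (Function.update v i (Pi.single a (v i b))) := by
  rw [siteE, PiTensorProduct.map_tprod]
  congr 1
  ext k c
  by_cases h : k = i
  · subst h
    simp [Matrix.single_mulVec, Function.update_apply, Pi.single_apply]
  · simp [h]

lemma spin_ext {n N : ℕ} {f g : Module.End ℂ (Spins n N)}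
    (h : ∀ v : Fin N → Fin n → ℂ, f (PiTensorProduct.tprod ℂ v) = g (PiTensorProduct.tprod ℂ v)) :
    f = g :=
  PiTensorProduct.ext (MultilinearMap.ext h)

lemma spinPerm_mul_siteE {n N : ℕ} (e : Equiv.Perm (Fin N)) (k : Fin N) (a b : Fin n) :
    spinPerm n N e * siteE k a b = siteE (e k) a b * spinPerm n N e := by
  refine spin_ext fun v => ?_
  simp only [Module.End.mul_apply, siteE_tprod, spinPerm_tprod]
  congr 1
  ext i c
  by_cases h : i = e k
  · subst h; simp
  · have h' : e.symm i ≠ k := fun h' => h (by rw [← h']; simp)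
    simp [h, h']

lemma Pop_mul_siteE {n N : ℕ} (i j k : Fin N) (a b : Fin n) :
    Pop n i j * siteE k a b = siteE (Equiv.swap i j k) a b * Pop n i j :=
  spinPerm_mul_siteE _ _ _ _

lemma Pop_mul_self {n N : ℕ} (i j : Fin N) : Pop n i j * Pop n i j = 1 := by
  rw [Pop_eq, ← map_mul, Equiv.swap_mul_self, map_one]

lemma swap_comm_of_disjoint {N : ℕ} {i j k l : Fin N} (h1 : i ≠ k) (h2 : i ≠ l) (h3 : j ≠ k)
    (h4 : j ≠ l) : Equiv.swap i j * Equiv.swap k l = Equiv.swap k l * Equiv.swap i j := by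
  ext t
  simp only [Equiv.Perm.mul_apply, Equiv.swap_apply_def]
  split_ifs <;> simp_all

lemma swap_braid {N : ℕ} {i j k : Fin N} (h1 : i ≠ j) (h2 : j ≠ k) (h3 : i ≠ k) :
    Equiv.swap i j * Equiv.swap j k * Equiv.swap i j =
      Equiv.swap j k * Equiv.swap i j * Equiv.swap j k := by
  ext t
  simp only [Equiv.Perm.mul_apply, Equiv.swap_apply_def]
  split_ifs <;> simp_all

lemma Pop_comm {n N : ℕ} {i j k l : Fin N} (h1 : i ≠ k) (h2 : i ≠ l) (h3 : j ≠ k) (h4 : j ≠ l) :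
    Pop n i j * Pop n k l = Pop n k l * Pop n i j := by
  rw [Pop_eq, Pop_eq, ← map_mul, ← map_mul, swap_comm_of_disjoint h1 h2 h3 h4]

lemma Pop_braid {n N : ℕ} {i j k : Fin N} (h1 : i ≠ j) (h2 : j ≠ k) (h3 : i ≠ k) :
    Pop n i j * Pop n j k * Pop n i j = Pop n j k * Pop n i j * Pop n j k := by
  simp only [Pop_eq, ← map_mul, swap_braid h1 h2 h3]

lemma siteE_mul_same {n N : ℕ} (i : Fin N) (a b c d : Fin n) :
    siteE i a b * siteE i c d = if b = c then siteE i a d else 0 := by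
  refine spin_ext fun v => ?_
  rw [Module.End.mul_apply, siteE_tprod, siteE_tprod]
  split_ifs with h
  · subst h; simp [siteE_tprod]
  · simp only [Function.update_self, Function.update_idem, LinearMap.zero_apply]
    apply (PiTensorProduct.tprod ℂ).map_coord_zero i
    simp [h]

lemma siteE_comm {n N : ℕ} {i j : Fin N} (h : i ≠ j) (a b c d : Fin n) :
    siteE i a b * siteE j c d = siteE j c d * siteE i a b := by
  refine spin_ext fun v => ?_
  simp only [Module.End.mul_apply, siteE_tprod]
  rw [Function.update_comm h]
  simp [h, h.symm]

/-- The matrix elements of `P_{0,i} P_{0,j} = P_{0,j} P_{i,j}`. -/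
lemma sum_siteE_mul_siteE {n N : ℕ} {i j : Fin N} (h : i ≠ j) (a b : Fin n) :
    ∑ c, siteE i c a * siteE j b c = siteE j b a * Pop n i j := by
  refine spin_ext fun v => ?_
  rw [LinearMap.sum_apply]
  simp only [Module.End.mul_apply, siteE_tprod, Pop_eq, spinPerm_tprod]
  -- By multilinearity the scalars `v i a` and `v j c` may trade slots; the sum over `c` then
  -- rebuilds the vector `v j` in slot `i`.
  have h1 : ∀ c : Fin n, PiTensorProduct.tprod ℂ
      (Function.update (Function.update v j (Pi.single b (v j c))) i
        (Pi.single c (Function.update v j (Pi.single b (v j c)) i a))) =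
      PiTensorProduct.tprod ℂ
      (Function.update (Function.update v j (Pi.single b (v i a))) i
        (Pi.single c (v j c))) := by
    intro c
    have e1 : (Pi.single b (v j c) : Fin n → ℂ) = v j c • Pi.single b 1 := by
      rw [← Pi.single_smul]; simp
    have e2 : (Pi.single b (v i a) : Fin n → ℂ) = v i a • Pi.single b 1 := by
      rw [← Pi.single_smul]; simp
    have e3 : (Pi.single c (v i a) : Fin n → ℂ) = v i a • Pi.single c 1 := by
      rw [← Pi.single_smul]; simp
    have e4 : (Pi.single c (v j c) : Fin n → ℂ) = v j c • Pi.single c 1 := by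
      rw [← Pi.single_smul]; simp
    rw [Function.update_of_ne h, e3, e4, e1, e2, (PiTensorProduct.tprod ℂ).map_update_smul,
      (PiTensorProduct.tprod ℂ).map_update_smul, Function.update_comm h.symm,
      (PiTensorProduct.tprod ℂ).map_update_smul, Function.update_comm h.symm,
      (PiTensorProduct.tprod ℂ).map_update_smul, smul_comm]
  rw [Finset.sum_congr rfl fun c _ => h1 c, ← (PiTensorProduct.tprod ℂ).map_update_sum]
  congr 1
  have h2 : ∑ c, (Pi.single c (v j c) : Fin n → ℂ) = v j := by
    ext d; simp [Finset.sum_apply, Pi.single_apply]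
  rw [h2]
  ext t c
  by_cases ht : t = i
  · subst ht; simp [h]
  · by_cases ht' : t = j
    · subst ht'; simp [ht]
    · simp [ht, ht', Equiv.swap_apply_of_ne_of_ne]

/-! ### Adjacent transpositions -/

lemma Adj.lt {N : ℕ} {i j : Fin N} (h : Adj i j) : i < j := by
  unfold Adj at h; rw [Fin.lt_def]; omega

lemma Adj.ne {N : ℕ} {i j : Fin N} (h : Adj i j) : i ≠ j := h.lt.ne

/-- An adjacent transposition reverses the order of a single pair, the one it exchanges. -/
lemma swap_lt_swap {N : ℕ} {i j p q : Fin N} (h : Adj i j) (hpq : p < q)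
    (hne : ¬ (p = i ∧ q = j)) : Equiv.swap i j p < Equiv.swap i j q := by
  unfold Adj at h
  simp only [Equiv.swap_apply_def]
  simp only [Fin.lt_def, Fin.ext_iff] at *
  split_ifs <;> omega

lemma monotone_of_adj {N : ℕ} {β : Type} [Preorder β] {f : Fin N → β}
    (h : ∀ i j, Adj i j → f i ≤ f j) : Monotone f := by
  cases N with
  | zero => exact fun i => i.elim0
  | succ N => exact Fin.monotone_iff_le_succ.2 fun i => h _ _ (by simp [Adj])

lemma perm_eq_one_of_monotone {N : ℕ} {w : Equiv.Perm (Fin N)} (h : Monotone w) : w = 1 := by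
  have h1 : StrictMono w := h.strictMono_of_injective w.injective
  have h2 := h1.range_inj (g := id) strictMono_id |>.1 (by simp)
  exact Equiv.ext fun i => congrFun h2 i

/-- A height function on permutations that decreases when a descent is removed. -/
def permHeight {N : ℕ} (w : Equiv.Perm (Fin N)) : ℕ := ∑ k : Fin N, (N - (k : ℕ)) * (w k : ℕ)

lemma sum_mul_swap {N : ℕ} (g f : Fin N → ℤ) {i j : Fin N} (hij : i ≠ j) :
    ∑ k, g k * f (Equiv.swap i j k) = ∑ k, g k * f k + (g i - g j) * (f j - f i) := by
  have h : ∑ k, (g k * f (Equiv.swap i j k) - g k * f k) = (g i - g j) * (f j - f i) := by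
    rw [Fintype.sum_eq_add i j hij]
    · simp; ring
    · rintro k ⟨h1, h2⟩
      rw [Equiv.swap_apply_of_ne_of_ne h1 h2, sub_self]
  rw [Finset.sum_sub_distrib] at h
  linarith

lemma permHeight_lt {N : ℕ} {w : Equiv.Perm (Fin N)} {i j : Fin N} (h : Adj i j)
    (hw : w j < w i) : permHeight (w * Equiv.swap i j) < permHeight w := by
  have key := sum_mul_swap (fun k : Fin N => ((N - (k : ℕ) : ℕ) : ℤ)) (fun k => ((w k : ℕ) : ℤ)) h.ne
  unfold Adj at h
  -- Neighbouring weights differ by exactly one, so the height changes by `w j - w i`.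
  have h1 : ((N - (i : ℕ) : ℕ) : ℤ) - ((N - (j : ℕ) : ℕ) : ℤ) = 1 := by omega
  rw [h1] at key
  have h2 : ((w j : ℕ) : ℤ) < (w i : ℕ) := by exact_mod_cast hw
  rw [← Int.ofNat_lt]
  simp only [permHeight, Nat.cast_sum, Nat.cast_mul, Equiv.Perm.mul_apply]
  linarith

/-! ### The operators `Ř` for all permutations -/

/-- After expansion the cubic terms agree by the braid relation, and only the coefficients of `P`
and `Q` still differ. The hypothesis `h` removes this difference; it holds when `a`, `b`, `c` are
the inverses of `u`, `v`, `u + v`. -/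
lemma yang_baxter {A : Type} [Ring A] [Algebra ℂ A] {P Q : A} (hP : P * P = 1) (hQ : Q * Q = 1)
    (hPQ : P * Q * P = Q * P * Q) {a b c : ℂ} (h : c * (a + b) = a * b) :
    (algebraMap ℂ A a + P) * (algebraMap ℂ A c + Q) * (algebraMap ℂ A b + P) =
      (algebraMap ℂ A b + Q) * (algebraMap ℂ A c + P) * (algebraMap ℂ A a + Q) := by
  simp only [Algebra.algebraMap_eq_smul_one, add_mul, mul_add, smul_mul_assoc, mul_smul_comm,
    one_mul, mul_one, hP, hQ, hPQ]
  linear_combination (norm := module) h • P - h • Q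

lemma Rcheck_yang_baxter {n N : ℕ} {i j k : Fin N} (h1 : i ≠ j) (h2 : j ≠ k) (h3 : i ≠ k)
    {x y z : ℂ} (hxy : x ≠ y) (hyz : y ≠ z) (hxz : x ≠ z) :
    Rcheck n i j (x - y) * Rcheck n j k (x - z) * Rcheck n i j (y - z) =
      Rcheck n j k (y - z) * Rcheck n i j (x - z) * Rcheck n j k (x - y) := by
  refine yang_baxter (A := Module.End ℂ (Spins n N)) (Pop_mul_self _ _) (Pop_mul_self _ _) (Pop_braid h1 h2 h3) ?_
  have e1 := sub_ne_zero.2 hxy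
  have e2 := sub_ne_zero.2 hyz
  have e3 := sub_ne_zero.2 hxz
  field_simp
  ring

lemma Rcheck_comm {n N : ℕ} {i j k l : Fin N} (h1 : i ≠ k) (h2 : i ≠ l) (h3 : j ≠ k) (h4 : j ≠ l)
    (u v : ℂ) : Rcheck n i j u * Rcheck n k l v = Rcheck n k l v * Rcheck n i j u := by
  have h : Commute (Pop n i j) (Pop n k l) := Pop_comm h1 h2 h3 h4
  exact Commute.add_left (Algebra.commute_algebraMap_left _ _)
    (Commute.add_right (Algebra.commute_algebraMap_right _ _) h)

open Classical in
/-- The operators `Ř(w)` for all permutations `w` and arbitrary spectral parameters. -/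
def Rperm (n : ℕ) {N : ℕ} (x : Fin N → ℂ) (w : Equiv.Perm (Fin N)) : Module.End ℂ (Spins n N) :=
  if h : ∃ p : Fin N × Fin N, Adj p.1 p.2 ∧ w p.2 < w p.1 then
    have : permHeight (w * Equiv.swap h.choose.1 h.choose.2) < permHeight w :=
      permHeight_lt h.choose_spec.1 h.choose_spec.2
    Rcheck n h.choose.1 h.choose.2 (x (w h.choose.1) - x (w h.choose.2)) *
      Rperm n x (w * Equiv.swap h.choose.1 h.choose.2)
  else 1
termination_by permHeight w

lemma Rperm_one (n : ℕ) {N : ℕ} (x : Fin N → ℂ) : Rperm n x 1 = 1 := by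
  rw [Rperm, dif_neg]
  rintro ⟨p, hp, h⟩
  exact lt_asymm hp.lt h

lemma Rperm_exists_step (n : ℕ) {N : ℕ} (x : Fin N → ℂ) {w : Equiv.Perm (Fin N)}
    (h : ∃ p : Fin N × Fin N, Adj p.1 p.2 ∧ w p.2 < w p.1) :
    ∃ i j, Adj i j ∧ w j < w i ∧
      Rperm n x w = Rcheck n i j (x (w i) - x (w j)) * Rperm n x (w * Equiv.swap i j) := by
  refine ⟨_, _, h.choose_spec.1, h.choose_spec.2, ?_⟩
  rw [Rperm, dif_pos h]

/-- Two overlapping descents: both sides can be unwound, by the induction hypothesis, to three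
factors times the value at the same shorter permutation, and the triple products agree by
Yang–Baxter. Injectivity of `x` keeps all spectral parameters non-zero. -/
lemma Rperm_braid_step {n N : ℕ} {x : Fin N → ℂ} (hx : Function.Injective x)
    {w : Equiv.Perm (Fin N)}
    (ih : ∀ w' : Equiv.Perm (Fin N), permHeight w' < permHeight w → ∀ i j, Adj i j → w' j < w' i →
      Rperm n x w' = Rcheck n i j (x (w' i) - x (w' j)) * Rperm n x (w' * Equiv.swap i j))
    {i j k : Fin N} (hij : Adj i j) (hjk : Adj j k) (h1 : w j < w i) (h2 : w k < w j) :
    Rcheck n i j (x (w i) - x (w j)) * Rperm n x (w * Equiv.swap i j) =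
      Rcheck n j k (x (w j) - x (w k)) * Rperm n x (w * Equiv.swap j k) := by
  have nij := hij.ne
  have njk := hjk.ne
  have nik := (hij.lt.trans hjk.lt).ne
  have si : Equiv.swap j k i = i := Equiv.swap_apply_of_ne_of_ne nij nik
  have sk : Equiv.swap i j k = k := Equiv.swap_apply_of_ne_of_ne nik.symm njk.symm
  have l1 := permHeight_lt hij h1
  have l2 := permHeight_lt hjk h2
  have d1 : (w * Equiv.swap i j) k < (w * Equiv.swap i j) j := by
    simpa [sk] using h2.trans h1
  have d2 : (w * Equiv.swap j k) j < (w * Equiv.swap j k) i := by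
    simpa [si] using h2.trans h1
  have l1' := (permHeight_lt hjk d1).trans l1
  have l2' := (permHeight_lt hij d2).trans l2
  have d1' : (w * Equiv.swap i j * Equiv.swap j k) j < (w * Equiv.swap i j * Equiv.swap j k) i := by
    simpa [sk, si] using h2
  have d2' : (w * Equiv.swap j k * Equiv.swap i j) k < (w * Equiv.swap j k * Equiv.swap i j) j := by
    simpa [sk, si] using h1
  rw [ih _ l1 _ _ hjk d1, ih _ l1' _ _ hij d1', ih _ l2 _ _ hij d2, ih _ l2' _ _ hjk d2']
  have e : w * Equiv.swap i j * Equiv.swap j k * Equiv.swap i j =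
      w * Equiv.swap j k * Equiv.swap i j * Equiv.swap j k := by
    simp only [mul_assoc w, swap_braid nij njk nik]
  rw [e]
  simp only [Equiv.Perm.mul_apply, si, sk, Equiv.swap_apply_left, Equiv.swap_apply_right]
  simp only [← mul_assoc]
  rw [Rcheck_yang_baxter nij njk nik (hx.ne h1.ne') (hx.ne h2.ne') (hx.ne (h2.trans h1).ne')]

/-- The definition of `Rperm` picks some descent; this says that every descent gives the same
operator. By induction on the height, the chosen descent is compared with the given one: they
coincide, overlap (Yang–Baxter), or are disjoint, where the factors commute. -/
theorem Rperm_step (n : ℕ) {N : ℕ} {x : Fin N → ℂ} (hx : Function.Injective x)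
    (w : Equiv.Perm (Fin N)) : ∀ i j, Adj i j → w j < w i →
      Rperm n x w = Rcheck n i j (x (w i) - x (w j)) * Rperm n x (w * Equiv.swap i j) := by
  induction hh : permHeight w using Nat.strong_induction_on generalizing w with
  | _ h ih =>
  subst hh
  intro i j hij hw
  have ih' : ∀ w' : Equiv.Perm (Fin N), permHeight w' < permHeight w → ∀ i j, Adj i j →
      w' j < w' i →
      Rperm n x w' = Rcheck n i j (x (w' i) - x (w' j)) * Rperm n x (w' * Equiv.swap i j) :=
    fun w' hlt => ih _ hlt w' rfl
  obtain ⟨p, q, hpq, hwpq, e⟩ := Rperm_exists_step n x ⟨(i, j), hij, hw⟩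
  rw [e]
  by_cases c1 : p = i
  · subst c1
    have : q = j := by unfold Adj at *; ext; omega
    rw [this]
  by_cases c2 : p = j
  · subst c2
    exact (Rperm_braid_step hx ih' hij hpq hw hwpq).symm
  by_cases c3 : q = i
  · subst c3
    exact Rperm_braid_step hx ih' hpq hij hwpq hw
  have c4 : q ≠ j := by
    unfold Adj at *
    rintro rfl
    exact c1 (by ext; omega)
  have t1 : Equiv.swap p q i = i := Equiv.swap_apply_of_ne_of_ne (Ne.symm c1) (Ne.symm c3)
  have t2 : Equiv.swap p q j = j := Equiv.swap_apply_of_ne_of_ne (Ne.symm c2) (Ne.symm c4)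
  have t3 : Equiv.swap i j p = p := Equiv.swap_apply_of_ne_of_ne c1 c2
  have t4 : Equiv.swap i j q = q := Equiv.swap_apply_of_ne_of_ne c3 c4
  rw [ih' _ (permHeight_lt hpq hwpq) i j hij (by simpa [t1, t2] using hw),
    ih' _ (permHeight_lt hij hw) p q hpq (by simpa [t3, t4] using hwpq)]
  have e2 : w * Equiv.swap p q * Equiv.swap i j = w * Equiv.swap i j * Equiv.swap p q := by
    rw [mul_assoc, mul_assoc, swap_comm_of_disjoint c1 c2 c3 c4]
  rw [e2]
  simp only [Equiv.Perm.mul_apply, t1, t2, t3, t4, ← mul_assoc]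
  rw [Rcheck_comm c1 c2 c3 c4]

lemma exists_descent {N : ℕ} {w : Equiv.Perm (Fin N)} (hw : w ≠ 1) :
    ∃ i j, Adj i j ∧ w j < w i := by
  by_contra! h
  exact hw (perm_eq_one_of_monotone (monotone_of_adj h))

/-- `Ř(s_k w) = Ř(w) Ř_k` if `s_k w` is longer than `w`. -/
theorem Rperm_swap_mul (n : ℕ) {N : ℕ} {x : Fin N → ℂ} (hx : Function.Injective x) {k l : Fin N}
    (hkl : Adj k l) (w : Equiv.Perm (Fin N)) (hw : w.symm k < w.symm l) :
    Rperm n x (Equiv.swap k l * w) =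
      Rperm n (x ∘ Equiv.swap k l) w * Rcheck n k l (x l - x k) := by
  induction hh : permHeight w using Nat.strong_induction_on generalizing w with
  | _ h ih =>
  subst hh
  by_cases h1 : w = 1
  · subst h1
    rw [Rperm_one, mul_one, one_mul, Rperm_step n hx _ k l hkl (by simpa using hkl.lt)]
    simp [Rperm_one]
  obtain ⟨i, j, hij, hlt⟩ := exists_descent h1
  have hx' : Function.Injective (x ∘ Equiv.swap k l) := hx.comp (Equiv.injective _)
  -- Exchanging the values `k` and `l` could destroy this descent only if `w i = l` and `w j = k`,
  -- which `hw` excludes.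
  have hd : (Equiv.swap k l * w) j < (Equiv.swap k l * w) i := by
    refine swap_lt_swap hkl hlt ?_
    rintro ⟨rfl, rfl⟩
    simp only [Equiv.symm_apply_apply] at hw
    exact lt_asymm hij.lt hw
  rw [Rperm_step n hx _ i j hij hd, Rperm_step n hx' w i j hij hlt, mul_assoc, mul_assoc,
    ih _ (permHeight_lt hij hlt) _ ?_ rfl]
  · simp
  · change Equiv.swap i j (w.symm k) < Equiv.swap i j (w.symm l)
    refine swap_lt_swap hij hw ?_
    rintro ⟨rfl, rfl⟩
    simp only [Equiv.apply_symm_apply] at hlt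
    exact lt_asymm hkl.lt hlt

/-! ### The relation `RTT = TTR` in two formal variables -/

section RTT

variable {n : ℕ} {A : Type} [Ring A]

/-- Series in the first of two formal variables. -/
def inFst (A : Type) [Ring A] : PowerSeries A →+* PowerSeries (PowerSeries A) := PowerSeries.C

/-- Series in the second of two formal variables. -/
def inSnd (A : Type) [Ring A] : PowerSeries A →+* PowerSeries (PowerSeries A) :=
  PowerSeries.map PowerSeries.C

/-- The Yangian relations for a matrix of power series, in terms of generating functions. -/
def IsRTT (T : Matrix (Fin n) (Fin n) (PowerSeries A)) : Prop :=
  ∀ a b c d, (inFst A PowerSeries.X - inSnd A PowerSeries.X) *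
      (inFst A (T a b) * inSnd A (T c d) - inSnd A (T c d) * inFst A (T a b)) =
    inFst A PowerSeries.X * inSnd A PowerSeries.X *
      (inFst A (T c b) * inSnd A (T a d) - inSnd A (T c b) * inFst A (T a d))

lemma coeff_inFst_mul_inSnd (f g : PowerSeries A) (r s : ℕ) :
    PowerSeries.coeff r (PowerSeries.coeff s (inFst A f * inSnd A g)) =
      PowerSeries.coeff r f * PowerSeries.coeff s g := by
  simp [inFst, inSnd, PowerSeries.coeff_C_mul, PowerSeries.coeff_mul_C]

lemma coeff_inSnd_mul_inFst (f g : PowerSeries A) (r s : ℕ) :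
    PowerSeries.coeff r (PowerSeries.coeff s (inSnd A g * inFst A f)) =
      PowerSeries.coeff s g * PowerSeries.coeff r f := by
  simp [inFst, inSnd, PowerSeries.coeff_C_mul, PowerSeries.coeff_mul_C]

lemma inSnd_X : inSnd A PowerSeries.X = PowerSeries.X := by
  simp [inSnd]

lemma IsRTT.coeff {T : Matrix (Fin n) (Fin n) (PowerSeries A)} (h : IsRTT T)
    (a b c d : Fin n) (r s : ℕ) :
    (PowerSeries.coeff r (T a b) * PowerSeries.coeff (s + 1) (T c d) -
        PowerSeries.coeff (s + 1) (T c d) * PowerSeries.coeff r (T a b)) -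
      (PowerSeries.coeff (r + 1) (T a b) * PowerSeries.coeff s (T c d) -
        PowerSeries.coeff s (T c d) * PowerSeries.coeff (r + 1) (T a b)) =
    PowerSeries.coeff r (T c b) * PowerSeries.coeff s (T a d) -
      PowerSeries.coeff s (T c b) * PowerSeries.coeff r (T a d) := by
  -- With `X`, `Y` the inverses of the two spectral variables, the relation of index `(r, s)` is the
  -- coefficient of `X^(r+1) Y^(s+1)`: the factor `X - Y` lowers one index at a time, the factor `X
  -- Y` both.
  have h1 := congrArg (fun F => PowerSeries.coeff (r + 1) (PowerSeries.coeff (s + 1) F)) (h a b c d)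
  have hx : ∀ (F : PowerSeries (PowerSeries A)) (p q : ℕ),
      PowerSeries.coeff (p + 1) (PowerSeries.coeff q (inFst A PowerSeries.X * F)) =
        PowerSeries.coeff p (PowerSeries.coeff q F) := by
    intro F p q
    rw [inFst, PowerSeries.coeff_C_mul, PowerSeries.coeff_succ_X_mul]
  have hy : ∀ (F : PowerSeries (PowerSeries A)) (q : ℕ),
      PowerSeries.coeff (q + 1) (inSnd A PowerSeries.X * F) = PowerSeries.coeff q F := by
    intro F q
    rw [inSnd_X, PowerSeries.coeff_succ_X_mul]
  simpa only [sub_mul, mul_assoc, map_sub, hx, hy, coeff_inFst_mul_inSnd,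
    coeff_inSnd_mul_inFst] using h1

lemma commute_inFst_X (F : PowerSeries (PowerSeries A)) : Commute (inFst A PowerSeries.X) F := by
  ext q
  rw [inFst, PowerSeries.coeff_C_mul, PowerSeries.coeff_mul_C, PowerSeries.X_mul]

lemma commute_inSnd_X (F : PowerSeries (PowerSeries A)) : Commute (inSnd A PowerSeries.X) F := by
  rw [inSnd_X]
  exact (PowerSeries.commute_X F).symm

lemma commute_inFst_inSnd {f g : PowerSeries A}
    (h : ∀ r s, Commute (PowerSeries.coeff r f) (PowerSeries.coeff s g)) :
    Commute (inFst A f) (inSnd A g) := by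
  ext s r
  rw [coeff_inFst_mul_inSnd, coeff_inSnd_mul_inFst, h r s]

/-- The algebra behind the coproduct. Here `P`, `P'` are two solutions at the first spectral
variable and `Q`, `Q'` the same solutions at the second, while `z` and `t` stand for `X - Y` and `X
Y`. -/
lemma rtt_mul_aux {R : Type} [Ring R] {P Q P' Q' : Fin n → Fin n → R} {z t : R}
    (hz : ∀ r, Commute z r) (ht : ∀ r, Commute t r)
    (h : ∀ a b c d, z * (P a b * Q c d - Q c d * P a b) = t * (P c b * Q a d - Q c b * P a d))
    (h' : ∀ a b c d,
      z * (P' a b * Q' c d - Q' c d * P' a b) = t * (P' c b * Q' a d - Q' c b * P' a d))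
    (h1 : ∀ a b c d, Commute (P a b) (Q' c d)) (h2 : ∀ a b c d, Commute (Q a b) (P' c d))
    (a b c d : Fin n) :
    z * ((∑ e, P a e * P' e b) * (∑ f, Q c f * Q' f d) -
        (∑ f, Q c f * Q' f d) * (∑ e, P a e * P' e b)) =
      t * ((∑ e, P c e * P' e b) * (∑ f, Q a f * Q' f d) -
        (∑ e, Q c e * Q' e b) * (∑ f, P a f * P' f d)) := by
  have hPQ : ∀ a b c d : Fin n, (∑ e, P a e * P' e b) * (∑ f, Q c f * Q' f d) =
      ∑ e, ∑ f, P a e * Q c f * (P' e b * Q' f d) := by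
    intro a b c d
    rw [Finset.sum_mul_sum]
    refine Finset.sum_congr rfl fun e _ => Finset.sum_congr rfl fun f _ => ?_
    rw [mul_assoc, ← mul_assoc (P' e b), ← (h2 c f e b).eq]
    simp only [mul_assoc]
  have hQP : ∀ a b c d : Fin n, (∑ e, Q a e * Q' e b) * (∑ f, P c f * P' f d) =
      ∑ e, ∑ f, Q a e * P c f * (Q' e b * P' f d) := by
    intro a b c d
    rw [Finset.sum_mul_sum]
    refine Finset.sum_congr rfl fun e _ => Finset.sum_congr rfl fun f _ => ?_
    rw [mul_assoc, ← mul_assoc (Q' e b), ← (h1 c f e b).eq]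
    simp only [mul_assoc]
  rw [hPQ, hQP, hPQ, hQP, Finset.sum_comm (f := fun e f => Q c e * P a f * (Q' e d * P' f b))]
  -- Split the commutator as `[P, Q] P' Q' + Q P [P', Q']` and apply one relation to each part.
  -- After summation the two middle terms cancel, since they differ by exchanging `e` and `f`.
  have key : ∀ e f, z * (P a e * Q c f * (P' e b * Q' f d) - Q c f * P a e * (Q' f d * P' e b)) =
      t * (P c e * Q a f * (P' e b * Q' f d)) - t * (Q c e * P a f * (P' e b * Q' f d)) +
      (t * (Q c f * P a e * (P' f b * Q' e d)) - t * (Q c f * P a e * (Q' f b * P' e d))) := by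
    intro e f
    have e1 : P a e * Q c f * (P' e b * Q' f d) - Q c f * P a e * (Q' f d * P' e b) =
      (P a e * Q c f - Q c f * P a e) * (P' e b * Q' f d) +
        Q c f * P a e * (P' e b * Q' f d - Q' f d * P' e b) := by noncomm_ring
    rw [e1, mul_add, ← mul_assoc, h, ← mul_assoc z (_ * _), (hz _).eq, mul_assoc _ z, h',
      ← mul_assoc _ t, ← (ht _).eq]
    noncomm_ring
  simp only [Finset.mul_sum, ← Finset.sum_sub_distrib, ← mul_sub] at key ⊢
  simp only [key, Finset.sum_add_distrib, Finset.sum_sub_distrib, mul_sub]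
  rw [Finset.sum_comm (f := fun x y => t * (Q c y * P a x * (P' y b * Q' x d))),
    Finset.sum_comm (f := fun x y => t * (Q c y * P a x * (Q' y b * P' x d)))]
  abel

/-- The product of two commuting solutions of the `RTT` relation is a solution. -/
theorem IsRTT.mul {T T' : Matrix (Fin n) (Fin n) (PowerSeries A)} (h : IsRTT T) (h' : IsRTT T')
    (hc : ∀ a b c d r s, Commute (PowerSeries.coeff r (T a b)) (PowerSeries.coeff s (T' c d))) :
    IsRTT (T * T') := by
  intro a b c d
  simp only [Matrix.mul_apply, map_sum, map_mul]
  exact rtt_mul_aux (fun r => (commute_inFst_X r).sub_left (commute_inSnd_X r))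
    (fun r => (commute_inFst_X r).mul_left (commute_inSnd_X r)) h h'
    (fun a b c d => commute_inFst_inSnd (hc a b c d))
    (fun a b c d => (commute_inFst_inSnd fun r s => (hc a b c d s r).symm).symm) a b c d

lemma isRTT_one : IsRTT (1 : Matrix (Fin n) (Fin n) (PowerSeries A)) := by
  intro a b c d
  simp only [Matrix.one_apply]
  split_ifs <;> simp_all

lemma commute_inFst_of_central {f : PowerSeries A}
    (h : ∀ s r, Commute (PowerSeries.coeff s f) r) (F : PowerSeries (PowerSeries A)) :
    Commute (inFst A f) F := by
  have h' : ∀ g, Commute f g := fun g => by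
    ext s
    rw [PowerSeries.coeff_mul, PowerSeries.coeff_mul, ← Finset.Nat.sum_antidiagonal_swap]
    exact Finset.sum_congr rfl fun p _ => (h _ _).eq
  ext q
  rw [inFst, PowerSeries.coeff_C_mul, PowerSeries.coeff_mul_C, (h' _).eq]

lemma commute_inSnd_of_central {f : PowerSeries A}
    (h : ∀ s r, Commute (PowerSeries.coeff s f) r) (F : PowerSeries (PowerSeries A)) :
    Commute (inSnd A f) F := by
  ext q p
  rw [PowerSeries.coeff_mul, PowerSeries.coeff_mul, ← Finset.Nat.sum_antidiagonal_swap, map_sum,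
    map_sum]
  refine Finset.sum_congr rfl fun p _ => ?_
  simp only [inSnd, PowerSeries.coeff_map, Prod.fst_swap, Prod.snd_swap, PowerSeries.coeff_C_mul,
    PowerSeries.coeff_mul_C]
  rw [h]

end RTT

/-! ### Scalar resolvents and the evaluation homomorphism. -/

section Scalars

variable {n : ℕ} {A : Type} [Ring A] [Algebra ℂ A]

lemma coeff_resolventSeries_algebraMap (x : ℂ) (s : ℕ) :
    PowerSeries.coeff s (resolventSeries (algebraMap ℂ A x)) =
      algebraMap ℂ A (PowerSeries.coeff s (resolventSeries x)) := by
  cases s <;> simp [resolventSeries]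

lemma resolventSeries_mul_one_sub (x : ℂ) :
    resolventSeries (algebraMap ℂ A x) * (1 - PowerSeries.C (algebraMap ℂ A x) * PowerSeries.X) =
      PowerSeries.X := by
  ext s
  rw [mul_sub, mul_one, ← mul_assoc, map_sub]
  rcases s with _ | _ | s
  · simp [resolventSeries]
  · simp [resolventSeries, PowerSeries.coeff_succ_mul_X, PowerSeries.coeff_mul_C]
  · simp [resolventSeries, PowerSeries.coeff_succ_mul_X, PowerSeries.coeff_mul_C, pow_succ,
      PowerSeries.coeff_X]

lemma commute_coeff_resolventSeries (x : ℂ) (s : ℕ) (r : A) :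
    Commute (PowerSeries.coeff s (resolventSeries (algebraMap ℂ A x))) r := by
  rw [coeff_resolventSeries_algebraMap]
  exact Algebra.commute_algebraMap_left _ _

/-- This is the partial fraction identity `(v - u) / ((u - x) (v - x)) = 1 / (u - x) - 1 / (v - x)`,
written in `X = 1 / u`, `Y = 1 / v`. It is derived from `ρ (1 - x X) = X` without dividing. -/
lemma rtt_resolvent (x : ℂ) :
    let ρ := resolventSeries (algebraMap ℂ A x)
    (inFst A PowerSeries.X - inSnd A PowerSeries.X) * (inFst A ρ * inSnd A ρ) =
      inFst A PowerSeries.X * inSnd A PowerSeries.X * (inFst A ρ - inSnd A ρ) := by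
  intro ρ
  have h := resolventSeries_mul_one_sub (A := A) x
  have h1 := congrArg (inFst A) h
  have h2 := congrArg (inSnd A) h
  rw [map_mul, map_sub, map_one, map_mul] at h1 h2
  have hξ : inSnd A (PowerSeries.C (algebraMap ℂ A x)) =
    inFst A (PowerSeries.C (algebraMap ℂ A x)) := by simp [inSnd, inFst]
  rw [hξ] at h2
  set ξ := inFst A (PowerSeries.C (algebraMap ℂ A x))
  set X := inFst A (PowerSeries.X : PowerSeries A)
  set Y := inSnd A (PowerSeries.X : PowerSeries A)
  have c1 : ∀ F, Commute (inFst A ρ) F := commute_inFst_of_central (commute_coeff_resolventSeries x)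
  have c2 : ∀ F, Commute (inSnd A ρ) F := commute_inSnd_of_central (commute_coeff_resolventSeries x)
  have cX : ∀ F, Commute X F := commute_inFst_X
  have cY : ∀ F, Commute Y F := commute_inSnd_X
  set u := inFst A ρ
  set v := inSnd A ρ
  change u * (1 - ξ * X) = X at h1
  change v * (1 - ξ * Y) = Y at h2
  have e1 : X * Y * u = X * (u * v) - X * Y * ξ * (u * v) := by
    calc X * Y * u = X * (v * (1 - ξ * Y)) * u := by rw [h2]
      _ = X * (v * u) - X * (v * ((ξ * Y) * u)) := by noncomm_ring
      _ = _ := by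
        rw [(c2 u).eq, ← (c1 (ξ * Y)).eq, ← mul_assoc v, (c2 u).eq,
          (Commute.mul_left (c1 _) (c2 _) : Commute (u * v) (ξ * Y)).eq, ← (cY ξ).eq]
        noncomm_ring
  have e2 : X * Y * v = Y * (u * v) - X * Y * ξ * (u * v) := by
    calc X * Y * v = Y * (u * (1 - ξ * X)) * v := by rw [h1, (cX Y).eq]
      _ = Y * (u * v) - Y * (u * ((ξ * X) * v)) := by noncomm_ring
      _ = _ := by
        rw [← (c2 (ξ * X)).eq, ← mul_assoc u,
          (Commute.mul_left (c1 _) (c2 _) : Commute (u * v) (ξ * X)).eq, ← (cX ξ).eq, (cX Y).eq]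
        noncomm_ring
  rw [mul_sub, e1, e2]
  noncomm_ring

/-- The evaluation homomorphism: for every representation of `gl_n`, the matrix
`δ_{a,b} + E_{b,a} (u - x)⁻¹` satisfies the `RTT` relation. -/
theorem isRTT_lMatrix {e : Fin n → Fin n → A} (x : ℂ)
    (he : ∀ a b c d, e a b * e c d - e c d * e a b =
      (if b = c then e a d else 0) - (if d = a then e c b else 0)) :
    IsRTT (lMatrix e (algebraMap ℂ A x)) := by
  intro a b c d
  have hr := rtt_resolvent (A := A) x
  set ρ := resolventSeries (algebraMap ℂ A x)
  have c1 : ∀ F, Commute (inFst A ρ) F := commute_inFst_of_central (commute_coeff_resolventSeries x)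
  have c2 : ∀ F, Commute (inSnd A ρ) F := commute_inSnd_of_central (commute_coeff_resolventSeries x)
  have cX : ∀ F, Commute (inFst A PowerSeries.X) F := commute_inFst_X
  have cY : ∀ F, Commute (inSnd A PowerSeries.X) F := commute_inSnd_X
  have hE : ∀ y : A, inSnd A (PowerSeries.C y) = inFst A (PowerSeries.C y) := by
    intro y; simp [inSnd, inFst]
  have hd1 : ∀ p : Prop, [Decidable p] → inFst A (if p then 1 else 0) = if p then 1 else 0 := by
    intro p _; split_ifs <;> simp
  have hd2 : ∀ p : Prop, [Decidable p] → inSnd A (if p then 1 else 0) = if p then 1 else 0 := by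
    intro p _; split_ifs <;> simp
  simp only [lMatrix, Matrix.of_apply, map_add, map_mul, hE, hd1, hd2]
  set E : Fin n → Fin n → PowerSeries (PowerSeries A) := fun a b => inFst A (PowerSeries.C (e a b))
    with hEdef
  have hEE : E b a * E d c - E d c * E b a =
      (if a = d then E b c else 0) - (if c = b then E d a else 0) := by
    simp only [hEdef, ← map_mul, ← map_sub, he]
    split_ifs <;> simp
  set u := inFst A ρ
  set v := inSnd A ρ
  set X := inFst A (PowerSeries.X : PowerSeries A)
  set Y := inSnd A (PowerSeries.X : PowerSeries A)
  change (X - Y) * (u * v) = X * Y * (u - v) at hr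
  have comb : ∀ (p q r s : PowerSeries (PowerSeries A)),
      p * u * (q * v) = p * q * (u * v) ∧ p * v * (q * u) = p * q * (u * v) := by
    intro p q r s
    constructor
    · rw [mul_assoc, ← mul_assoc u, (c1 q).eq]; noncomm_ring
    · rw [mul_assoc, ← mul_assoc v, (c2 q).eq, mul_assoc q, (c2 u).eq]; noncomm_ring
  have hl : ∀ (p q r s : PowerSeries (PowerSeries A)), (∀ F, Commute r F) → (∀ F, Commute s F) →
      (r + p * u) * (s + q * v) - (s + q * v) * (r + p * u) = (p * q - q * p) * (u * v) := by
    intro p q r s hr hs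
    have e1 := (comb p q r s).1
    have e2 := (comb q p r s).2
    have e3 := (hr s).eq
    have e4 := (hr (q * v)).eq
    have e5 := (hs (p * u)).eq
    calc _ = r * s + r * (q * v) + p * u * s + p * u * (q * v) -
        (s * r + s * (p * u) + q * v * r + q * v * (p * u)) := by noncomm_ring
      _ = _ := by rw [e1, e2, e3, e4, e5]; noncomm_ring
  have hrr : ∀ (p q r s : PowerSeries (PowerSeries A)), (∀ F, Commute r F) → (∀ F, Commute s F) →
      (r + p * u) * (s + q * v) - (r + p * v) * (s + q * u) = (s * p - r * q) * (u - v) := by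
    intro p q r s hr hs
    have e1 := (comb p q r s).1
    have e2 := (comb p q r s).2
    calc _ = r * s + r * (q * v) + p * u * s + p * u * (q * v) -
        (r * s + r * (q * u) + p * v * s + p * v * (q * u)) := by noncomm_ring
      _ = _ := by rw [e1, e2, ← (hs (p * u)).eq, ← (hs (p * v)).eq]; noncomm_ring
  have hδ : ∀ (p : Prop) [Decidable p] (F : PowerSeries (PowerSeries A)),
      Commute (if p then 1 else 0) F := by
    intro p _ F
    split_ifs
    · exact Commute.one_left F
    · exact Commute.zero_left F
  -- Both sides are now an expression linear in the matrix units times a scalar series;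
  -- `rtt_resolvent` matches the scalar series and the `gl_n` commutator the rest.
  rw [hl _ _ _ _ (hδ _) (hδ _), hrr _ _ _ _ (hδ _) (hδ _), hEE]
  have hz : ∀ F, Commute (X - Y) F := fun F => (cX F).sub_left (cY F)
  have ht : ∀ F, Commute (X * Y) F := fun F => (cX F).mul_left (cY F)
  rw [← mul_assoc, (hz _).eq, mul_assoc, hr, ← mul_assoc, ← (ht _).eq, mul_assoc]
  congr 2
  split_ifs <;> simp [hEdef]

end Scalars

/-! ### Modules over the Yangian -/

/-- All coefficients of all entries of `T` lie in the subalgebra `S`. -/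
def CoeffsIn {n : ℕ} {A : Type} [Ring A] [Algebra ℂ A] (S : Subalgebra ℂ A)
    (T : Matrix (Fin n) (Fin n) (PowerSeries A)) : Prop :=
  ∀ a b s, PowerSeries.coeff s (T a b) ∈ S

section CoeffsIn

variable {n : ℕ} {A : Type} [Ring A] [Algebra ℂ A] {S : Subalgebra ℂ A}

lemma coeffsIn_one : CoeffsIn S (1 : Matrix (Fin n) (Fin n) (PowerSeries A)) := by
  intro a b s
  rw [Matrix.one_apply]
  split_ifs
  · rw [PowerSeries.coeff_one]
    split_ifs
    · exact S.one_mem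
    · exact S.zero_mem
  · rw [map_zero]
    exact S.zero_mem

lemma CoeffsIn.mul {T T' : Matrix (Fin n) (Fin n) (PowerSeries A)} (h : CoeffsIn S T)
    (h' : CoeffsIn S T') : CoeffsIn S (T * T') := by
  intro a b s
  rw [Matrix.mul_apply, map_sum]
  refine S.sum_mem fun c _ => ?_
  rw [PowerSeries.coeff_mul]
  exact S.sum_mem fun p _ => S.mul_mem (h _ _ _) (h' _ _ _)

/-- Used with `S` a centralizer: commutation with fixed operators passes from the factors to all
coefficients of the product. -/
lemma CoeffsIn.list_prod {l : List (Matrix (Fin n) (Fin n) (PowerSeries A))}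
    (h : ∀ T ∈ l, CoeffsIn S T) : CoeffsIn S l.prod := by
  induction l with
  | nil => exact coeffsIn_one
  | cons T l ih =>
    rw [List.prod_cons]
    exact (h T (by simp)).mul (ih fun T' hT' => h T' (by simp [hT']))

lemma coeff_lMatrix (e : Fin n → Fin n → A) (x : ℂ) (a b : Fin n) (s : ℕ) :
    PowerSeries.coeff s (lMatrix e (algebraMap ℂ A x) a b) =
      (if s = 0 ∧ a = b then 1 else 0) + PowerSeries.coeff s (resolventSeries x) • e b a := by
  rw [lMatrix, Matrix.of_apply, map_add, PowerSeries.coeff_C_mul, coeff_resolventSeries_algebraMap,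
    ← Algebra.commutes, ← Algebra.smul_def]
  congr 1
  by_cases h1 : a = b <;> simp [h1, PowerSeries.coeff_one]

lemma coeffsIn_lMatrix {e : Fin n → Fin n → A} (he : ∀ a b, e a b ∈ S) (x : ℂ) :
    CoeffsIn S (lMatrix e (algebraMap ℂ A x)) := by
  intro a b s
  rw [coeff_lMatrix]
  refine S.add_mem ?_ (S.smul_mem (he _ _) _)
  split_ifs
  · exact S.one_mem
  · exact S.zero_mem

end CoeffsIn

lemma coeff_zero_list_prod {n : ℕ} {A : Type} [Ring A]
    {l : List (Matrix (Fin n) (Fin n) (PowerSeries A))}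
    (h : ∀ T ∈ l, ∀ a b, PowerSeries.coeff 0 (T a b) = if a = b then 1 else 0) (a b : Fin n) :
    PowerSeries.coeff 0 (l.prod a b) = if a = b then 1 else 0 := by
  induction l generalizing a b with
  | nil => by_cases h1 : a = b <;> simp [h1]
  | cons T l ih =>
    have ih' := ih fun T' hT' => h T' (by simp [hT'])
    simp only [List.prod_cons, Matrix.mul_apply, map_sum, PowerSeries.coeff_mul,
      Finset.HasAntidiagonal.antidiagonal_zero, Finset.sum_singleton, ih', h T (by simp)]
    simp

/-- A solution of the `RTT` relation whose coefficients preserve a subspace makes it a module over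
the Yangian. -/
theorem exists_isYangianAction {n : ℕ} {V : Type} [AddCommGroup V] [Module ℂ V]
    {S : Submodule ℂ V} {T : Matrix (Fin n) (Fin n) (PowerSeries (Module.End ℂ V))}
    (h0 : ∀ a b, PowerSeries.coeff 0 (T a b) = if a = b then 1 else 0) (hT : IsRTT T)
    (hS : ∀ a b s, ∀ w ∈ S, PowerSeries.coeff s (T a b) w ∈ S) :
    ∃ ρ : Yangian n →ₐ[ℂ] Module.End ℂ S, IsYangianAction S T ρ := by
  let t : Fin n → Fin n → ℕ → Module.End ℂ S := fun a b s =>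
    (PowerSeries.coeff s (T a b)).restrict (hS a b s)
  have ht : ∀ a b s (w : S), ((t a b s w : S) : V) = PowerSeries.coeff s (T a b) (w : V) :=
    fun a b s w => rfl
  let f : FreeAlgebra ℂ (Fin n × Fin n × ℕ) →ₐ[ℂ] Module.End ℂ S :=
    FreeAlgebra.lift ℂ fun p => t p.1 p.2.1 (p.2.2 + 1)
  have hf : ∀ a b s, f (freeT n a b s) = t a b s := by
    intro a b s
    cases s with
    -- `T^(0) = δ` is not a generator of the free algebra, so its value is matched through `h0`.
    | zero =>
      ext w
      rw [ht, h0, freeT]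
      split_ifs <;> simp
    | succ k => rw [freeT]; exact FreeAlgebra.lift_ι_apply _ _
  have hrel : ∀ ⦃x y⦄, YangianRel n x y → f x = f y := by
    rintro _ _ ⟨a, b, c, d, r, s⟩
    simp only [map_sub, map_mul, hf]
    ext w
    have := LinearMap.congr_fun (hT.coeff a b c d r s) (w : V)
    simpa only [LinearMap.sub_apply, Module.End.mul_apply, Submodule.coe_sub, ht] using this
  refine ⟨RingQuot.liftAlgHom ℂ ⟨f, hrel⟩, fun a b s w => ?_⟩
  rw [yangianT, RingQuot.liftAlgHom_mkAlgHom_apply, hf]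
  rfl

/-! ### The module `W` -/

section W

variable {n N : ℕ}

lemma blockE_comm (m : Fin N → ℤ) {c c' : ℤ} (h : c ≠ c') (a b a' b' : Fin n) :
    Commute (blockE m c a b) (blockE m c' a' b') := by
  refine Commute.sum_left _ _ _ fun i hi => Commute.sum_right _ _ _ fun j hj => ?_
  refine siteE_comm ?_ _ _ _ _
  rintro rfl
  simp only [Finset.mem_filter] at hi hj
  exact h (hi.2.symm.trans hj.2)

lemma siteE_lie (i j : Fin N) (a b c d : Fin n) :
    siteE i a b * siteE j c d - siteE j c d * siteE i a b =
      if i = j then (if b = c then siteE i a d else 0) - (if d = a then siteE i c b else 0)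
      else 0 := by
  by_cases h : i = j
  · subst h
    rw [siteE_mul_same, siteE_mul_same, if_pos rfl]
  · rw [siteE_comm h, if_neg h]
    exact sub_self (G := Module.End ℂ (Spins n N)) _

/-- Commuting copies of `gl_n` add up to a representation, because only the diagonal terms `i = j`
of the double sum survive in the commutator. -/
lemma sum_lie_aux {ι A : Type} [DecidableEq ι] [Ring A] (e : ι → Fin n → Fin n → A)
    (he : ∀ i j a b c d, e i a b * e j c d - e j c d * e i a b =
      if i = j then (if b = c then e i a d else 0) - (if d = a then e i c b else 0) else 0)
    (s : Finset ι) (a b c d : Fin n) :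
    (∑ i ∈ s, e i a b) * (∑ i ∈ s, e i c d) - (∑ i ∈ s, e i c d) * (∑ i ∈ s, e i a b) =
      (if b = c then ∑ i ∈ s, e i a d else 0) - (if d = a then ∑ i ∈ s, e i c b else 0) := by
  rw [Finset.sum_mul_sum, Finset.sum_mul_sum,
    Finset.sum_comm (f := fun i j => e i c d * e j a b)]
  simp only [← Finset.sum_sub_distrib, he, Finset.sum_ite_eq]
  simp only [Finset.sum_ite_mem, Finset.inter_self, Finset.sum_sub_distrib]
  split_ifs <;> simp

lemma sum_siteE_lie (s : Finset (Fin N)) (a b c d : Fin n) :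
    (∑ i ∈ s, siteE i a b) * (∑ i ∈ s, siteE i c d) -
      (∑ i ∈ s, siteE i c d) * (∑ i ∈ s, siteE i a b) =
      (if b = c then ∑ i ∈ s, siteE i a d else 0) - (if d = a then ∑ i ∈ s, siteE i c b else 0) :=
  sum_lie_aux (A := Module.End ℂ (Spins n N)) siteE siteE_lie s a b c d

lemma blockValues_nodup (m : Fin N → ℤ) : (blockValues m).Nodup := Finset.sort_nodup _ _

lemma isRTT_blocks (α : ℝ) (m : Fin N → ℤ) {l : List ℤ} (hl : l.Nodup) :
    IsRTT (l.map fun c => lMatrix (blockE (n := n) m c)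
      (algebraMap ℂ (Module.End ℂ (Spins n N)) (-blockShift α m c))).prod := by
  induction l with
  | nil => exact isRTT_one
  | cons c l ih =>
    rw [List.nodup_cons] at hl
    rw [List.map_cons, List.prod_cons]
    refine (isRTT_lMatrix _ fun a b c' d => sum_siteE_lie _ _ _ _ _).mul (ih hl.2) ?_
    intro a b a' b' r s
    -- Centralizers are used twice: first the coefficients for the remaining blocks commute with the
    -- generators of block `c`, then the coefficients for block `c` commute with each of them.
    have h1 : CoeffsIn (Subalgebra.centralizer ℂ {X | ∃ a b, X = blockE (n := n) m c a b})
        (l.map fun c => lMatrix (blockE (n := n) m c)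
          (algebraMap ℂ (Module.End ℂ (Spins n N)) (-blockShift α m c))).prod := by
      refine CoeffsIn.list_prod fun T hT => ?_
      obtain ⟨c', hc', rfl⟩ := List.mem_map.1 hT
      refine coeffsIn_lMatrix (fun p q => ?_) _
      rw [Subalgebra.mem_centralizer_iff]
      rintro _ ⟨p', q', rfl⟩
      exact blockE_comm m (fun h => hl.1 (by rwa [h])) _ _ _ _
    have h2 := h1 a' b' s
    rw [Subalgebra.mem_centralizer_iff] at h2
    set X := PowerSeries.coeff s ((l.map fun c => lMatrix (blockE (n := n) m c)
          (algebraMap ℂ (Module.End ℂ (Spins n N)) (-blockShift α m c))).prod a' b')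
    have h3 : CoeffsIn (Subalgebra.centralizer ℂ {X}) (lMatrix (blockE (n := n) m c)
        (algebraMap ℂ (Module.End ℂ (Spins n N)) (-blockShift α m c))) := by
      refine coeffsIn_lMatrix (fun p q => ?_) _
      rw [Subalgebra.mem_centralizer_iff]
      rintro _ rfl
      exact (h2 _ ⟨p, q, rfl⟩).symm
    have h4 := h3 a b r
    rw [Subalgebra.mem_centralizer_iff] at h4
    exact (h4 X rfl).symm

lemma mem_Wspace {m : Fin N → ℤ} {w : Spins n N} :
    w ∈ Wspace n m ↔ ∀ i j, Adj i j → m i = m j → Pop n i j w = w := by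
  simp only [Wspace, Submodule.mem_iInf, LinearMap.mem_ker, LinearMap.sub_apply, sub_eq_zero,
    Module.End.one_apply, and_imp]

/-- As `m` takes equal values at `i` and `j`, their exchange permutes the positions of every block.
-/
lemma Pop_comm_blockE {m : Fin N → ℤ} {i j : Fin N} (h : m i = m j) (c : ℤ) (a b : Fin n) :
    Pop n i j * blockE m c a b = blockE m c a b * Pop n i j := by
  rw [blockE, Finset.mul_sum, Finset.sum_mul]
  simp only [Pop_mul_siteE]
  refine Finset.sum_equiv (Equiv.swap i j) (fun k => ?_) fun k _ => rfl
  have : m (Equiv.swap i j k) = m k := by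
    rw [Equiv.swap_apply_def]
    split_ifs <;> simp_all
  simp [this]

lemma monodromyW_mem (α : ℝ) (m : Fin N → ℤ) (a b : Fin n) (s : ℕ) {w : Spins n N}
    (hw : w ∈ Wspace n m) : PowerSeries.coeff s (monodromyW n α m a b) w ∈ Wspace n m := by
  rw [mem_Wspace] at hw ⊢
  intro i j hij hm
  have h : CoeffsIn (Subalgebra.centralizer ℂ {Pop n i j}) (monodromyW n α m) := by
    refine CoeffsIn.list_prod fun T hT => ?_
    obtain ⟨c', hc', rfl⟩ := List.mem_map.1 hT
    refine coeffsIn_lMatrix (fun p q => ?_) _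
    rw [Subalgebra.mem_centralizer_iff]
    rintro _ rfl
    exact Pop_comm_blockE hm _ _ _
  have h2 := h a b s
  rw [Subalgebra.mem_centralizer_iff] at h2
  have h3 := LinearMap.congr_fun (h2 _ rfl) w
  rw [Module.End.mul_apply, Module.End.mul_apply, hw i j hij hm] at h3
  exact h3

lemma coeff_zero_monodromyW (α : ℝ) (m : Fin N → ℤ) (a b : Fin n) :
    PowerSeries.coeff 0 (monodromyW n α m a b) = if a = b then 1 else 0 := by
  refine coeff_zero_list_prod (A := Module.End ℂ (Spins n N)) (fun T hT a b => ?_) a b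
  obtain ⟨c', hc', rfl⟩ := List.mem_map.1 hT
  rw [coeff_lMatrix]
  simp [resolventSeries]

theorem exists_yangianAction_Wspace (α : ℝ) (m : Fin N → ℤ) :
    ∃ ρ : Yangian n →ₐ[ℂ] Module.End ℂ (Wspace n m),
      IsYangianAction (Wspace n m) (monodromyW n α m) ρ :=
  exists_isYangianAction (V := Spins n N) (S := Wspace n m) (T := monodromyW n α m)
    (coeff_zero_monodromyW α m) (isRTT_blocks α m (blockValues_nodup m))
    fun a b s _ hw => monodromyW_mem α m a b s hw

end W

/-! ### The monodromy matrix with scalar parameters -/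

section Resolvent

variable {A : Type} [Ring A] [Algebra ℂ A]

lemma resolventSeries_algebraMap (x : ℂ) :
    resolventSeries (algebraMap ℂ A x) = PowerSeries.map (algebraMap ℂ A) (resolventSeries x) := by
  ext s
  rw [coeff_resolventSeries_algebraMap, PowerSeries.coeff_map]

lemma resolventSeries_sub (x y : ℂ) :
    resolventSeries y - resolventSeries x =
      PowerSeries.C (y - x) * (resolventSeries x * resolventSeries y) := by
  have hx := resolventSeries_mul_one_sub (A := ℂ) x
  have hy := resolventSeries_mul_one_sub (A := ℂ) y
  simp only [Algebra.algebraMap_self, RingHom.id_apply] at hx hy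
  have hX : (PowerSeries.X : PowerSeries ℂ) ≠ 0 := PowerSeries.X_ne_zero
  -- Multiplied by `X`, the identity is a combination of the defining equations `ρ (1 - x X) = X` of
  -- the two resolvents.
  apply mul_left_cancel₀ hX
  rw [map_sub]
  linear_combination (-resolventSeries y) * hx + resolventSeries x * hy

/-- Scalar power series act on power series with coefficients in an algebra. -/
abbrev scalarSeriesAlgebra (A : Type) [Ring A] [Algebra ℂ A] :
    Algebra (PowerSeries ℂ) (PowerSeries A) :=
  (PowerSeries.map (algebraMap ℂ A)).toAlgebra' fun f g => by
    ext s
    rw [PowerSeries.coeff_mul, PowerSeries.coeff_mul, ← Finset.Nat.sum_antidiagonal_swap]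
    refine Finset.sum_congr rfl fun p _ => ?_
    rw [PowerSeries.coeff_map, PowerSeries.coeff_map]
    exact Algebra.commutes _ _

lemma smul_scalarSeries (f : PowerSeries ℂ) (g : PowerSeries A) :
    letI := scalarSeriesAlgebra A
    f • g = PowerSeries.map (algebraMap ℂ A) f * g := rfl

end Resolvent

/-- Here `e`, `f` are matrix units at two sites, `q` the contracted product and `r`, `t` the two
resolvents. Since `P` exchanges `e` and `f`, the expanded sides differ only in the coefficients of
`e` and `f`, and `hc`, formally `c = 1 / (1 / r - 1 / t)`, makes these equal. -/
lemma two_site_intertwining {Z R : Type} [CommRing Z] [Ring R] [Algebra Z R] {d : Z}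
    {e f q P : R} {r t c : Z} (hP : P * P = 1) (hq : q = f * P) (he : P * e = f * P)
    (hf : P * f = e * P) (hc : c * (t - r) = r * t) :
    (d • 1 + r • f + t • e + (r * t) • q) * (c • 1 + P) =
      (c • 1 + P) * (d • 1 + t • f + r • e + (r * t) • q) := by
  have h1 : P * (f * P) = e := by rw [← mul_assoc, hf, mul_assoc, hP, mul_one]
  have h2 : f * P * P = f := by rw [mul_assoc, hP, mul_one]
  subst hq
  simp only [add_mul, mul_add, smul_mul_assoc, mul_smul_comm, one_mul, mul_one, he, hf, h1, h2]
  linear_combination (norm := module) hc • e - hc • f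

lemma lMatrix_mul_lMatrix {n : ℕ} {A : Type} [Ring A] [Algebra ℂ A] (e f : Fin n → Fin n → A) (x y : ℂ)
    (a b : Fin n) :
    letI := scalarSeriesAlgebra A
    (lMatrix e (algebraMap ℂ A x) * lMatrix f (algebraMap ℂ A y)) a b =
      (if a = b then 1 else 0 : PowerSeries ℂ) • 1 + resolventSeries y • PowerSeries.C (f b a) +
        resolventSeries x • PowerSeries.C (e b a) +
        (resolventSeries y * resolventSeries x) • PowerSeries.C (∑ c, e c a * f b c) := by
  let := scalarSeriesAlgebra A
  have hl : ∀ (e : Fin n → Fin n → A) (x : ℂ) (a b : Fin n),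
      lMatrix e (algebraMap ℂ A x) a b =
        (if a = b then 1 else 0) + resolventSeries x • PowerSeries.C (e b a) := by
    intro e x a b
    rw [lMatrix, Matrix.of_apply, resolventSeries_algebraMap, Algebra.smul_def, Algebra.commutes]
    rfl
  rw [Matrix.mul_apply]
  simp only [hl, add_mul, mul_add, Finset.sum_add_distrib, ite_mul, mul_ite, one_mul, mul_one,
    zero_mul, mul_zero, Finset.sum_ite_eq, Finset.sum_ite_eq', Finset.mem_univ, if_true,
    map_sum, Finset.smul_sum, map_mul, smul_mul_smul_comm]
  rw [ite_smul, one_smul, zero_smul, mul_comm (resolventSeries x)]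
  abel

/-! ### Exchanging neighbouring spectral parameters. -/

section Monodromy

variable {n N : ℕ} {A : Type} [Ring A] [Algebra ℂ A]

/-- The product of the first `k` factors of the monodromy matrix with parameters `x`. -/
def prefixMonodromy (E : Fin N → Fin n → Fin n → A) (x : Fin N → ℂ) (k : ℕ) :
    Matrix (Fin n) (Fin n) (PowerSeries A) :=
  ((List.ofFn fun i : Fin N => lMatrix (E i) (algebraMap ℂ A (x i))).take k).prod

lemma prefixMonodromy_zero (E : Fin N → Fin n → Fin n → A) (x : Fin N → ℂ) :
    prefixMonodromy E x 0 = 1 := by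
  simp [prefixMonodromy]

lemma prefixMonodromy_succ (E : Fin N → Fin n → Fin n → A) (x : Fin N → ℂ) (i : Fin N) :
    prefixMonodromy E x (i + 1) =
      prefixMonodromy E x i * lMatrix (E i) (algebraMap ℂ A (x i)) := by
  rw [prefixMonodromy, List.prod_take_succ _ _ (by simp)]
  simp [prefixMonodromy]

lemma prefixMonodromy_full (E : Fin N → Fin n → Fin n → A) (x : Fin N → ℂ) :
    prefixMonodromy E x N = (List.ofFn fun i : Fin N =>
      lMatrix (E i) (algebraMap ℂ A (x i))).prod := by
  rw [prefixMonodromy, List.take_of_length_le (by simp)]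

lemma matrix_intertwining_mul {A : Type} [Ring A]
    {S S' T T' : Matrix (Fin n) (Fin n) (PowerSeries A)} {r : PowerSeries A}
    (h1 : ∀ a b, S' a b * r = r * S a b) (h2 : ∀ a b, T' a b * r = r * T a b) (a b : Fin n) :
    (S' * T') a b * r = r * (S * T) a b := by
  simp only [Matrix.mul_apply, Finset.sum_mul, Finset.mul_sum]
  refine Finset.sum_congr rfl fun c _ => ?_
  rw [mul_assoc, h2, ← mul_assoc, h1, mul_assoc]

lemma commute_C_lMatrix {e : Fin n → Fin n → A} {r : A}
    (h : ∀ a b, Commute (e a b) r) (x : ℂ) (a b : Fin n) :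
    lMatrix e (algebraMap ℂ A x) a b * PowerSeries.C r =
      PowerSeries.C r * lMatrix e (algebraMap ℂ A x) a b := by
  have h1 := coeffsIn_lMatrix (S := Subalgebra.centralizer ℂ {r}) (e := e)
    (fun a b => by
      rw [Subalgebra.mem_centralizer_iff]
      rintro _ rfl
      exact (h a b).symm) x
  ext s
  have h2 := h1 a b s
  rw [Subalgebra.mem_centralizer_iff] at h2
  rw [PowerSeries.coeff_C_mul, PowerSeries.coeff_mul_C, h2 r rfl]

variable {E : Fin N → Fin n → Fin n → A} {P : Equiv.Perm (Fin N) →* A}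

/-- `L_i(x_j) L_j(x_i) Ř = Ř L_i(x_i) L_j(x_j)`. -/
lemma lMatrix_intertwining (hPE : ∀ w k a b, P w * E k a b = E (w k) a b * P w)
    (hEE : ∀ i j, i ≠ j → ∀ a b, ∑ c, E i c a * E j b c = E j b a * P (Equiv.swap i j))
    {i j : Fin N} (hij : i ≠ j) {x y : ℂ} (hxy : x ≠ y) (a b : Fin n) :
    (lMatrix (E i) (algebraMap ℂ A y) * lMatrix (E j) (algebraMap ℂ A x)) a b *
      PowerSeries.C (algebraMap ℂ A (y - x)⁻¹ + P (Equiv.swap i j)) =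
    PowerSeries.C (algebraMap ℂ A (y - x)⁻¹ + P (Equiv.swap i j)) *
      (lMatrix (E i) (algebraMap ℂ A x) * lMatrix (E j) (algebraMap ℂ A y)) a b := by
  let := scalarSeriesAlgebra A
  have hR : PowerSeries.C (algebraMap ℂ A (y - x)⁻¹ + P (Equiv.swap i j)) =
      (PowerSeries.C (y - x)⁻¹ : PowerSeries ℂ) • (1 : PowerSeries A) +
        PowerSeries.C (P (Equiv.swap i j)) := by
    rw [map_add, smul_scalarSeries, PowerSeries.map_C, mul_one]
  rw [lMatrix_mul_lMatrix, lMatrix_mul_lMatrix, hR, mul_comm (resolventSeries y)]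
  refine two_site_intertwining ?_ ?_ ?_ ?_ ?_
  · rw [← map_mul, ← map_mul, Equiv.swap_mul_self, map_one, map_one]
  · rw [hEE i j hij, map_mul]
  · rw [← map_mul, ← map_mul, hPE, Equiv.swap_apply_left]
  · rw [← map_mul, ← map_mul, hPE, Equiv.swap_apply_right]
  · rw [resolventSeries_sub, ← mul_assoc, ← map_mul, inv_mul_cancel₀ (sub_ne_zero.2 hxy.symm),
      map_one, one_mul]

lemma lMatrix_comm_of_ne (hPE : ∀ w k a b, P w * E k a b = E (w k) a b * P w) {i j k : Fin N}
    (h1 : k ≠ i) (h2 : k ≠ j) (u x : ℂ) (a b : Fin n) :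
    lMatrix (E k) (algebraMap ℂ A x) a b *
        PowerSeries.C (algebraMap ℂ A u + P (Equiv.swap i j)) =
      PowerSeries.C (algebraMap ℂ A u + P (Equiv.swap i j)) *
        lMatrix (E k) (algebraMap ℂ A x) a b := by
  refine commute_C_lMatrix (fun a b => ?_) x a b
  refine Commute.add_right (Algebra.commute_algebraMap_right _ _) ?_
  have := hPE (Equiv.swap i j) k a b
  rw [Equiv.swap_apply_of_ne_of_ne h1 h2] at this
  exact this.symm

lemma prefixMonodromy_intertwining_of_le (hPE : ∀ w k a b, P w * E k a b = E (w k) a b * P w)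
    {i j : Fin N} (hij : Adj i j) (x : Fin N → ℂ) (u : ℂ) (k : ℕ) (hk : k ≤ i) (a b : Fin n) :
    prefixMonodromy E (x ∘ Equiv.swap i j) k a b *
        PowerSeries.C (algebraMap ℂ A u + P (Equiv.swap i j)) =
      PowerSeries.C (algebraMap ℂ A u + P (Equiv.swap i j)) * prefixMonodromy E x k a b := by
  induction k generalizing a b with
  | zero =>
    rw [prefixMonodromy_zero, prefixMonodromy_zero, Matrix.one_apply]
    split_ifs <;> simp
  | succ k ih =>
    have hki : (⟨k, by omega⟩ : Fin N) < i := hk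
    have hkj := hki.trans hij.lt
    have e1 := prefixMonodromy_succ E (x ∘ Equiv.swap i j) ⟨k, by omega⟩
    have e2 := prefixMonodromy_succ E x ⟨k, by omega⟩
    rw [Function.comp_apply, Equiv.swap_apply_of_ne_of_ne hki.ne hkj.ne] at e1
    rw [e1, e2]
    exact matrix_intertwining_mul (ih (by omega))
      (lMatrix_comm_of_ne hPE hki.ne hkj.ne _ _) a b

/-- `T(x_1, …, x_{i+1}, x_i, …, x_N) Ř = Ř T(x_1, …, x_N)`. -/
theorem prefixMonodromy_intertwining (hPE : ∀ w k a b, P w * E k a b = E (w k) a b * P w)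
    (hEE : ∀ i j, i ≠ j → ∀ a b, ∑ c, E i c a * E j b c = E j b a * P (Equiv.swap i j))
    {i j : Fin N} (hij : Adj i j) {x : Fin N → ℂ}
    (hx : x i ≠ x j) (k : ℕ) (hk : j < k) (hkN : k ≤ N) (a b : Fin n) :
    prefixMonodromy E (x ∘ Equiv.swap i j) k a b *
        PowerSeries.C (algebraMap ℂ A (x j - x i)⁻¹ + P (Equiv.swap i j)) =
      PowerSeries.C (algebraMap ℂ A (x j - x i)⁻¹ + P (Equiv.swap i j)) *
        prefixMonodromy E x k a b := by
  induction k, hk using Nat.le_induction generalizing a b with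
  | base =>
    have h1 : ((i : ℕ) + 1) = j := hij
    have h2 : (j : ℕ).succ = j + 1 := rfl
    have e1 := prefixMonodromy_succ E (x ∘ Equiv.swap i j) j
    have e2 := prefixMonodromy_succ E x j
    have e3 := prefixMonodromy_succ E (x ∘ Equiv.swap i j) i
    have e4 := prefixMonodromy_succ E x i
    rw [h1] at e3 e4
    rw [e3] at e1
    rw [e4] at e2
    simp only [Function.comp_apply, Equiv.swap_apply_left, Equiv.swap_apply_right] at e1
    rw [h2, e1, e2, mul_assoc, mul_assoc]
    exact matrix_intertwining_mul (prefixMonodromy_intertwining_of_le hPE hij x _ _ le_rfl)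
      (lMatrix_intertwining hPE hEE hij.ne hx) a b
  | succ k hk ih =>
    have hki : i < (⟨k, by omega⟩ : Fin N) := hij.lt.trans hk
    have hkj : j < (⟨k, by omega⟩ : Fin N) := hk
    have e1 := prefixMonodromy_succ E (x ∘ Equiv.swap i j) ⟨k, by omega⟩
    have e2 := prefixMonodromy_succ E x ⟨k, by omega⟩
    rw [Function.comp_apply, Equiv.swap_apply_of_ne_of_ne hki.ne' hkj.ne'] at e1
    rw [e1, e2]
    exact matrix_intertwining_mul (ih (by omega))
      (lMatrix_comm_of_ne hPE hki.ne' hkj.ne' _ _) a b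

end Monodromy

/-! ### Fusion -/

/-- Equality of operator-valued power series on a set of vectors. -/
def SeriesEqOn {V : Type} [AddCommGroup V] [Module ℂ V] (S : Set V)
    (F G : PowerSeries (Module.End ℂ V)) : Prop :=
  ∀ s, ∀ w ∈ S, PowerSeries.coeff s F w = PowerSeries.coeff s G w

section Fusion

variable {n N : ℕ} {V : Type} [AddCommGroup V] [Module ℂ V] {S S' : Set V}

lemma SeriesEqOn.mul_left {F G : PowerSeries (Module.End ℂ V)} (h : SeriesEqOn S F G)
    (H : PowerSeries (Module.End ℂ V)) : SeriesEqOn S (H * F) (H * G) := by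
  intro s w hw
  rw [PowerSeries.coeff_mul, PowerSeries.coeff_mul, LinearMap.sum_apply, LinearMap.sum_apply]
  refine Finset.sum_congr rfl fun p _ => ?_
  rw [Module.End.mul_apply, Module.End.mul_apply, h _ w hw]

lemma SeriesEqOn.mul_right {F G : PowerSeries (Module.End ℂ V)} (h : SeriesEqOn S F G)
    {H : PowerSeries (Module.End ℂ V)} (hH : ∀ s, ∀ w ∈ S', PowerSeries.coeff s H w ∈ S) :
    SeriesEqOn S' (F * H) (G * H) := by
  intro s w hw
  rw [PowerSeries.coeff_mul, PowerSeries.coeff_mul, LinearMap.sum_apply, LinearMap.sum_apply]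
  refine Finset.sum_congr rfl fun p _ => ?_
  rw [Module.End.mul_apply, Module.End.mul_apply, h _ _ (hH _ w hw)]

lemma SeriesEqOn.sum {ι : Type} {s : Finset ι} {F G : ι → PowerSeries (Module.End ℂ V)}
    (h : ∀ i ∈ s, SeriesEqOn S (F i) (G i)) : SeriesEqOn S (∑ i ∈ s, F i) (∑ i ∈ s, G i) := by
  intro r w hw
  rw [map_sum, map_sum, LinearMap.sum_apply, LinearMap.sum_apply]
  exact Finset.sum_congr rfl fun i hi => h i hi r w hw

variable {E : Fin N → Fin n → Fin n → Module.End ℂ V}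
  {P : Equiv.Perm (Fin N) →* Module.End ℂ V}

/-- On a vector fixed by the exchanges of `k` with the positions in `s`, the quadratic term of the
product collapses to `s.card • E k b a`. By the resolvent identity it turns the coefficient `(u - x
+ s.card)⁻¹` of `E k b a` into `(u - x)⁻¹`, which is that of the positions in `s`. -/
lemma lMatrix_fusion
    (hEE : ∀ i j, i ≠ j → ∀ a b, ∑ c, E i c a * E j b c = E j b a * P (Equiv.swap i j))
    {s : Finset (Fin N)} {k : Fin N} (hk : k ∉ s)
    (hS : ∀ i ∈ s, ∀ w ∈ S, P (Equiv.swap i k) w = w) (x : ℂ) (a b : Fin n) :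
    SeriesEqOn S
      ((lMatrix (fun a b => ∑ i ∈ s, E i a b) (algebraMap ℂ (Module.End ℂ V) x) *
        lMatrix (E k) (algebraMap ℂ (Module.End ℂ V) (x - s.card))) a b)
      (lMatrix (fun a b => ∑ i ∈ insert k s, E i a b) (algebraMap ℂ (Module.End ℂ V) x) a b) := by
  intro r w hw
  have hsum : (∑ c, (∑ i ∈ s, E i c a) * E k b c) w = (s.card : ℂ) • E k b a w := by
    simp only [Finset.sum_mul]
    rw [Finset.sum_comm, LinearMap.sum_apply, Finset.sum_congr rfl fun i hi => ?_,
      Finset.sum_const, Nat.cast_smul_eq_nsmul]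
    have hik : i ≠ k := fun h => hk (h ▸ hi)
    rw [hEE i k hik, Module.End.mul_apply, hS i hi w hw]
  have hc : ∀ (f : PowerSeries ℂ) (X : Module.End ℂ V),
      letI := scalarSeriesAlgebra (Module.End ℂ V)
      PowerSeries.coeff r (f • PowerSeries.C X) w = PowerSeries.coeff r f • X w := by
    intro f X
    rw [smul_scalarSeries, PowerSeries.coeff_mul_C, PowerSeries.coeff_map, Module.End.mul_apply,
      Module.algebraMap_end_apply]
  have hδ : ∀ f : PowerSeries ℂ,
      letI := scalarSeriesAlgebra (Module.End ℂ V)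
      PowerSeries.coeff r (f • (1 : PowerSeries (Module.End ℂ V))) w =
        PowerSeries.coeff r f • w := by
    intro f
    rw [smul_scalarSeries, mul_one, PowerSeries.coeff_map, Module.algebraMap_end_apply]
  have hres := congrArg (PowerSeries.coeff r) (resolventSeries_sub x (x - s.card))
  rw [map_sub, PowerSeries.coeff_C_mul, mul_comm (resolventSeries x)] at hres
  rw [lMatrix_mul_lMatrix, coeff_lMatrix]
  simp only [map_add, LinearMap.add_apply, hc, hδ, hsum, Finset.sum_insert hk, LinearMap.smul_apply]
  have h1 : PowerSeries.coeff r (if a = b then 1 else 0 : PowerSeries ℂ) • w =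
      (if r = 0 ∧ a = b then (1 : Module.End ℂ V) else 0) w := by
    by_cases h1 : a = b <;> by_cases h2 : r = 0 <;> simp [h1, h2, PowerSeries.coeff_one]
  rw [h1]
  linear_combination (norm := module) hres • E k b a w

lemma lMatrix_zero {A : Type} [Ring A] (d : A) :
    lMatrix (fun _ _ => 0 : Fin n → Fin n → A) d = 1 := by
  ext1 a b
  simp [lMatrix, Matrix.one_apply]

/-- The product over the blocks, restricted to the first `k` positions. -/
def prefixBlocks (E : Fin N → Fin n → Fin n → Module.End ℂ V) (α : ℝ) (m : Fin N → ℤ) (l : List ℤ)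
    (k : ℕ) : Matrix (Fin n) (Fin n) (PowerSeries (Module.End ℂ V)) :=
  (l.map fun c => lMatrix
    (fun a b => ∑ i ∈ Finset.univ.filter fun i : Fin N => m i = c ∧ (i : ℕ) < k, E i a b)
    (algebraMap ℂ (Module.End ℂ V) (-blockShift α m c))).prod

lemma antitone_eq_between {m : Fin N → ℤ} (hm : Antitone m) {i j k : Fin N} (hij : i ≤ j)
    (hjk : j ≤ k) (h : m i = m k) : m i = m j :=
  le_antisymm (h ▸ hm hjk) (hm hij)

lemma card_position {m : Fin N → ℤ} (hm : Antitone m) (k : Fin N) :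
    (Finset.univ.filter fun i : Fin N => m k < m i).card +
      (Finset.univ.filter fun i : Fin N => m i = m k ∧ (i : ℕ) < k).card = k := by
  rw [← Finset.card_union_of_disjoint]
  · have : (Finset.univ.filter fun i : Fin N => m k < m i) ∪
        (Finset.univ.filter fun i : Fin N => m i = m k ∧ (i : ℕ) < k) = Finset.Iio k := by
      ext i
      simp only [Finset.mem_union, Finset.mem_filter, Finset.mem_univ, true_and, Finset.mem_Iio,
        Fin.lt_def]
      constructor
      · rintro (h | h)
        · by_contra hik
          exact absurd (hm (Fin.le_def.2 (not_lt.1 hik))) (not_le.2 h)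
        · exact h.2
      · intro h
        rcases (hm (Fin.le_def.2 h.le)).lt_or_eq with h' | h'
        · exact Or.inl h'
        · exact Or.inr ⟨h'.symm, h⟩
    rw [this, Fin.card_Iio]
  · rw [Finset.disjoint_left]
    intro i h1 h2
    simp only [Finset.mem_filter] at h1 h2
    exact h1.2.ne' h2.2.1

/-- The vectors invariant under exchanges of positions `< k` in the same block. -/
def prefixSym (P : Equiv.Perm (Fin N) →* Module.End ℂ V) (m : Fin N → ℤ) (k : ℕ) : Set V :=
  {w | ∀ i j : Fin N, (i : ℕ) < k → (j : ℕ) < k → m i = m j → P (Equiv.swap i j) w = w}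

lemma coeff_lMatrix_mem_prefixSym (hPE : ∀ w k a b, P w * E k a b = E (w k) a b * P w)
    {m : Fin N → ℤ} (k : Fin N) (x : ℂ) (a b : Fin n) (s : ℕ) {w : V}
    (hw : w ∈ prefixSym P m (k + 1)) :
    PowerSeries.coeff s (lMatrix (E k) (algebraMap ℂ (Module.End ℂ V) x) a b) w ∈
      prefixSym P m k := by
  intro i j hi hj hij
  have hki : k ≠ i := by rintro rfl; exact lt_irrefl _ hi
  have hkj : k ≠ j := by rintro rfl; exact lt_irrefl _ hj
  have h1 : ∀ a b, Commute (E k a b) (P (Equiv.swap i j)) := by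
    intro a b
    have := hPE (Equiv.swap i j) k a b
    rw [Equiv.swap_apply_of_ne_of_ne hki hkj] at this
    exact this.symm
  have h2 := congrArg (PowerSeries.coeff s) (commute_C_lMatrix h1 x a b)
  rw [PowerSeries.coeff_C_mul, PowerSeries.coeff_mul_C] at h2
  have h3 := LinearMap.congr_fun h2 w
  rw [Module.End.mul_apply, Module.End.mul_apply, hw i j (by omega) (by omega) hij] at h3
  exact h3.symm

lemma prefixBlocks_zero (E : Fin N → Fin n → Fin n → Module.End ℂ V) (α : ℝ) (m : Fin N → ℤ)
    (l : List ℤ) : prefixBlocks E α m l 0 = 1 := by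
  refine List.prod_eq_one fun T hT => ?_
  obtain ⟨c, hc, rfl⟩ := List.mem_map.1 hT
  simpa using lMatrix_zero (n := n) (algebraMap ℂ (Module.End ℂ V) (-blockShift α m c))

/-- On vectors symmetric in every block of positions, the monodromy matrix is the product over the
blocks of the evaluation representations. -/
theorem prefixMonodromy_fusion (hPE : ∀ w k a b, P w * E k a b = E (w k) a b * P w)
    (hEE : ∀ i j, i ≠ j → ∀ a b, ∑ c, E i c a * E j b c = E j b a * P (Equiv.swap i j))
    (α : ℝ) {m : Fin N → ℤ} (hm : Antitone m) (k : ℕ) (hk : k ≤ N) (a b : Fin n) :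
    SeriesEqOn (prefixSym P m k) (prefixMonodromy E (xi α m 1) k a b)
      (prefixBlocks E α m (blockValues m) k a b) := by
  induction k generalizing a b with
  | zero =>
    intro s w _
    rw [prefixMonodromy_zero, prefixBlocks_zero]
  | succ k ih =>
    set κ : Fin N := ⟨k, by omega⟩ with hκ
    have e1 : prefixMonodromy E (xi α m 1) (k + 1) = prefixMonodromy E (xi α m 1) k *
      lMatrix (E κ) (algebraMap ℂ _ (xi α m 1 κ)) := prefixMonodromy_succ E (xi α m 1) κ
    -- Split the list at the block containing the position `k`: the blocks in `l₁` do not change in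
    -- this step, those in `l₂` are still empty and contribute the identity matrix.
    obtain ⟨l₁, l₂, hl⟩ := List.append_of_mem (a := m κ) (l := blockValues m) (by
      simp [blockValues])
    have hsort : (blockValues m).Pairwise (· > ·) := by
      exact Finset.sortedGT_sort _ |>.pairwise
    have hnd := blockValues_nodup m
    rw [hl] at hsort hnd ⊢
    have hl₁ : ∀ c ∈ l₁, c ≠ m κ := by
      rintro c hc rfl
      rw [List.nodup_append] at hnd
      exact hnd.2.2 _ hc _ (by simp) rfl
    have hl₂ : ∀ c ∈ l₂, c < m κ := by
      intro c hc
      rw [List.pairwise_append] at hsort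
      exact List.rel_of_pairwise_cons hsort.2.1 hc
    have hpre : ∀ p, prefixBlocks E α m (l₁ ++ m κ :: l₂) p = prefixBlocks E α m l₁ p *
        (lMatrix (fun a b => ∑ i ∈ Finset.univ.filter fun i : Fin N => m i = m κ ∧ (i : ℕ) < p,
          E i a b) (algebraMap ℂ (Module.End ℂ V) (-blockShift α m (m κ))) *
            prefixBlocks E α m l₂ p) := by
      intro p
      simp [prefixBlocks]
    have hone : ∀ p ≤ k + 1, prefixBlocks E α m l₂ p = 1 := by
      intro p hp
      refine List.prod_eq_one fun T hT => ?_
      obtain ⟨c, hc, rfl⟩ := List.mem_map.1 hT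
      have hempty : (Finset.univ.filter fun i : Fin N => m i = c ∧ (i : ℕ) < p) = ∅ := by
        rw [Finset.filter_eq_empty_iff]
        rintro i - ⟨rfl, hi⟩
        have hik : i ≤ κ := Fin.le_def.2 (by rw [hκ]; simp only; omega)
        exact absurd (hm hik) (not_le.2 (hl₂ _ hc))
      rw [hempty]
      simpa using lMatrix_zero (n := n) (algebraMap ℂ (Module.End ℂ V) (-blockShift α m c))
    have hsame : prefixBlocks E α m l₁ (k + 1) = prefixBlocks E α m l₁ k := by
      refine congrArg List.prod (List.map_congr_left fun c hc => ?_)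
      have : (Finset.univ.filter fun i : Fin N => m i = c ∧ (i : ℕ) < k + 1) =
          Finset.univ.filter fun i : Fin N => m i = c ∧ (i : ℕ) < k := by
        refine Finset.filter_congr fun i _ => and_congr_right fun hi => ?_
        have : (i : ℕ) ≠ k := by
          intro h
          have : i = κ := Fin.ext h
          exact hl₁ c hc (by rw [← hi, this])
        omega
      rw [this]
    have hins : (Finset.univ.filter fun i : Fin N => m i = m κ ∧ (i : ℕ) < k + 1) =
        insert κ (Finset.univ.filter fun i : Fin N => m i = m κ ∧ (i : ℕ) < k) := by
      ext i
      simp only [Finset.mem_insert, Finset.mem_filter, Finset.mem_univ, true_and]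
      constructor
      · rintro ⟨h1, h2⟩
        by_cases h : (i : ℕ) = k
        · exact Or.inl (Fin.ext h)
        · exact Or.inr ⟨h1, by omega⟩
      · rintro (rfl | ⟨h1, h2⟩)
        · exact ⟨rfl, by simp [hκ]⟩
        · exact ⟨h1, by omega⟩
    -- Inside a block the parameters decrease by one per position, so the new factor carries exactly
    -- the shift that `lMatrix_fusion` requires.
    have hx : xi α m 1 κ = -blockShift α m (m κ) -
        ((Finset.univ.filter fun i : Fin N => m i = m κ ∧ (i : ℕ) < k).card : ℂ) := by
      have h1 := card_position hm κ
      have h2 : ((Finset.univ.filter fun i : Fin N => m κ < m i).card : ℂ) +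
        ((Finset.univ.filter fun i : Fin N => m i = m κ ∧ (i : ℕ) < k).card : ℂ) = (k : ℂ) := by
        exact_mod_cast h1
      rw [xi, blockShift, Equiv.Perm.one_apply]
      have h3 : ((κ : ℕ) : ℂ) = (k : ℂ) := rfl
      rw [h3, ← h2]
      ring
    -- The induction hypothesis can be used behind the new factor because the operators at position
    -- `k` commute with all exchanges of earlier positions and so preserve that symmetry.
    have step1 : SeriesEqOn (prefixSym P m (k + 1))
        (prefixMonodromy E (xi α m 1) (k + 1) a b)
        ((prefixBlocks E α m (l₁ ++ m κ :: l₂) k *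
          lMatrix (E κ) (algebraMap ℂ _ (xi α m 1 κ))) a b) := by
      rw [e1, Matrix.mul_apply, Matrix.mul_apply]
      refine SeriesEqOn.sum fun c _ => ?_
      have ih' := ih (by omega) a c
      rw [hl] at ih'
      exact ih'.mul_right fun s w hw => coeff_lMatrix_mem_prefixSym hPE κ _ _ _ _ hw
    have step2 : SeriesEqOn (prefixSym P m (k + 1))
        ((prefixBlocks E α m (l₁ ++ m κ :: l₂) k *
          lMatrix (E κ) (algebraMap ℂ _ (xi α m 1 κ))) a b)
        (prefixBlocks E α m (l₁ ++ m κ :: l₂) (k + 1) a b) := by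
      rw [hpre, hpre, hone k (by omega), hone (k + 1) le_rfl, mul_one, mul_one, mul_assoc, hsame,
        hx, hins, Matrix.mul_apply, Matrix.mul_apply]
      refine SeriesEqOn.sum fun c _ => SeriesEqOn.mul_left ?_ _
      refine lMatrix_fusion hEE (by simp [hκ]) (fun i hi w hw => ?_) _ _ _
      simp only [Finset.mem_filter] at hi
      exact hw i κ (by omega) (by simp [hκ]) hi.2.1
    intro s w hw
    rw [step1 s w hw, step2 s w hw]

/-- Invariance under adjacent exchanges inside the blocks implies invariance under all exchanges
inside the blocks. -/
lemma mem_prefixSym_of_adj {m : Fin N → ℤ} (hm : Antitone m) {w : V}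
    (hw : ∀ i j, Adj i j → m i = m j → P (Equiv.swap i j) w = w) : w ∈ prefixSym P m N := by
  have key : ∀ (d : ℕ) (i j : Fin N), (j : ℕ) = i + d → m i = m j → P (Equiv.swap i j) w = w := by
    intro d
    induction d with
    | zero =>
      intro i j h _
      have : i = j := Fin.ext (by omega)
      rw [this, Equiv.swap_self]
      exact LinearMap.congr_fun (map_one P) w
    | succ d ih =>
      intro i j h hij
      rcases Nat.eq_zero_or_pos d with rfl | hd
      · exact hw i j h.symm hij
      let k : Fin N := ⟨i + d, by omega⟩
      have hk1 : i < k := by rw [Fin.lt_def]; simp only [k]; omega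
      have hkj : Adj k j := by simp only [Adj, k]; omega
      have hik : m i = m k := antitone_eq_between hm hk1.le hkj.lt.le hij
      have e : Equiv.swap i j = Equiv.swap k j * Equiv.swap i k * Equiv.swap k j := by
        rw [Equiv.swap_mul_swap_mul_swap hk1.ne (hk1.trans hkj.lt).ne, Equiv.swap_comm]
      have h1 := hw k j hkj (hik.symm.trans hij)
      have h2 := ih i k rfl hik
      rw [e, map_mul, map_mul, Module.End.mul_apply, Module.End.mul_apply, h1, h2, h1]
  intro i j _ _ hij
  rcases le_total i j with h | h
  · exact key (j - i) i j (by rw [Fin.le_def] at h; omega) hij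
  · rw [Equiv.swap_comm]
    exact key (i - j) j i (by rw [Fin.le_def] at h; omega) hij.symm

end Fusion

/-! ### Compositions and their sorting permutations -/

/-- The position of `a_i` when the entries of `a` are sorted into weakly decreasing order,
equal entries being kept in their order; positions are counted from `1`. -/
def entryRank {N : ℕ} (a : Fin N → ℤ) (i : Fin N) : ℕ :=
  (Finset.univ.filter fun j : Fin N => a i < a j ∨ (a i = a j ∧ j ≤ i)).card

section Sorting

variable {N : ℕ}

lemma entryRank_eq (a : Fin N → ℤ) (i : Fin N) : entryRank a i =
    (Finset.univ.filter fun j : Fin N => j ≤ i ∧ a i ≤ a j).card +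
      (Finset.univ.filter fun j : Fin N => i < j ∧ a i < a j).card := by
  rw [entryRank, ← Finset.card_union_of_disjoint]
  · congr 1
    ext j
    simp only [Finset.mem_union, Finset.mem_filter, Finset.mem_univ, true_and]
    rcases le_or_gt j i with h | h
    · simp only [h, and_true, true_and, not_lt.2 h, false_and, or_false, le_iff_lt_or_eq]
    · simp only [h, not_le.2 h, and_false, or_false, true_and, false_and, false_or]
  · rw [Finset.disjoint_left]
    intro j h1 h2
    simp only [Finset.mem_filter] at h1 h2
    exact absurd h2.2.1 (not_lt.2 h1.2.1)

lemma entryRank_lt {a : Fin N → ℤ} {i j : Fin N} (h : a i < a j ∨ (a i = a j ∧ j < i)) :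
    entryRank a j < entryRank a i := by
  refine Finset.card_lt_card (Finset.ssubset_iff_of_subset ?_ |>.2 ⟨i, ?_, ?_⟩)
  · intro k hk
    simp only [Finset.mem_filter, Finset.mem_univ, true_and, Fin.le_def, Fin.lt_def] at *
    omega
  · simp
  · simp only [Finset.mem_filter, Finset.mem_univ, true_and, Fin.le_def, Fin.lt_def] at *
    omega

lemma entryRank_injective (a : Fin N → ℤ) : Function.Injective (entryRank a) := by
  intro i j h
  by_contra hij
  rcases lt_trichotomy (a i) (a j) with h1 | h1 | h1
  · exact (entryRank_lt (Or.inl h1)).ne' h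
  · rcases lt_or_gt_of_ne hij with h2 | h2
    · exact (entryRank_lt (Or.inr ⟨h1.symm, h2⟩)).ne h
    · exact (entryRank_lt (Or.inr ⟨h1, h2⟩)).ne' h
  · exact (entryRank_lt (Or.inl h1)).ne h

lemma entryRank_pos (a : Fin N → ℤ) (i : Fin N) : 0 < entryRank a i :=
  Finset.card_pos.2 ⟨i, by simp⟩

lemma entryRank_le (a : Fin N → ℤ) (i : Fin N) : entryRank a i ≤ N := by
  simpa [entryRank] using Finset.card_le_univ
    (Finset.univ.filter fun j : Fin N => a i < a j ∨ (a i = a j ∧ j ≤ i))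

/-- The permutation that sorts `a`. -/
def sortPerm (a : Fin N → ℤ) : Equiv.Perm (Fin N) :=
  Equiv.ofBijective
    (fun i => (⟨entryRank a i - 1, by have := entryRank_pos a i; have := entryRank_le a i; omega⟩ :
      Fin N))
    (Finite.injective_iff_bijective.1 fun i j h => entryRank_injective a (by
      have := entryRank_pos a i
      have := entryRank_pos a j
      simp only [Fin.mk.injEq] at h
      omega))

lemma sortPerm_add_one (a : Fin N → ℤ) (i : Fin N) : (sortPerm a i : ℕ) + 1 = entryRank a i := by
  have := entryRank_pos a i
  change entryRank a i - 1 + 1 = _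
  omega

lemma mem_sortSet_iff_entryRank {m : Fin N → ℤ} {σ : Equiv.Perm (Fin N)} :
    σ ∈ sortSet m ↔ ∀ i, (σ i : ℕ) + 1 = entryRank (m ∘ σ) i := by
  simp only [sortSet, Finset.mem_filter, Finset.mem_univ, true_and, entryRank_eq,
    Function.comp_apply]

lemma sortPerm_comp {m : Fin N → ℤ} {σ : Equiv.Perm (Fin N)} (h : σ ∈ sortSet m) :
    sortPerm (m ∘ σ) = σ := by
  rw [mem_sortSet_iff_entryRank] at h
  ext i
  have h1 := sortPerm_add_one (m ∘ σ) i
  have h2 := h i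
  omega

/-- The decreasing rearrangement of `a`. -/
def sorted (a : Fin N → ℤ) : Fin N → ℤ := a ∘ (sortPerm a).symm

lemma sorted_comp_sortPerm (a : Fin N → ℤ) : sorted a ∘ sortPerm a = a := by
  ext i; simp [sorted]

lemma sorted_antitone (a : Fin N → ℤ) : Antitone (sorted a) := by
  intro k l hkl
  by_contra! h
  have h1 := entryRank_lt (a := a) (i := (sortPerm a).symm k) (j := (sortPerm a).symm l) (Or.inl h)
  rw [← sortPerm_add_one, ← sortPerm_add_one] at h1
  rw [Equiv.apply_symm_apply, Equiv.apply_symm_apply] at h1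
  rw [Fin.le_def] at hkl
  omega

lemma sortPerm_mem (a : Fin N → ℤ) : sortPerm a ∈ sortSet (sorted a) := by
  rw [mem_sortSet_iff_entryRank, sorted_comp_sortPerm]
  exact sortPerm_add_one a

lemma sorted_comp {m : Fin N → ℤ} {σ : Equiv.Perm (Fin N)} (h : σ ∈ sortSet m) :
    sorted (m ∘ σ) = m := by
  rw [sorted, sortPerm_comp h]
  ext i; simp

lemma antitone_rearrangement_unique {β : Type} [LinearOrder β] {f g : Fin N → β}
    (hf : Antitone f) (hg : Antitone g) {s : Equiv.Perm (Fin N)} (h : g = f ∘ s) : g = f := by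
  have h1 := Tuple.unique_monotone (f := (OrderDual.toDual ∘ f : Fin N → βᵒᵈ)) (σ := 1) (τ := s)
    (fun i j hij => hf hij) (fun i j hij => by subst h; exact hg hij)
  ext i
  rw [h]
  exact (congrFun h1 i).symm

lemma sorted_comp_perm (a : Fin N → ℤ) (s : Equiv.Perm (Fin N)) : sorted (a ∘ s) = sorted a := by
  refine antitone_rearrangement_unique (s := sortPerm a * s * (sortPerm (a ∘ s))⁻¹)
    (sorted_antitone a) (sorted_antitone _) ?_
  ext i
  simp [sorted, Equiv.Perm.inv_def]

/-- So `S^m` consists of the shortest representatives of the cosets of the stabilizer of `m`: the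
rank condition says only that ties are kept in order. -/
lemma mem_sortSet_iff {m : Fin N → ℤ} (hm : Antitone m) {σ : Equiv.Perm (Fin N)} :
    σ ∈ sortSet m ↔ ∀ i j, i < j → m (σ i) = m (σ j) → σ i < σ j := by
  constructor
  · intro h i j hij he
    rw [mem_sortSet_iff_entryRank] at h
    have h1 : entryRank (m ∘ σ) i < entryRank (m ∘ σ) j := entryRank_lt (Or.inr ⟨he.symm, hij⟩)
    rw [← h, ← h] at h1
    rw [Fin.lt_def]
    omega
  · intro h
    rw [mem_sortSet_iff_entryRank]
    intro i
    have : (Finset.univ.filter fun j : Fin N =>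
        (m ∘ σ) i < (m ∘ σ) j ∨ ((m ∘ σ) i = (m ∘ σ) j ∧ j ≤ i)) =
        (Finset.Iic (σ i)).map σ.symm.toEmbedding := by
      ext j
      simp only [Finset.mem_filter, Finset.mem_univ, true_and, Finset.mem_map_equiv,
        Equiv.symm_symm, Finset.mem_Iic, Function.comp_apply]
      constructor
      · rintro (h1 | ⟨h1, h2⟩)
        · by_contra h3
          exact absurd (hm (not_le.1 h3).le) (not_le.2 h1)
        · rcases h2.eq_or_lt with rfl | h2
          · exact le_rfl
          · exact (h j i h2 h1.symm).le
      · intro h1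
        rcases (hm h1).lt_or_eq with h2 | h2
        · exact Or.inl h2
        · refine Or.inr ⟨h2, ?_⟩
          by_contra h3
          exact absurd h1 (not_le.2 (h i j (not_le.1 h3) h2))
    rw [entryRank, this, Finset.card_map, Fin.card_Iic]

lemma one_mem_sortSet {m : Fin N → ℤ} (hm : Antitone m) : (1 : Equiv.Perm (Fin N)) ∈ sortSet m :=
  (mem_sortSet_iff hm).2 fun _ _ h _ => h

lemma mul_swap_mem_sortSet {m : Fin N → ℤ} (hm : Antitone m) {σ : Equiv.Perm (Fin N)}
    (hσ : σ ∈ sortSet m) {i j : Fin N} (hij : Adj i j) (h : m (σ i) ≠ m (σ j)) :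
    σ * Equiv.swap i j ∈ sortSet m := by
  rw [mem_sortSet_iff hm] at *
  intro p q hpq he
  refine hσ _ _ (swap_lt_swap hij hpq ?_) he
  rintro ⟨rfl, rfl⟩
  exact h (by simpa using he.symm)

/-- A position strictly between `σ i` and `σ j` would belong to the same block of `m`; as `σ` keeps
the order inside a block, its preimage would lie strictly between the neighbours `i` and `j`. -/
lemma sortSet_apply_of_eq {m : Fin N → ℤ} (hm : Antitone m) {σ : Equiv.Perm (Fin N)}
    (hσ : σ ∈ sortSet m) {i j : Fin N} (hij : Adj i j) (h : m (σ i) = m (σ j)) :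
    Adj (σ i) (σ j) := by
  have h1 := (mem_sortSet_iff hm).1 hσ
  have h2 := h1 i j hij.lt h
  by_contra h3
  unfold Adj at h3 hij
  have hk : (σ i : ℕ) + 1 < N := by rw [Fin.lt_def] at h2; omega
  set k : Fin N := ⟨σ i + 1, hk⟩ with hkdef
  have hk1 : σ i < k := by rw [Fin.lt_def, hkdef]; simp
  have hk2 : k < σ j := by rw [Fin.lt_def] at *; rw [hkdef]; simp only; omega
  have hmk : m (σ i) = m k := antitone_eq_between hm hk1.le hk2.le h
  obtain ⟨l, hl⟩ := σ.surjective k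
  rcases lt_trichotomy l i with h4 | h4 | h4
  · exact absurd (h1 l i h4 (by rw [hl, hmk])) (by rw [hl]; exact not_lt.2 hk1.le)
  · exact hk1.ne (by rw [← hl, h4])
  · rcases lt_trichotomy l j with h5 | h5 | h5
    · rw [Fin.lt_def] at h4 h5; omega
    · exact hk2.ne (by rw [← hl, h5])
    · exact absurd (h1 j l h5 (by rw [hl, ← hmk, h])) (by rw [hl]; exact not_lt.2 hk2.le)

/-- A descent of `σ` cannot occur between equal values of `m`, so it is a strict rise of `m ∘ σ`,
and removing it stays in `S^m`. -/
lemma exists_ascent {m : Fin N → ℤ} (hm : Antitone m) {σ : Equiv.Perm (Fin N)}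
    (hσ : σ ∈ sortSet m) (h : σ ≠ 1) : ∃ i j, Adj i j ∧ m (σ i) < m (σ j) ∧ σ j < σ i := by
  obtain ⟨i, j, hij, hlt⟩ := exists_descent h
  refine ⟨i, j, hij, lt_of_le_of_ne (hm hlt.le) fun he => ?_, hlt⟩
  exact lt_asymm hlt ((mem_sortSet_iff hm).1 hσ i j hij.lt he)

end Sorting

/-! ### Spectra -/

/-- The joint spectrum of the Dunkl operators belonging to the composition `a`. -/
def spec {N : ℕ} (α : ℝ) (a : Fin N → ℤ) (i : Fin N) : ℂ := (α : ℂ) * a i - entryRank a i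

section Spectra

variable {N : ℕ} {α : ℝ}

lemma xi_eq_spec {m : Fin N → ℤ} {σ : Equiv.Perm (Fin N)} (h : σ ∈ sortSet m) :
    xi α m σ = spec α (m ∘ σ) := by
  rw [mem_sortSet_iff_entryRank] at h
  ext i
  rw [spec, ← h, xi]
  push_cast
  rfl

lemma xi_strictAnti (hα : 0 < α) {m : Fin N → ℤ} (hm : Antitone m) :
    StrictAnti fun i => α * m i - ((i : ℕ) + 1 : ℝ) := by
  intro i j hij
  have h1 : (m j : ℝ) ≤ m i := by exact_mod_cast hm hij.le
  have h2 : ((i : ℕ) : ℝ) < (j : ℕ) := by exact_mod_cast hij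
  have h3 := mul_le_mul_of_nonneg_left h1 hα.le
  linarith

lemma xi_one_injective (hα : 0 < α) {m : Fin N → ℤ} (hm : Antitone m) :
    Function.Injective (xi α m 1) := by
  intro i j h
  refine (xi_strictAnti hα hm).injective ?_
  simp only [xi, Equiv.Perm.one_apply] at h
  exact_mod_cast h

lemma xi_eq (m : Fin N → ℤ) (σ : Equiv.Perm (Fin N)) : xi α m σ = xi α m 1 ∘ σ := rfl

lemma xi_mul (m : Fin N → ℤ) (σ τ : Equiv.Perm (Fin N)) : xi α m (σ * τ) = xi α m σ ∘ τ := rfl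

/-- A composition is determined by its spectrum. -/
lemma spec_eq (hα : 0 < α) {a b : Fin N → ℤ} {s : Equiv.Perm (Fin N)}
    (h : spec α a ∘ s = spec α b) : b = a ∘ s ∧ sortPerm b = sortPerm a * s := by
  have ha : spec α a = xi α (sorted a) 1 ∘ sortPerm a := by
    rw [← xi_eq, xi_eq_spec (sortPerm_mem a), sorted_comp_sortPerm]
  have hb : spec α b = xi α (sorted b) 1 ∘ sortPerm b := by
    rw [← xi_eq, xi_eq_spec (sortPerm_mem b), sorted_comp_sortPerm]
  have hA := xi_strictAnti hα (sorted_antitone a)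
  have hB := xi_strictAnti hα (sorted_antitone b)
  -- The two sorted spectra are strictly decreasing real sequences and rearrangements of each other,
  -- so they coincide; strictness then also identifies the sorting permutations.
  have h1 : (fun i => α * sorted b i - ((i : ℕ) + 1 : ℝ)) =
      (fun i => α * sorted a i - ((i : ℕ) + 1 : ℝ)) ∘ (sortPerm a * s * (sortPerm b)⁻¹) := by
    ext i
    have := congrFun h ((sortPerm b)⁻¹ i)
    rw [ha, hb] at this
    simp only [xi, Function.comp_apply, Equiv.Perm.one_apply, Equiv.Perm.inv_def,
      Equiv.apply_symm_apply] at this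
    simp only [Function.comp_apply, Equiv.Perm.mul_apply, Equiv.Perm.inv_def]
    exact_mod_cast this.symm
  have h2 := antitone_rearrangement_unique hA.antitone hB.antitone h1
  have h3 : sortPerm b = sortPerm a * s := by
    ext1 i
    refine hA.injective ?_
    have := congrFun (h2.symm.trans h1) (sortPerm b i)
    rw [this]
    simp
  refine ⟨?_, h3⟩
  have h4 : sorted b = sorted a := by
    ext i
    have := congrFun h2 i
    simp only [sub_left_inj, mul_eq_mul_left_iff, Int.cast_inj, hα.ne', or_false] at this
    exact this
  calc b = sorted b ∘ sortPerm b := (sorted_comp_sortPerm b).symm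
    _ = (sorted a ∘ sortPerm a) ∘ s := by rw [h4, h3]; rfl
    _ = a ∘ s := by rw [sorted_comp_sortPerm]

lemma spec_injective (hα : 0 < α) : Function.Injective (spec (N := N) α) := fun _ _ h =>
  (spec_eq hα (s := 1) h).1.symm

end Spectra

/-! ### The order on compositions -/

/-- The order on compositions induced by `PairGT`. -/
def CompGT {N : ℕ} (a b : Fin N → ℤ) : Prop :=
  PairGT (sorted a) (sortPerm a) (sorted b) (sortPerm b)

section Order

variable {N : ℕ}

lemma compGT_iff {a b : Fin N → ℤ} : CompGT a b ↔ DomGT (sorted a) (sorted b) ∨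
    (sorted a = sorted b ∧ ∃ k, a k < b k ∧ ∀ j, k < j → a j = b j) := by
  refine or_congr_right (and_congr_right fun h => exists_congr fun k => ?_)
  have h1 : ∀ j, sorted a (sortPerm a j) = a j := congrFun (sorted_comp_sortPerm a)
  have h2 : ∀ j, sorted a (sortPerm b j) = b j := by
    rw [h]; exact congrFun (sorted_comp_sortPerm b)
  simp only [h1, h2, sub_neg, sub_eq_zero]

lemma eq_of_partial_sums {f g : Fin N → ℤ}
    (h : ∀ k : Fin N, ∑ i ∈ Finset.Iic k, f i = ∑ i ∈ Finset.Iic k, g i) : f = g := by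
  ext k
  induction k using WellFoundedLT.induction with
  | _ k ih =>
    have h1 := h k
    rw [← Finset.Iio_insert, Finset.sum_insert (by simp), Finset.sum_insert (by simp),
      Finset.sum_congr rfl fun i hi => ih i (Finset.mem_Iio.1 hi)] at h1
    exact add_right_cancel h1

lemma DomGT.trans {f g h : Fin N → ℤ} (h1 : DomGT f g) (h2 : DomGT g h) : DomGT f h := by
  refine ⟨?_, h1.2.1.trans h2.2.1, fun k => (h2.2.2 k).trans (h1.2.2 k)⟩
  rintro rfl
  exact h1.1 (eq_of_partial_sums fun k => le_antisymm (h2.2.2 k) (h1.2.2 k))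

lemma CompGT.trans {a b c : Fin N → ℤ} (h1 : CompGT a b) (h2 : CompGT b c) : CompGT a c := by
  rw [compGT_iff] at *
  rcases h1 with h1 | ⟨h1, k, hk, hk'⟩
  · rcases h2 with h2 | ⟨h2, _⟩
    · exact Or.inl (h1.trans h2)
    · exact Or.inl (h2 ▸ h1)
  · rcases h2 with h2 | ⟨h2, l, hl, hl'⟩
    · exact Or.inl (h1 ▸ h2)
    · refine Or.inr ⟨h1.trans h2, max k l, ?_, fun j hj => ?_⟩
      · rcases lt_trichotomy k l with h | rfl | h
        · rw [max_eq_right h.le, hk' l h]; exact hl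
        · rw [max_self]; exact hk.trans hl
        · rw [max_eq_left h.le, ← hl' k h]; exact hk
      · rw [hk' j ((le_max_left _ _).trans_lt hj), hl' j ((le_max_right _ _).trans_lt hj)]

lemma CompGT.irrefl (a : Fin N → ℤ) : ¬ CompGT a a := by
  rw [compGT_iff]
  rintro (h | ⟨_, k, hk, _⟩)
  · exact h.1 rfl
  · exact lt_irrefl _ hk

lemma compGT_swap {a : Fin N → ℤ} {i j : Fin N} (hij : i < j) (h : a j < a i) :
    CompGT a (a ∘ Equiv.swap i j) := by
  rw [compGT_iff]
  refine Or.inr ⟨(sorted_comp_perm _ _).symm, j, by simpa using h, fun k hk => ?_⟩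
  rw [Function.comp_apply, Equiv.swap_apply_of_ne_of_ne (hij.trans hk).ne' hk.ne']

lemma sum_sorted {β : Type} [AddCommMonoid β] (a : Fin N → ℤ) (f : ℤ → β) :
    ∑ i, f (sorted a i) = ∑ i, f (a i) :=
  Equiv.sum_comp (sortPerm a).symm fun i => f (a i)

lemma sum_le_of_pinch {a b : Fin N → ℤ} {i j : Fin N} (hij : i ≠ j)
    (hb : ∀ k, k ≠ i → k ≠ j → b k = a k) {f : ℤ → ℤ}
    (h : f (b i) + f (b j) ≤ f (a i) + f (a j)) : ∑ k, f (b k) ≤ ∑ k, f (a k) := by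
  have h1 : ∑ k, (f (a k) - f (b k)) = (f (a i) - f (b i)) + (f (a j) - f (b j)) := by
    refine Fintype.sum_eq_add i j hij ?_
    rintro k ⟨h1, h2⟩
    rw [hb k h1 h2, sub_self]
  rw [Finset.sum_sub_distrib] at h1
  linarith

/-- Moving two entries strictly closer to each other makes a composition smaller. -/
lemma compGT_pinch {a b : Fin N → ℤ} {i j : Fin N} (hij : i ≠ j)
    (hb : ∀ k, k ≠ i → k ≠ j → b k = a k) (hs : b i + b j = a i + a j)
    (h1 : min (a i) (a j) < b i) (h2 : min (a i) (a j) < b j) : CompGT a b := by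
  rw [compGT_iff]
  refine Or.inl ⟨fun h => ?_, ?_, fun k => ?_⟩
  -- Pinching lowers the sum of squares by at least one, so the sorted sequences differ; the summand
  -- at `k = i` records that one.
  · have h3 : ∑ k, ((b k) ^ 2 + if k = i then 1 else 0) ≤ ∑ k, (a k) ^ 2 := by
      have h5 : ∑ k, ((a k) ^ 2 - (b k) ^ 2) = (a i ^ 2 - b i ^ 2) + (a j ^ 2 - b j ^ 2) := by
        refine Fintype.sum_eq_add i j hij ?_
        rintro k ⟨h1, h2⟩
        rw [hb k h1 h2, sub_self]
      rw [Finset.sum_add_distrib, Finset.sum_ite_eq' Finset.univ i, if_pos (Finset.mem_univ _)]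
      rw [Finset.sum_sub_distrib] at h5
      have h6 : 1 ≤ (a i ^ 2 - b i ^ 2) + (a j ^ 2 - b j ^ 2) := by
        have e : a j = b i + b j - a i := by linarith
        rcases le_total (a i) (a j) with h | h
        · rw [min_eq_left h] at h1 h2
          have : 1 ≤ (b i - a i) * (b j - a i) := by nlinarith
          rw [e]; nlinarith
        · rw [min_eq_right h] at h1 h2
          have : 1 ≤ (b i - a j) * (b j - a j) := by nlinarith
          have e : a i = b i + b j - a j := by linarith
          rw [e]; nlinarith
      linarith
    have h4 : ∑ k, (a k) ^ 2 = ∑ k, (b k) ^ 2 := by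
      rw [← sum_sorted a fun x => x ^ 2, h, sum_sorted b fun x => x ^ 2]
    rw [Finset.sum_add_distrib, Finset.sum_ite_eq' Finset.univ i, if_pos (Finset.mem_univ _)] at h3
    linarith
  · rw [sum_sorted a fun x => x, sum_sorted b fun x => x]
    exact le_antisymm
      (sum_le_of_pinch hij (f := fun x => x) (fun k h h' => (hb k h h').symm) hs.ge)
      (sum_le_of_pinch hij (f := fun x => x) hb hs.le)
  -- Majorization by the convex function `max (x - t) 0`, whose sum does not grow under pinching.
  -- For the threshold `t` the partial sum of `sorted a` equals the sum of `t` over `Iic k` plus the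
  -- total excess over `t`; for `sorted b` it is at most that.
  · set t := sorted a k
    have hconv : ∑ i, max (b i - t) 0 ≤ ∑ i, max (a i - t) 0 := by
      refine sum_le_of_pinch hij hb (f := fun x => max (x - t) 0) ?_
      omega
    calc ∑ i ∈ Finset.Iic k, sorted b i
        ≤ ∑ i ∈ Finset.Iic k, (t + max (sorted b i - t) 0) :=
          Finset.sum_le_sum fun i _ => by have := le_max_left (sorted b i - t) 0; linarith
      _ = ∑ i ∈ Finset.Iic k, t + ∑ i ∈ Finset.Iic k, max (sorted b i - t) 0 :=
          Finset.sum_add_distrib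
      _ ≤ ∑ i ∈ Finset.Iic k, t + ∑ i, max (sorted b i - t) 0 := by
          exact add_le_add le_rfl (Finset.sum_le_sum_of_subset_of_nonneg (Finset.subset_univ _)
            fun i _ _ => le_max_right _ _)
      _ ≤ ∑ i ∈ Finset.Iic k, t + ∑ i, max (sorted a i - t) 0 := by
          rw [sum_sorted b fun x => max (x - t) 0, sum_sorted a fun x => max (x - t) 0]
          gcongr
      _ = ∑ i ∈ Finset.Iic k, t + ∑ i ∈ Finset.Iic k, (sorted a i - t) := by
          congr 1
          rw [← Finset.sum_subset (Finset.subset_univ (Finset.Iic k))]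
          · refine Finset.sum_congr rfl fun i hi => max_eq_left ?_
            exact sub_nonneg.2 (sorted_antitone a (Finset.mem_Iic.1 hi))
          · intro i _ hi
            rw [Finset.mem_Iic, not_le] at hi
            exact max_eq_right (sub_nonpos.2 (sorted_antitone a hi.le))
      _ = ∑ i ∈ Finset.Iic k, sorted a i := by
          rw [← Finset.sum_add_distrib]
          exact Finset.sum_congr rfl fun i _ => by ring

end Order

/-! ### Permutations of the variables -/

section Laurent

variable {N : ℕ}

lemma laurent_ext {V : Type} [AddCommGroup V] [Module ℂ V] {f g : Laurent N →ₗ[ℂ] V}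
    (h : ∀ a, f (mono a) = g (mono a)) : f = g :=
  (AddMonoidAlgebra.basis (Fin N → ℤ) ℂ).ext fun a => by
    rw [AddMonoidAlgebra.basis_apply]; exact h a

lemma coeff_mono (a b : Fin N → ℤ) : (mono a).coeff b = if a = b then 1 else 0 := by
  rw [mono, AddMonoidAlgebra.coeff_single, Finsupp.single_apply]

lemma laurent_eq_sum (f : Laurent N) : f = ∑ a ∈ f.coeff.support, f.coeff a • mono a := by
  ext b
  rw [AddMonoidAlgebra.coeff_sum, Finsupp.finsetSum_apply]
  simp only [AddMonoidAlgebra.coeff_smul, Finsupp.smul_apply, coeff_mono, smul_eq_mul, mul_ite,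
    mul_one, mul_zero, Finset.sum_ite_eq']
  split_ifs with h
  · rfl
  · simpa using h

/-- The automorphism of the algebra of Laurent polynomials that sends `z_i` to `z_{σ(i)}`. -/
def varPerm (σ : Equiv.Perm (Fin N)) : Laurent N ≃ₐ[ℂ] Laurent N :=
  AddMonoidAlgebra.domCongr ℂ ℂ (AddEquiv.arrowCongr σ (AddEquiv.refl ℤ))

lemma varPerm_mono (σ : Equiv.Perm (Fin N)) (a : Fin N → ℤ) :
    varPerm σ (mono a) = mono (a ∘ σ.symm) :=
  AddMonoidAlgebra.domCongr_single _ _ _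

lemma coeff_varPerm (σ : Equiv.Perm (Fin N)) (f : Laurent N) (a : Fin N → ℤ) :
    (varPerm σ f).coeff a = f.coeff (a ∘ σ) :=
  AddMonoidAlgebra.coeff_domCongr _ _ _

lemma varPerm_mul (σ τ : Equiv.Perm (Fin N)) (f : Laurent N) :
    varPerm (σ * τ) f = varPerm σ (varPerm τ f) := by
  ext a
  simp only [coeff_varPerm]
  rfl

lemma varPerm_one (f : Laurent N) : varPerm 1 f = f := by
  ext a
  simp only [coeff_varPerm]
  rfl

lemma Kop_eq (i j : Fin N) (f : Laurent N) : Kop i j f = varPerm (Equiv.swap i j) f := by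
  refine LinearMap.congr_fun (g := (varPerm (Equiv.swap i j)).toLinearMap) (laurent_ext fun a => ?_) f
  rw [Kop, ofMono_mono, AlgEquiv.toLinearMap_apply, varPerm_mono, Equiv.symm_swap]

lemma Kop_comm (i j : Fin N) (f : Laurent N) : Kop i j f = Kop j i f := by
  rw [Kop_eq, Kop_eq, Equiv.swap_comm]

lemma Kop_Kop (i j : Fin N) (f : Laurent N) : Kop i j (Kop i j f) = f := by
  rw [Kop_eq, Kop_eq, ← varPerm_mul, Equiv.swap_mul_self, varPerm_one]

lemma varPerm_Kop (σ : Equiv.Perm (Fin N)) (i j : Fin N) (f : Laurent N) :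
    varPerm σ (Kop i j f) = Kop (σ i) (σ j) (varPerm σ f) := by
  rw [Kop_eq, Kop_eq, ← varPerm_mul, ← varPerm_mul]
  congr 1
  rw [Equiv.swap_apply_apply]
  group

lemma varPerm_zvar (σ : Equiv.Perm (Fin N)) (i : Fin N) : varPerm σ (zvar i) = zvar (σ i) := by
  rw [zvar, zvar, varPerm_mono]
  congr 1
  ext k
  simp only [Function.comp_apply, Pi.single_apply, Equiv.symm_apply_eq]

lemma zvar_sub_ne_zero {i j : Fin N} (hij : i ≠ j) : zvar j - zvar i ≠ 0 := by
  intro h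
  have h1 := congrArg (fun f => f.coeff (Pi.single j 1)) (sub_eq_zero.1 h)
  simp only [zvar, coeff_mono, if_true] at h1
  rw [if_neg] at h1
  · exact one_ne_zero h1
  · intro h2
    have := congrFun h2 j
    simp [hij.symm] at this

/-! ### Divided differences -/

/-- The operator `z_j (z_j - z_i)⁻¹ (K_{i,j} - 1)`. -/
def dunklTerm (i j : Fin N) : Laurent N →ₗ[ℂ] Laurent N :=
  LinearMap.mulLeft ℂ (zvar j) ∘ₗ divDiff i j

lemma dunklTerm_self (i : Fin N) (f : Laurent N) : dunklTerm i i f = 0 := by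
  have : divDiff i i = 0 := laurent_ext fun a => by
    rw [divDiff, ofMono_mono]; simp
  rw [dunklTerm, this]; simp

lemma dunklTerm_spec {i j : Fin N} (hij : i ≠ j) (f : Laurent N) :
    (zvar j - zvar i) * dunklTerm i j f = zvar j * (Kop i j f - f) := by
  rw [← divDiff_spec hij f, dunklTerm, LinearMap.comp_apply, LinearMap.mulLeft_apply]
  ring

/-- Laurent polynomials have no zero divisors, so identities for divided differences can be checked
after multiplication by `z_j - z_i`. -/
lemma dunklTerm_unique {i j : Fin N} (hij : i ≠ j) {f g : Laurent N}
    (h : (zvar j - zvar i) * g = zvar j * (Kop i j f - f)) : dunklTerm i j f = g :=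
  mul_left_cancel₀ (zvar_sub_ne_zero hij) ((dunklTerm_spec hij f).trans h.symm)

lemma varPerm_dunklTerm (σ : Equiv.Perm (Fin N)) (i j : Fin N) (f : Laurent N) :
    varPerm σ (dunklTerm i j f) = dunklTerm (σ i) (σ j) (varPerm σ f) := by
  by_cases hij : i = j
  · subst hij
    rw [dunklTerm_self, dunklTerm_self, map_zero]
  · symm
    refine dunklTerm_unique (σ.injective.ne hij) ?_
    rw [← varPerm_zvar, ← varPerm_zvar, ← varPerm_Kop, ← map_sub, ← map_mul, dunklTerm_spec hij]
    simp

/-- Because `z_j / (z_j - z_i) + z_i / (z_i - z_j) = 1`. -/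
lemma dunklTerm_add {i j : Fin N} (hij : i ≠ j) (f : Laurent N) :
    dunklTerm i j f = Kop i j f - f - dunklTerm j i f := by
  refine dunklTerm_unique hij ?_
  have h := dunklTerm_spec hij.symm f
  rw [Kop_comm j i] at h
  linear_combination h

lemma Kop_mul (i j : Fin N) (f g : Laurent N) : Kop i j (f * g) = Kop i j f * Kop i j g := by
  rw [Kop_eq, Kop_eq, Kop_eq, map_mul]

lemma Kop_zvar (i j k : Fin N) : Kop i j (zvar k) = zvar (Equiv.swap i j k) := by
  rw [Kop_eq, varPerm_zvar]

lemma dunklTerm_zvar_right {i j : Fin N} (hij : i ≠ j) (f : Laurent N) :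
    dunklTerm i j (zvar j * f) = zvar j * dunklTerm i j f - zvar j * Kop i j f := by
  refine dunklTerm_unique hij ?_
  have h := dunklTerm_spec hij f
  rw [Kop_mul, Kop_zvar, Equiv.swap_apply_right]
  linear_combination zvar j * h

lemma dunklTerm_zvar_left {i j : Fin N} (hij : i ≠ j) (f : Laurent N) :
    dunklTerm i j (zvar i * f) = zvar i * dunklTerm i j f + zvar j * Kop i j f := by
  refine dunklTerm_unique hij ?_
  have h := dunklTerm_spec hij f
  rw [Kop_mul, Kop_zvar, Equiv.swap_apply_left]
  linear_combination zvar i * h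

lemma dunklTerm_zvar {i j k : Fin N} (hi : k ≠ i) (hj : k ≠ j) (f : Laurent N) :
    dunklTerm i j (zvar k * f) = zvar k * dunklTerm i j f := by
  by_cases hij : i = j
  · subst hij
    rw [dunklTerm_self, dunklTerm_self, mul_zero]
  refine dunklTerm_unique hij ?_
  have h := dunklTerm_spec hij f
  rw [Kop_mul, Kop_zvar, Equiv.swap_apply_of_ne_of_ne hi hj]
  linear_combination zvar k * h

lemma varPerm_eulerOp (σ : Equiv.Perm (Fin N)) (i : Fin N) (f : Laurent N) :
    varPerm σ (eulerOp i f) = eulerOp (σ i) (varPerm σ f) := by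
  refine LinearMap.congr_fun (f := (varPerm σ).toLinearMap ∘ₗ eulerOp i)
    (g := eulerOp (σ i) ∘ₗ (varPerm σ).toLinearMap) (laurent_ext fun a => ?_) f
  simp only [LinearMap.comp_apply, AlgEquiv.toLinearMap_apply, eulerOp, ofMono_mono, map_smul,
    varPerm_mono, Function.comp_apply, Equiv.symm_apply_apply]

lemma eulerOp_zvar (i k : Fin N) (f : Laurent N) : eulerOp i (zvar k * f) =
    zvar k * eulerOp i f + (if i = k then zvar k * f else 0) := by
  have h : eulerOp i ∘ₗ LinearMap.mulLeft ℂ (zvar k) = LinearMap.mulLeft ℂ (zvar k) ∘ₗ eulerOp i +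
      (if i = k then 1 else 0 : ℂ) • LinearMap.mulLeft ℂ (zvar k) := laurent_ext fun a => by
    simp only [LinearMap.comp_apply, LinearMap.add_apply, LinearMap.smul_apply,
      LinearMap.mulLeft_apply, eulerOp, ofMono_mono, zvar, mono_mul, mul_smul_comm, ← add_smul,
      Pi.add_apply, Pi.single_apply]
    congr 1
    split_ifs <;> push_cast <;> ring
  have h' := LinearMap.congr_fun h f
  simp only [LinearMap.comp_apply, LinearMap.add_apply, LinearMap.smul_apply,
    LinearMap.mulLeft_apply] at h'
  rw [h']
  split_ifs <;> simp

/-! ### Dunkl operators -/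

/-- The part of the Dunkl operator that is equivariant under permutations of the variables. -/
def heckman (α : ℝ) (i : Fin N) : Laurent N →ₗ[ℂ] Laurent N :=
  (α : ℂ) • eulerOp i + ∑ j, dunklTerm i j

lemma heckman_apply (α : ℝ) (i : Fin N) (f : Laurent N) :
    heckman α i f = (α : ℂ) • eulerOp i f + ∑ j, dunklTerm i j f := by
  simp [heckman]

lemma varPerm_heckman (α : ℝ) (σ : Equiv.Perm (Fin N)) (i : Fin N) (f : Laurent N) :
    varPerm σ (heckman α i f) = heckman α (σ i) (varPerm σ f) := by
  rw [heckman_apply, heckman_apply, map_add, map_smul, varPerm_eulerOp, map_sum]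
  simp only [varPerm_dunklTerm]
  rw [Equiv.sum_comp σ fun j => dunklTerm (σ i) j (varPerm σ f)]

lemma dunkl_apply (α : ℝ) (i : Fin N) (f : Laurent N) :
    dunkl α i f = (α : ℂ) • eulerOp i f - (((i : ℕ) : ℂ) + 1) • f +
      ∑ j ∈ Finset.Ioi i, dunklTerm i j f - ∑ j ∈ Finset.Iio i, dunklTerm j i f := by
  simp only [dunkl, dunklTerm, LinearMap.add_apply, LinearMap.sub_apply, LinearMap.sum_apply,
    LinearMap.smul_apply, LinearMap.id_apply]

/-- For `j < i`, `dunklTerm_add` trades `-dunklTerm j i` for `dunklTerm i j - K_{i,j} + 1`. The ones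
add up to the index `i` counted from zero and leave `-1` of the constant `-(i + 1)`. -/
lemma dunkl_eq_heckman (α : ℝ) (i : Fin N) (f : Laurent N) :
    dunkl α i f = heckman α i f - f - ∑ j ∈ Finset.Iio i, Kop i j f := by
  have h1 : ∑ j ∈ Finset.Iio i, dunklTerm j i f =
      ∑ j ∈ Finset.Iio i, Kop i j f - ((i : ℕ) : ℂ) • f - ∑ j ∈ Finset.Iio i, dunklTerm i j f := by
    rw [Finset.sum_congr rfl fun j hj => dunklTerm_add (Finset.mem_Iio.1 hj).ne f,
      Finset.sum_sub_distrib, Finset.sum_sub_distrib, Finset.sum_const, Fin.card_Iio,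
      Nat.cast_smul_eq_nsmul]
    simp only [Kop_comm i]
  have h2 : ∑ j, dunklTerm i j f =
      ∑ j ∈ Finset.Iio i, dunklTerm i j f + ∑ j ∈ Finset.Ioi i, dunklTerm i j f := by
    rw [← Finset.sum_union (Finset.disjoint_left.2 fun j h3 h4 =>
      lt_asymm (Finset.mem_Iio.1 h3) (Finset.mem_Ioi.1 h4))]
    symm
    refine Finset.sum_subset (Finset.subset_univ _) fun j _ hj => ?_
    have : j = i := by
      simp only [Finset.mem_union, Finset.mem_Iio, Finset.mem_Ioi, not_or, not_lt] at hj
      exact le_antisymm hj.2 hj.1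
    rw [this, dunklTerm_self]
  rw [dunkl_apply, heckman_apply, h1, h2]
  module

/-- The cross relation of the degenerate affine Hecke algebra. The Heckman part is equivariant; the
tail at `j` has the one extra term `K_{i,j}`, which applied to `K_{i,j} f` gives back `f`. -/
lemma Kop_dunkl (α : ℝ) {i j : Fin N} (hij : Adj i j) (f : Laurent N) :
    Kop i j (dunkl α i f) = dunkl α j (Kop i j f) + f := by
  rw [dunkl_eq_heckman, dunkl_eq_heckman, Kop_eq i j, map_sub, map_sub, map_sum, varPerm_heckman,
    Equiv.swap_apply_left, ← Kop_eq]
  have hI : Finset.Iio j = insert i (Finset.Iio i) := by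
    ext k
    unfold Adj at hij
    simp only [Finset.mem_Iio, Finset.mem_insert, Fin.lt_def, Fin.ext_iff]
    omega
  rw [hI, Finset.sum_insert (by simp), Kop_comm j i, Kop_Kop]
  rw [Finset.sum_congr rfl fun k hk => ?_]
  · abel
  · have hk := Finset.mem_Iio.1 hk
    rw [varPerm_Kop, Equiv.swap_apply_left,
      Equiv.swap_apply_of_ne_of_ne hk.ne (hk.trans hij.lt).ne, ← Kop_eq i j]

lemma Kop_dunkl' (α : ℝ) {i j : Fin N} (hij : Adj i j) (f : Laurent N) :
    Kop i j (dunkl α j f) = dunkl α i (Kop i j f) - f := by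
  have h := Kop_dunkl α hij (Kop i j f)
  rw [Kop_Kop] at h
  rw [← Kop_Kop i j (dunkl α i (Kop i j f)), h, map_add, Kop_Kop]
  abel

lemma Kop_dunkl_of_ne (α : ℝ) {i j k : Fin N} (hij : Adj i j) (hi : k ≠ i) (hj : k ≠ j)
    (f : Laurent N) : Kop i j (dunkl α k f) = dunkl α k (Kop i j f) := by
  rw [dunkl_eq_heckman, dunkl_eq_heckman, Kop_eq i j, map_sub, map_sub, map_sum, varPerm_heckman,
    Equiv.swap_apply_of_ne_of_ne hi hj, ← Kop_eq]
  congr 1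
  refine Finset.sum_equiv (Equiv.swap i j) (fun l => ?_) fun l _ => ?_
  · unfold Adj at hij
    simp only [Finset.mem_Iio, Equiv.swap_apply_def]
    simp only [Fin.lt_def, Fin.ext_iff] at *
    split_ifs <;> omega
  · rw [varPerm_Kop, Equiv.swap_apply_of_ne_of_ne hi hj, ← Kop_eq i j]

end Laurent

/-! ### The shift operator and its commutation with the Dunkl operators. -/

section Shift

variable {M : ℕ}

/-- The operator `f(z_1, …, z_N) ↦ z_N f(z_N, z_1, …, z_{N-1})`. -/
def shiftOp (f : Laurent (M + 1)) : Laurent (M + 1) :=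
  zvar (Fin.last M) * varPerm (finRotate (M + 1)).symm f

lemma finRotate_symm_succ (i : Fin M) : (finRotate (M + 1)).symm i.succ = i.castSucc := by
  rw [Equiv.symm_apply_eq, finRotate_apply, Fin.coeSucc_eq_succ]

lemma finRotate_symm_zero : (finRotate (M + 1)).symm 0 = Fin.last M := by
  rw [Equiv.symm_apply_eq, finRotate_last]

lemma heckman_zvar_of_ne (α : ℝ) {i k : Fin (M + 1)} (hik : i ≠ k) (f : Laurent (M + 1)) :
    heckman α i (zvar k * f) = zvar k * heckman α i f - zvar k * Kop i k f := by
  rw [heckman_apply, heckman_apply, eulerOp_zvar, if_neg hik, add_zero, mul_add, mul_smul_comm,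
    Finset.mul_sum]
  have h : ∑ j, (dunklTerm i j (zvar k * f) - zvar k * dunklTerm i j f) = - (zvar k * Kop i k f) := by
    rw [Finset.sum_eq_single k]
    · rw [dunklTerm_zvar_right hik]; ring
    · intro j _ hj
      rw [dunklTerm_zvar hik.symm hj.symm, sub_self]
    · simp
  rw [Finset.sum_sub_distrib, sub_eq_iff_eq_add] at h
  rw [h]
  abel

lemma heckman_zvar_self (α : ℝ) (i : Fin (M + 1)) (f : Laurent (M + 1)) :
    heckman α i (zvar i * f) = zvar i * heckman α i f + (α : ℂ) • (zvar i * f) +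
      ∑ j ∈ Finset.univ.erase i, zvar j * Kop i j f := by
  rw [heckman_apply, heckman_apply, eulerOp_zvar, if_pos rfl, mul_add, mul_smul_comm,
    Finset.mul_sum, ← Finset.add_sum_erase _ _ (Finset.mem_univ i),
    ← Finset.add_sum_erase _ _ (Finset.mem_univ i), dunklTerm_self, dunklTerm_self,
    Finset.sum_congr rfl fun j hj => dunklTerm_zvar_left (Finset.ne_of_mem_erase hj).symm f,
    Finset.sum_add_distrib, mul_zero, zero_add, zero_add]
  module

/-- The rotation sends the first variable to the last, so one tail term becomes `K_{i,N}`; it is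
exactly the correction produced by moving `z_N` through the Heckman operator. -/
lemma dunkl_shiftOp_castSucc (α : ℝ) (i : Fin M) (f : Laurent (M + 1)) :
    dunkl α i.castSucc (shiftOp f) = shiftOp (dunkl α i.succ f) := by
  set c := (finRotate (M + 1)).symm with hc
  have hne : i.castSucc ≠ Fin.last M := i.castSucc_lt_last.ne
  have h1 : varPerm c (dunkl α i.succ f) = heckman α i.castSucc (varPerm c f) - varPerm c f -
      ∑ j ∈ Finset.Iio i.succ, Kop i.castSucc (c j) (varPerm c f) := by
    rw [dunkl_eq_heckman, map_sub, map_sub, map_sum, varPerm_heckman]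
    simp only [varPerm_Kop, hc, finRotate_symm_succ]
  have h2 : ∑ j ∈ Finset.Iio i.succ, Kop i.castSucc (c j) (varPerm c f) =
      Kop i.castSucc (Fin.last M) (varPerm c f) +
        ∑ j ∈ Finset.Iio i.castSucc, Kop i.castSucc j (varPerm c f) := by
    have e1 : Finset.Iio i.succ = Finset.univ.filter (· < i.succ) := by ext; simp
    have e2 : Finset.Iio i.castSucc = Finset.univ.filter (· < i.castSucc) := by ext; simp
    rw [e1, e2, Finset.sum_filter, Finset.sum_filter, Fin.sum_univ_succ, Fin.sum_univ_castSucc]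
    simp only [hc, finRotate_symm_succ, finRotate_symm_zero, Fin.succ_lt_succ_iff,
      Fin.castSucc_lt_castSucc_iff, Fin.succ_pos, if_true, not_lt.2 (Fin.le_last _), if_false,
      add_zero]
  rw [shiftOp, shiftOp, h1, h2, dunkl_eq_heckman, heckman_zvar_of_ne α hne]
  have h3 : ∀ j ∈ Finset.Iio i.castSucc,
      Kop i.castSucc j (zvar (Fin.last M) * varPerm c f) =
        zvar (Fin.last M) * Kop i.castSucc j (varPerm c f) := by
    intro j hj
    have hj' := (Finset.mem_Iio.1 hj).trans i.castSucc_lt_last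
    rw [Kop_mul, Kop_zvar, Equiv.swap_apply_of_ne_of_ne hne.symm hj'.ne']
  rw [Finset.sum_congr rfl h3, ← Finset.mul_sum]
  ring

/-- The first Dunkl operator has no tail. Moving `z_N` through the last Heckman operator creates the
terms `z_j K_{N,j}`, which cancel the whole tail, together with the summand `α`. -/
lemma dunkl_shiftOp_last (α : ℝ) (f : Laurent (M + 1)) :
    dunkl α (Fin.last M) (shiftOp f) = shiftOp (dunkl α 0 f) + (α : ℂ) • shiftOp f := by
  set c := (finRotate (M + 1)).symm with hc
  have h1 : varPerm c (dunkl α 0 f) = heckman α (Fin.last M) (varPerm c f) - varPerm c f := by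
    rw [dunkl_eq_heckman, map_sub, map_sub, map_sum, varPerm_heckman, hc, finRotate_symm_zero]
    have : Finset.Iio (0 : Fin (M + 1)) = ∅ := by ext; simp
    rw [this, Finset.sum_empty, sub_zero]
  rw [shiftOp, shiftOp, h1, dunkl_eq_heckman, heckman_zvar_self]
  have h2 : Finset.univ.erase (Fin.last M) = Finset.Iio (Fin.last M) := by
    ext j
    rw [Finset.mem_erase, Finset.mem_Iio, Fin.lt_last_iff_ne_last]
    simp only [Finset.mem_univ, and_true]
  rw [h2]
  have h3 : ∀ j ∈ Finset.Iio (Fin.last M), Kop (Fin.last M) j (zvar (Fin.last M) * varPerm c f) =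
      zvar j * Kop (Fin.last M) j (varPerm c f) := by
    intro j _
    rw [Kop_mul, Kop_zvar, Equiv.swap_apply_left]
  rw [Finset.sum_congr rfl h3]
  ring

end Shift

/-! ### Triangularity of the Dunkl operators -/

section Triangular

variable {N : ℕ}

/-- The Laurent polynomials all of whose monomials are smaller than `z^a`. -/
def lowerSpace (a : Fin N → ℤ) : Submodule ℂ (Laurent N) where
  carrier := {f | ∀ b, ¬ CompGT a b → f.coeff b = 0}
  add_mem' := by
    intro f g hf hg b hb
    rw [AddMonoidAlgebra.coeff_add, Finsupp.add_apply, hf b hb, hg b hb, add_zero]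
  zero_mem' := fun _ _ => rfl
  smul_mem' := by
    intro c f hf b hb
    rw [AddMonoidAlgebra.coeff_smul_apply, hf b hb, smul_zero]

lemma mono_mem_lowerSpace {a b : Fin N → ℤ} (h : CompGT a b) : mono b ∈ lowerSpace a := by
  intro c hc
  rw [coeff_mono, if_neg]
  rintro rfl
  exact hc h

lemma zvar_mul_mono_update {i j : Fin N} (a : Fin N → ℤ) (p q : ℤ) :
    zvar j * mono (Function.update (Function.update a i p) j q) =
      mono (Function.update (Function.update a i p) j (q + 1)) := by
  rw [zvar, mono_mul]
  congr 1
  ext k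
  by_cases h : k = j
  · subst h; simp [add_comm]
  · simp [h]

lemma dunklTerm_mono (i j : Fin N) (a : Fin N → ℤ) : dunklTerm i j (mono a) =
    (∑ k ∈ Finset.range (a i - a j).toNat,
      mono (Function.update (Function.update a i (a i - 1 - k)) j (a j + k + 1))) -
    ∑ k ∈ Finset.range (a j - a i).toNat,
      mono (Function.update (Function.update a i (a j - 1 - k)) j (a i + k + 1)) := by
  rw [dunklTerm, LinearMap.comp_apply, LinearMap.mulLeft_apply, divDiff, ofMono_mono, mul_sub,
    Finset.mul_sum, Finset.mul_sum]
  simp only [zvar_mul_mono_update]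

lemma comp_swap_eq_update (a : Fin N → ℤ) (i j : Fin N) :
    a ∘ Equiv.swap i j = Function.update (Function.update a i (a j)) j (a i) := by
  ext t
  by_cases h : t = j
  · subst h; simp
  · by_cases h' : t = i
    · subst h'; simp [h]
    · simp [h, h', Equiv.swap_apply_of_ne_of_ne h' h]

lemma compGT_update {i j : Fin N} (hij : i ≠ j) {a : Fin N → ℤ} {p q : ℤ} (hs : p + q = a i + a j)
    (hp : min (a i) (a j) < p) (hq : min (a i) (a j) < q) :
    CompGT a (Function.update (Function.update a i p) j q) := by
  refine compGT_pinch hij (fun k h1 h2 => ?_) ?_ ?_ ?_ <;> simp [*]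

/-- The exponents run over points of the segment between `a` and its exchange. Interior ones are
pinched, hence smaller. The only end point that occurs is the exchange, smaller than `a`, if `a j <
a i`, and `a` itself with coefficient `-1` if `a i < a j`. -/
lemma dunklTerm_mono_mem {i j : Fin N} (hij : i < j) (a : Fin N → ℤ) :
    dunklTerm i j (mono a) + (if a i < a j then 1 else 0 : ℂ) • mono a ∈ lowerSpace a := by
  rw [dunklTerm_mono]
  rcases le_or_gt (a j) (a i) with h | h
  · have e : (a j - a i).toNat = 0 := by omega
    rw [e, Finset.range_zero, Finset.sum_empty, sub_zero, if_neg (not_lt.2 h), zero_smul, add_zero]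
    refine Submodule.sum_mem _ fun k hk => mono_mem_lowerSpace ?_
    have hk' : (k : ℤ) < a i - a j := by rw [Finset.mem_range] at hk; omega
    by_cases hlast : (k : ℤ) + 1 = a i - a j
    · have e1 : a i - 1 - k = a j := by omega
      have e2 : a j + k + 1 = a i := by omega
      rw [e1, e2, ← comp_swap_eq_update]
      exact compGT_swap hij (by omega)
    · exact compGT_update hij.ne (by ring) (by omega) (by omega)
  · have e : (a i - a j).toNat = 0 := by omega
    obtain ⟨n, hn⟩ : ∃ n : ℕ, (a j - a i).toNat = n + 1 := ⟨(a j - a i).toNat - 1, by omega⟩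
    have e1 : a j - 1 - n = a i := by omega
    have e2 : a i + n + 1 = a j := by omega
    rw [e, hn, Finset.range_zero, Finset.sum_empty, zero_sub, Finset.sum_range_succ, if_pos h,
      one_smul, e1, e2, Function.update_eq_self, Function.update_eq_self, neg_add,
      neg_add_cancel_right]
    refine Submodule.neg_mem _ (Submodule.sum_mem _ fun k hk => mono_mem_lowerSpace ?_)
    have hk' : (k : ℤ) + 1 < a j - a i := by rw [Finset.mem_range] at hk; omega
    exact compGT_update hij.ne (by ring) (by omega) (by omega)

lemma entryRank_add (a : Fin N → ℤ) (i : Fin N) :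
    entryRank a i + (Finset.univ.filter fun j : Fin N => j < i ∧ a j < a i).card =
      i + 1 + (Finset.univ.filter fun j : Fin N => i < j ∧ a i < a j).card := by
  have h : (Finset.univ.filter fun j : Fin N => j ≤ i ∧ a i ≤ a j).card +
      (Finset.univ.filter fun j : Fin N => j < i ∧ a j < a i).card = i + 1 := by
    rw [← Finset.card_union_of_disjoint, ← Fin.card_Iic]
    · congr 1
      ext j
      simp only [Finset.mem_union, Finset.mem_filter, Finset.mem_univ, true_and, Finset.mem_Iic]
      constructor
      · rintro (h | h)
        · exact h.1
        · exact h.1.le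
      · intro h
        rcases le_or_gt (a i) (a j) with h1 | h1
        · exact Or.inl ⟨h, h1⟩
        · exact Or.inr ⟨lt_of_le_of_ne h (by rintro rfl; exact lt_irrefl _ h1), h1⟩
    · rw [Finset.disjoint_left]
      intro j h1 h2
      simp only [Finset.mem_filter] at h1 h2
      exact absurd h2.2.2 (not_lt.2 h1.2.2)
  rw [entryRank_eq, ← h]
  ring

/-- Each later larger entry contributes `-1` to the diagonal and each earlier smaller entry `+1`; by
`entryRank_add` these corrections turn the position `i + 1` into the rank. -/
theorem dunkl_mono_mem (α : ℝ) (i : Fin N) (a : Fin N → ℤ) :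
    dunkl α i (mono a) - spec α a i • mono a ∈ lowerSpace a := by
  have h1 : ∑ j ∈ Finset.Ioi i, (dunklTerm i j (mono a) + (if a i < a j then 1 else 0 : ℂ) • mono a)
      ∈ lowerSpace a :=
    Submodule.sum_mem _ fun j hj => dunklTerm_mono_mem (Finset.mem_Ioi.1 hj) a
  have h2 : ∑ j ∈ Finset.Iio i, (dunklTerm j i (mono a) + (if a j < a i then 1 else 0 : ℂ) • mono a)
      ∈ lowerSpace a :=
    Submodule.sum_mem _ fun j hj => dunklTerm_mono_mem (Finset.mem_Iio.1 hj) a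
  have hc1 : ∑ j ∈ Finset.Ioi i, (if a i < a j then 1 else 0 : ℂ) =
      ((Finset.univ.filter fun j : Fin N => i < j ∧ a i < a j).card : ℂ) := by
    rw [Finset.sum_boole]
    congr 2
    ext j; simp
  have hc2 : ∑ j ∈ Finset.Iio i, (if a j < a i then 1 else 0 : ℂ) =
      ((Finset.univ.filter fun j : Fin N => j < i ∧ a j < a i).card : ℂ) := by
    rw [Finset.sum_boole]
    congr 2
    ext j; simp
  have hr : (entryRank a i : ℂ) +
      ((Finset.univ.filter fun j : Fin N => j < i ∧ a j < a i).card : ℂ) =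
      ((i : ℕ) : ℂ) + 1 + ((Finset.univ.filter fun j : Fin N => i < j ∧ a i < a j).card : ℂ) := by
    exact_mod_cast entryRank_add a i
  rw [Finset.sum_add_distrib, ← Finset.sum_smul, hc1] at h1
  rw [Finset.sum_add_distrib, ← Finset.sum_smul, hc2] at h2
  have h3 := Submodule.sub_mem _ h1 h2
  rw [dunkl_apply, eulerOp, ofMono_mono, spec]
  convert h3 using 1
  linear_combination (norm := module) hr • mono a

/-! ### Joint eigenvectors -/

/-- `f` is a joint eigenvector (or zero) of the Dunkl operators with eigenvalues `x`. -/
def IsEig (α : ℝ) (x : Fin N → ℂ) (f : Laurent N) : Prop := ∀ i, dunkl α i f = x i • f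

variable {α : ℝ}

lemma IsEig.smul {x : Fin N → ℂ} {f : Laurent N} (hf : IsEig α x f) (c : ℂ) :
    IsEig α x (c • f) := fun i => by rw [map_smul, hf i, smul_comm]

lemma IsEig.sub {x : Fin N → ℂ} {f g : Laurent N} (hf : IsEig α x f) (hg : IsEig α x g) :
    IsEig α x (f - g) := fun i => by rw [map_sub, hf i, hg i, smul_sub]

/-- By triangularity, no other monomial of `f` can contribute to a maximal exponent. -/
lemma coeff_dunkl_of_maximal (α : ℝ) {f : Laurent N} {a : Fin N → ℤ}
    (ha : ∀ b, f.coeff b ≠ 0 → ¬ CompGT b a) (i : Fin N) :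
    (dunkl α i f).coeff a = spec α a i * f.coeff a := by
  have h : ∀ b, f.coeff b ≠ 0 → (dunkl α i (mono b)).coeff a = if b = a then spec α a i else 0 := by
    intro b hb
    have h1 := dunkl_mono_mem α i b a (ha b hb)
    rw [AddMonoidAlgebra.coeff_sub, Finsupp.sub_apply, AddMonoidAlgebra.coeff_smul_apply,
      coeff_mono, sub_eq_zero] at h1
    rw [h1]
    split_ifs with hba
    · subst hba; simp
    · simp
  conv_lhs => rw [laurent_eq_sum f, map_sum, AddMonoidAlgebra.coeff_sum, Finsupp.finsetSum_apply]
  rw [Finset.sum_congr rfl fun b hb => by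
    rw [map_smul, AddMonoidAlgebra.coeff_smul_apply, h b (Finsupp.mem_support_iff.1 hb)]]
  simp only [smul_eq_mul, mul_ite, mul_zero, Finset.sum_ite_eq', Finsupp.mem_support_iff]
  split_ifs with h0
  · ring
  · rw [not_not.1 h0, mul_zero]

instance : IsStrictOrder (Fin N → ℤ) CompGT where
  irrefl := CompGT.irrefl
  trans _ _ _ := CompGT.trans

/-- The leading monomial of a joint eigenvector is determined by its spectrum. -/
theorem IsEig.leading (hα : 0 < α) {x : Fin N → ℂ} {f : Laurent N} (hf : IsEig α x f)
    (h0 : f ≠ 0) : ∃ a, x = spec α a ∧ f.coeff a ≠ 0 ∧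
      ∀ b, f.coeff b ≠ 0 → b = a ∨ CompGT a b := by
  -- Going upwards from any monomial of `f` ends at a maximal one, whose spectrum must be `x`. Since
  -- a spectrum determines its composition, the end point is always the same.
  have key : ∀ b ∈ (f.coeff.support : Set (Fin N → ℤ)),
      ∃ a, x = spec α a ∧ f.coeff a ≠ 0 ∧ (b = a ∨ CompGT a b) := by
    intro b hb
    refine (Finset.wellFoundedOn (r := CompGT) f.coeff.support).induction hb
      (P := fun b => ∃ a, x = spec α a ∧ f.coeff a ≠ 0 ∧ (b = a ∨ CompGT a b)) ?_
    intro c hc ih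
    by_cases hmax : ∀ b, f.coeff b ≠ 0 → ¬ CompGT b c
    · have hc' : f.coeff c ≠ 0 := by simpa using hc
      refine ⟨c, ?_, hc', Or.inl rfl⟩
      ext i
      have h1 := coeff_dunkl_of_maximal α hmax i
      rw [hf i, AddMonoidAlgebra.coeff_smul_apply, smul_eq_mul] at h1
      exact mul_right_cancel₀ hc' h1
    · push Not at hmax
      obtain ⟨b, hb, hbc⟩ := hmax
      obtain ⟨a, h1, h2, h3⟩ := ih b (by simpa using hb) hbc
      refine ⟨a, h1, h2, Or.inr ?_⟩
      rcases h3 with rfl | h3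
      · exact hbc
      · exact h3.trans hbc
  obtain ⟨b, hb⟩ : ∃ b, f.coeff b ≠ 0 := by
    by_contra! h
    exact h0 (AddMonoidAlgebra.ext (Finsupp.ext h))
  obtain ⟨a, h1, h2, -⟩ := key b (by simpa using hb)
  refine ⟨a, h1, h2, fun c hc => ?_⟩
  obtain ⟨a', h1', -, h3⟩ := key c (by simpa using hc)
  rwa [spec_injective hα (h1'.symm.trans h1)] at h3

lemma IsEig.eq_zero (hα : 0 < α) {a : Fin N → ℤ} {f : Laurent N} (hf : IsEig α (spec α a) f)
    (h : f.coeff a = 0) : f = 0 := by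
  by_contra h0
  obtain ⟨b, h1, h2, -⟩ := hf.leading hα h0
  exact h2 (spec_injective hα h1 ▸ h)

/-- The intertwiner of the Dunkl operators. -/
lemma IsEig.swap {x : Fin N → ℂ} {f : Laurent N} (hf : IsEig α x f) {i j : Fin N} (hij : Adj i j)
    {c : ℂ} (hc : c * (x j - x i) = 1) :
    IsEig α (x ∘ Equiv.swap i j) (Kop i j f + c • f) := by
  intro k
  rw [map_add, map_smul, hf k, Function.comp_apply]
  by_cases hi : k = i
  · subst hi
    have h := Kop_dunkl' α hij f
    rw [hf j, map_smul] at h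
    rw [Equiv.swap_apply_left, eq_add_of_sub_eq h.symm]
    linear_combination (norm := module) (-hc) • f
  by_cases hj : k = j
  · subst hj
    have h := Kop_dunkl α hij f
    rw [hf i, map_smul] at h
    rw [Equiv.swap_apply_right, eq_sub_of_add_eq h.symm]
    linear_combination (norm := module) hc • f
  · have h := Kop_dunkl_of_ne α hij hi hj f
    rw [hf k, map_smul] at h
    rw [Equiv.swap_apply_of_ne_of_ne hi hj, ← h]
    module

lemma spec_comp_swap {a : Fin N → ℤ} {i j : Fin N} (hij : Adj i j) (h : a i ≠ a j) :
    spec α (a ∘ Equiv.swap i j) = spec α a ∘ Equiv.swap i j := by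
  have hσ := sortPerm_mem a
  have ha := sorted_comp_sortPerm a
  have h1 : sortPerm a * Equiv.swap i j ∈ sortSet (sorted a) := by
    refine mul_swap_mem_sortSet (sorted_antitone a) hσ hij ?_
    rwa [← Function.comp_apply (f := sorted a), ← Function.comp_apply (f := sorted a), ha]
  have h2 := xi_eq_spec (α := α) h1
  rw [xi_mul, xi_eq_spec hσ, ha] at h2
  rw [h2]
  congr 1
  conv_lhs => rw [← ha]
  rfl

lemma one_lt_spec_sub (hα : 0 < α) {a : Fin N → ℤ} {i j : Fin N} (h : a j < a i) :
    ∃ t : ℝ, 1 < t ∧ spec α a i - spec α a j = t := by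
  have h1 : (entryRank a i : ℝ) + 1 ≤ entryRank a j := by
    exact_mod_cast entryRank_lt (Or.inl h)
  have h2 : (a j : ℝ) + 1 ≤ a i := by exact_mod_cast h
  refine ⟨α * a i - entryRank a i - (α * a j - entryRank a j), by nlinarith, ?_⟩
  simp only [spec]
  push_cast
  ring

/-- The larger entry has both the larger `α a` and the smaller rank, so the gap exceeds one in
absolute value. Thus the intertwiner `K + c`, with `c` the inverse gap, is defined and invertible:
`(K + c) (K - c) = 1 - c ^ 2`. -/
lemma spec_sub_ne (hα : 0 < α) {a : Fin N → ℤ} {i j : Fin N} (h : a i ≠ a j) :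
    spec α a j - spec α a i ≠ 0 ∧ (spec α a j - spec α a i) ^ 2 ≠ 1 := by
  rcases lt_or_gt_of_ne h with h | h
  · obtain ⟨t, h1, h2⟩ := one_lt_spec_sub hα h
    rw [h2]
    exact ⟨by exact_mod_cast (by linarith : t ≠ 0), by exact_mod_cast (by nlinarith : t ^ 2 ≠ 1)⟩
  · obtain ⟨t, h1, h2⟩ := one_lt_spec_sub hα h
    rw [← neg_sub, h2, neg_sq]
    exact ⟨by exact_mod_cast (by linarith : -t ≠ 0), by exact_mod_cast (by nlinarith : t ^ 2 ≠ 1)⟩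

end Triangular

/-! ### Existence of joint eigenvectors -/

section Existence

/-- There is a joint eigenvector with the spectrum belonging to `a`. -/
def HasEig {N : ℕ} (α : ℝ) (a : Fin N → ℤ) : Prop := ∃ f ≠ 0, IsEig α (spec α a) f

variable {N : ℕ} {α : ℝ}

lemma hasEig_zero : HasEig α (0 : Fin N → ℤ) := by
  refine ⟨mono 0, ?_, fun i => ?_⟩
  · intro h
    have := congrArg (fun f => f.coeff 0) h
    simp [coeff_mono] at this
  · have h : ∀ p q : Fin N, dunklTerm p q (mono 0) = 0 := by
      intro p q
      rw [dunklTerm_mono]; simp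
    have hr : entryRank (0 : Fin N → ℤ) i = i + 1 := by
      have := entryRank_add (0 : Fin N → ℤ) i
      simpa using this
    rw [dunkl_apply]
    simp only [h, Finset.sum_const_zero, eulerOp, ofMono_mono, spec, hr]
    simp only [Pi.zero_apply, Int.cast_zero]
    push_cast
    module

lemma HasEig.swap (hα : 0 < α) {a : Fin N → ℤ} (h : HasEig α a) {i j : Fin N} (hij : Adj i j) :
    HasEig α (a ∘ Equiv.swap i j) := by
  by_cases ha : a i = a j
  · have : a ∘ Equiv.swap i j = a := by
      ext k
      rw [Function.comp_apply, Equiv.swap_apply_def]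
      split_ifs <;> simp_all
    rwa [this]
  · obtain ⟨f, hf, he⟩ := h
    obtain ⟨h1, h2⟩ := spec_sub_ne hα ha
    set d := spec α a j - spec α a i with hd
    refine ⟨Kop i j f + d⁻¹ • f, fun h0 => ?_, ?_⟩
    · have h3 : Kop i j f = -d⁻¹ • f := by rw [neg_smul]; exact eq_neg_of_add_eq_zero_left h0
      have h4 := Kop_Kop i j f
      rw [h3, map_smul, h3, smul_smul] at h4
      -- If the intertwiner killed `f`, then `K² = 1` would force `d² = 1`.
      have h5 : (-d⁻¹ * -d⁻¹ - 1) • f = 0 := by rw [sub_smul, h4, one_smul, sub_self]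
      rcases smul_eq_zero.1 h5 with h6 | h6
      · apply h2
        field_simp at h6
        linear_combination -h6
      · exact hf h6
    · rw [spec_comp_swap hij ha]
      exact he.swap hij (inv_mul_cancel₀ h1)

lemma HasEig.perm (hα : 0 < α) {a : Fin N → ℤ} (h : HasEig α a) (σ : Equiv.Perm (Fin N)) :
    HasEig α (a ∘ σ) := by
  induction hh : permHeight σ using Nat.strong_induction_on generalizing σ with
  | _ t ih =>
  subst hh
  by_cases h1 : σ = 1
  · subst h1; exact h
  · obtain ⟨i, j, hij, hlt⟩ := exists_descent h1
    have h2 := (ih _ (permHeight_lt hij hlt) _ rfl).swap hα hij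
    have e : (a ∘ (σ * Equiv.swap i j)) ∘ Equiv.swap i j = a ∘ σ := by
      ext k; simp
    rwa [e] at h2

lemma hasEig_perm_iff (hα : 0 < α) {a : Fin N → ℤ} (σ : Equiv.Perm (Fin N)) :
    HasEig α (a ∘ σ) ↔ HasEig α a := by
  refine ⟨fun h => ?_, fun h => h.perm hα σ⟩
  have := h.perm hα σ⁻¹
  have e : (a ∘ σ) ∘ (σ⁻¹ : Equiv.Perm (Fin N)) = a := by
    ext k; simp [Equiv.Perm.inv_def]
  rwa [e] at this

variable {M : ℕ}

/-- The composition `(a_2, …, a_N, a_1 + 1)`. -/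
def shiftComp (a : Fin (M + 1) → ℤ) : Fin (M + 1) → ℤ :=
  Fin.snoc (fun i : Fin M => a i.succ) (a 0 + 1)

/-- Ranks survive the rotation: the first entry precedes those equal to it, and after it has moved
to the end the added one makes it strictly larger than them. -/
lemma spec_shiftComp_castSucc (a : Fin (M + 1) → ℤ) (i : Fin M) :
    spec α (shiftComp a) i.castSucc = spec α a i.succ := by
  have h : entryRank (shiftComp a) i.castSucc = entryRank a i.succ := by
    rw [entryRank, entryRank, Finset.card_filter, Finset.card_filter, Fin.sum_univ_castSucc,
      Fin.sum_univ_succ, add_comm]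
    have hl : ¬ Fin.last M ≤ i.castSucc := not_le.2 i.castSucc_lt_last
    simp only [shiftComp, Fin.snoc_castSucc, Fin.snoc_last, hl, Fin.zero_le, and_true, and_false,
      or_false, Fin.castSucc_le_castSucc_iff, Fin.succ_le_succ_iff]
    congr 2
    rw [Int.lt_add_one_iff, le_iff_lt_or_eq]
  rw [spec, spec, h]
  simp [shiftComp]

lemma spec_shiftComp_last (a : Fin (M + 1) → ℤ) :
    spec α (shiftComp a) (Fin.last M) = spec α a 0 + α := by
  have h : entryRank (shiftComp a) (Fin.last M) = entryRank a 0 := by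
    rw [entryRank, entryRank, Finset.card_filter, Finset.card_filter, Fin.sum_univ_castSucc,
      Fin.sum_univ_succ, add_comm]
    simp only [shiftComp, Fin.snoc_castSucc, Fin.snoc_last, Fin.le_last, and_true, or_true,
      le_refl, Fin.le_zero_iff, Fin.succ_ne_zero, and_false, or_false, if_true]
    congr 1
    refine Finset.sum_congr rfl fun k _ => ?_
    congr 1
    rw [← le_iff_lt_or_eq, Int.add_one_le_iff]
  rw [spec, spec, h]
  simp only [shiftComp, Fin.snoc_last]
  push_cast
  ring

lemma shiftOp_smul (c : ℂ) (f : Laurent (M + 1)) : shiftOp (c • f) = c • shiftOp f := by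
  rw [shiftOp, shiftOp, map_smul, mul_smul_comm]

lemma shiftOp_zero : shiftOp (0 : Laurent (M + 1)) = 0 := by
  rw [shiftOp, map_zero, mul_zero]

lemma zvar_mul_inv {N : ℕ} (i : Fin N) (f : Laurent N) :
    zvar i * (mono (-Pi.single i 1) * f) = f := by
  rw [← mul_assoc, zvar, mono_mul, add_neg_cancel]
  exact one_mul f

lemma shiftOp_injective : Function.Injective (shiftOp (M := M)) := by
  intro f g h
  have hz : zvar (Fin.last M) ≠ 0 := by
    intro h0
    have := zvar_mul_inv (Fin.last M) 1
    rw [h0, zero_mul] at this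
    exact zero_ne_one this
  exact (varPerm _).injective (mul_left_cancel₀ hz h)

lemma shiftOp_surjective : Function.Surjective (shiftOp (M := M)) := by
  intro f
  obtain ⟨g, hg⟩ := (varPerm (finRotate (M + 1)).symm).surjective
    (mono (-Pi.single (Fin.last M) 1) * f)
  exact ⟨g, by rw [shiftOp, hg, zvar_mul_inv]⟩

lemma isEig_shiftOp_iff {a : Fin (M + 1) → ℤ} {f : Laurent (M + 1)} :
    IsEig α (spec α (shiftComp a)) (shiftOp f) ↔ IsEig α (spec α a) f := by
  have h1 : ∀ i : Fin M, dunkl α i.castSucc (shiftOp f) =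
      spec α (shiftComp a) i.castSucc • shiftOp f ↔ dunkl α i.succ f = spec α a i.succ • f := by
    intro i
    rw [dunkl_shiftOp_castSucc, spec_shiftComp_castSucc, ← shiftOp_smul]
    exact shiftOp_injective.eq_iff
  have h2 : dunkl α (Fin.last M) (shiftOp f) =
      spec α (shiftComp a) (Fin.last M) • shiftOp f ↔ dunkl α 0 f = spec α a 0 • f := by
    rw [dunkl_shiftOp_last, spec_shiftComp_last, add_smul, add_left_inj, ← shiftOp_smul]
    exact shiftOp_injective.eq_iff
  rw [IsEig, IsEig, Fin.forall_fin_succ', Fin.forall_fin_succ, and_comm, h2, forall_congr' h1]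

lemma hasEig_shiftComp_iff {a : Fin (M + 1) → ℤ} : HasEig α (shiftComp a) ↔ HasEig α a := by
  constructor
  · rintro ⟨f, hf, he⟩
    obtain ⟨g, rfl⟩ := shiftOp_surjective f
    exact ⟨g, fun h => hf (by rw [h, shiftOp_zero]), isEig_shiftOp_iff.1 he⟩
  · rintro ⟨f, hf, he⟩
    exact ⟨shiftOp f, fun h => hf (shiftOp_injective (h.trans shiftOp_zero.symm)),
      isEig_shiftOp_iff.2 he⟩

/-- Bringing the `k`-th entry to the front and rotating raises that entry by one, up to a
permutation. -/
lemma shiftComp_eq (a : Fin (M + 1) → ℤ) (k : Fin (M + 1)) :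
    shiftComp (a ∘ Equiv.swap 0 k) =
      (a + Pi.single k 1) ∘ (Equiv.swap 0 k * finRotate (M + 1) : Equiv.Perm (Fin (M + 1))) := by
  ext i
  refine Fin.lastCases ?_ (fun i => ?_) i
  · rw [Function.comp_apply, Equiv.Perm.mul_apply, finRotate_last]
    simp [shiftComp]
  · rw [Function.comp_apply, Equiv.Perm.mul_apply, finRotate_apply, Fin.coeSucc_eq_succ]
    have h : Equiv.swap 0 k i.succ ≠ k := by
      intro h
      rw [Equiv.swap_apply_eq_iff, Equiv.swap_apply_right] at h
      exact Fin.succ_ne_zero i h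
    simp [shiftComp, h]

lemma hasEig_add_single_iff (hα : 0 < α) (a : Fin (M + 1) → ℤ) (k : Fin (M + 1)) :
    HasEig α (a + Pi.single k 1) ↔ HasEig α a := by
  rw [← hasEig_perm_iff hα (Equiv.swap 0 k * finRotate (M + 1)), ← shiftComp_eq,
    hasEig_shiftComp_iff, hasEig_perm_iff hα]

theorem hasEig (hα : 0 < α) (a : Fin N → ℤ) : HasEig α a := by
  cases N with
  | zero => rw [Subsingleton.elim a 0]; exact hasEig_zero
  | succ M =>
    -- The translations that preserve existence in both directions form a subgroup; it contains the
    -- unit vectors, hence everything, and existence is known at zero.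
    let S : AddSubgroup (Fin (M + 1) → ℤ) :=
      { carrier := {b | ∀ a, HasEig α (a + b) ↔ HasEig α a}
        add_mem' := fun {b c} hb hc a => by rw [← add_assoc, hc, hb]
        zero_mem' := fun a => by rw [add_zero]
        neg_mem' := fun {b} hb a => by rw [← hb, neg_add_cancel_right] }
    have h : a ∈ S := by
      rw [← Finset.univ_sum_single a]
      refine sum_mem fun k _ => ?_
      have h1 : (Pi.single k (a k) : Fin (M + 1) → ℤ) = a k • Pi.single k 1 := by
        rw [← Pi.single_smul]; simp
      rw [h1]
      exact zsmul_mem (show (Pi.single k 1 : Fin (M + 1) → ℤ) ∈ S from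
        fun b => hasEig_add_single_iff hα b k) _
    have h2 := (h 0).2 hasEig_zero
    rwa [zero_add] at h2

end Existence

/-! ### Non-symmetric Jack polynomials -/

section Jack

variable {N : ℕ} {α : ℝ} {m : Fin N → ℤ} {σ : Equiv.Perm (Fin N)}

/-- The prescribed form of the lower terms is automatic: `IsEig.leading` gives it for every joint
eigenvector with this spectrum. -/
lemma isNonsymJack_iff (hα : 0 < α) (hσ : σ ∈ sortSet m) {Φ : Laurent N} :
    IsNonsymJack α m σ Φ ↔ IsEig α (spec α (m ∘ σ)) Φ ∧ Φ.coeff (m ∘ σ) = 1 := by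
  rw [← xi_eq_spec hσ]
  refine ⟨fun h => ⟨h.1, h.2.1⟩, fun h => ⟨h.1, h.2, fun a ha => ?_⟩⟩
  have h0 : Φ ≠ 0 := by
    rintro rfl
    exact ha rfl
  have h1 := h.1
  rw [xi_eq_spec hσ] at h1
  obtain ⟨b, h2, -, h3⟩ := h1.leading hα h0
  rw [← spec_injective hα h2] at h3
  refine (h3 a ha).imp_right fun h4 => ⟨sorted a, sortPerm a, sorted_antitone a, sortPerm_mem a, ?_,
    (sorted_comp_sortPerm a).symm⟩
  rwa [CompGT, sorted_comp hσ, sortPerm_comp hσ] at h4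

theorem existsUnique_isNonsymJack (hα : 0 < α) (hσ : σ ∈ sortSet m) :
    ∃! Φ, IsNonsymJack α m σ Φ := by
  simp only [isNonsymJack_iff hα hσ]
  obtain ⟨f, hf, he⟩ := hasEig hα (m ∘ σ)
  have hc : f.coeff (m ∘ σ) ≠ 0 := fun h => hf (he.eq_zero hα h)
  refine ⟨(f.coeff (m ∘ σ))⁻¹ • f, ⟨he.smul _, ?_⟩, ?_⟩
  · rw [AddMonoidAlgebra.coeff_smul_apply, smul_eq_mul, inv_mul_cancel₀ hc]
  · rintro g ⟨h1, h2⟩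
    refine sub_eq_zero.1 ((h1.sub (he.smul _)).eq_zero hα ?_)
    rw [AddMonoidAlgebra.coeff_sub, Finsupp.sub_apply, h2, AddMonoidAlgebra.coeff_smul_apply,
      smul_eq_mul, inv_mul_cancel₀ hc, sub_self]

lemma nonsymJack_spec (hα : 0 < α) (hσ : σ ∈ sortSet m) :
    IsNonsymJack α m σ (nonsymJack α m σ) :=
  Classical.epsilon_spec (existsUnique_isNonsymJack hα hσ).exists

lemma nonsymJack_isEig (hα : 0 < α) (hσ : σ ∈ sortSet m) :
    IsEig α (spec α (m ∘ σ)) (nonsymJack α m σ) :=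
  ((isNonsymJack_iff hα hσ).1 (nonsymJack_spec hα hσ)).1

lemma nonsymJack_coeff (hα : 0 < α) (hσ : σ ∈ sortSet m) :
    (nonsymJack α m σ).coeff (m ∘ σ) = 1 := (nonsymJack_spec hα hσ).2.1

/-- `K_{i,i+1} Φ_σ = Φ_σ` if `m_{σ(i)} = m_{σ(i+1)}`. -/
theorem Kop_nonsymJack_of_eq (hα : 0 < α) (hm : Antitone m) (hσ : σ ∈ sortSet m) {i j : Fin N}
    (hij : Adj i j) (h : m (σ i) = m (σ j)) :
    Kop i j (nonsymJack α m σ) = nonsymJack α m σ := by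
  have he := nonsymJack_isEig hα hσ
  have hadj := sortSet_apply_of_eq hm hσ hij h
  have hx : spec α (m ∘ σ) i - spec α (m ∘ σ) j = 1 := by
    rw [← xi_eq_spec hσ, xi, xi, h]
    have : ((σ j : ℕ) : ℂ) = (σ i : ℕ) + 1 := by exact_mod_cast hadj.symm
    rw [this]
    ring
  -- The spectrum differs by `1` at `i` and `j`, so `K Φ - Φ` has the exchanged spectrum. That would
  -- have to belong to the composition with entries `i`, `j` exchanged, which is `m ∘ σ` again,
  -- whose spectrum is not symmetric; so the difference is zero.
  have h1 := he.swap (c := -1) hij (by linear_combination hx)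
  by_contra h2
  obtain ⟨b, h3, -, -⟩ := h1.leading hα (by
    rw [neg_one_smul, ← sub_eq_add_neg]
    exact sub_ne_zero.2 h2)
  have h4 := (spec_eq hα h3).1
  have h5 : (m ∘ σ) ∘ Equiv.swap i j = m ∘ σ := by
    ext k
    simp only [Function.comp_apply, Equiv.swap_apply_def]
    split_ifs <;> simp_all
  rw [h4, h5] at h3
  have h6 := congrFun h3 i
  rw [Function.comp_apply, Equiv.swap_apply_left] at h6
  rw [h6, sub_self] at hx
  exact zero_ne_one hx

/-- `K_{i,i+1} Φ_{σ(i,i+1)} = Φ_σ + c Φ_{σ(i,i+1)}` if `m_{σ(i)} > m_{σ(i+1)}`. -/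
theorem Kop_nonsymJack_of_lt (hα : 0 < α) (hm : Antitone m) (hσ : σ ∈ sortSet m) {i j : Fin N}
    (hij : Adj i j) (h : m (σ j) < m (σ i)) :
    Kop i j (nonsymJack α m (σ * Equiv.swap i j)) = nonsymJack α m σ +
      (-xi α m σ i + xi α m σ j)⁻¹ • nonsymJack α m (σ * Equiv.swap i j) := by
  have hτ := mul_swap_mem_sortSet hm hσ hij h.ne'
  have hne : (m ∘ σ) i ≠ (m ∘ σ) j := h.ne'
  obtain ⟨hd, -⟩ := spec_sub_ne hα hne
  have e : m ∘ (σ * Equiv.swap i j : Equiv.Perm (Fin N)) = (m ∘ σ) ∘ Equiv.swap i j := rfl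
  have he := nonsymJack_isEig hα hτ
  rw [e, spec_comp_swap hij hne] at he
  have hc := nonsymJack_coeff hα hτ
  rw [e] at hc
  rw [xi_eq_spec hσ]
  set x := spec α (m ∘ σ)
  set Ψ := nonsymJack α m (σ * Equiv.swap i j)
  rw [neg_add_eq_sub]
  -- `Ψ` has the exchanged spectrum, whence the sign of `c`. The intertwined vector has spectrum
  -- `x`, so comparing the coefficient at `m ∘ σ` identifies it with `Φ_σ`.
  have h1 := he.swap (c := -(x j - x i)⁻¹) hij (by
    rw [Function.comp_apply, Function.comp_apply, Equiv.swap_apply_left, Equiv.swap_apply_right]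
    field_simp
    ring)
  have hxx : (x ∘ Equiv.swap i j) ∘ Equiv.swap i j = x := by ext k; simp
  rw [hxx] at h1
  -- The leading exponent of `Ψ` is smaller than `m ∘ σ`.
  have h0 : Ψ.coeff (m ∘ σ) = 0 := by
    by_contra h0
    have hgt : CompGT (m ∘ σ) ((m ∘ σ) ∘ Equiv.swap i j) := compGT_swap hij.lt h
    have hΨ : Ψ ≠ 0 := by
      intro h2
      rw [h2] at h0
      exact h0 rfl
    obtain ⟨b, h2, -, h3⟩ := (nonsymJack_isEig hα hτ).leading hα hΨ
    rw [← spec_injective hα h2] at h3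
    rcases h3 _ h0 with h4 | h4
    · rw [e] at h4
      rw [← h4] at hgt
      exact CompGT.irrefl _ hgt
    · exact CompGT.irrefl _ (hgt.trans h4)
  have h2 := (h1.sub (nonsymJack_isEig hα hσ)).eq_zero hα (by
    rw [AddMonoidAlgebra.coeff_sub, Finsupp.sub_apply, nonsymJack_coeff hα hσ,
      AddMonoidAlgebra.coeff_add, Finsupp.add_apply, AddMonoidAlgebra.coeff_smul_apply, h0,
      smul_zero, Kop_eq, coeff_varPerm, hc]
    ring)
  linear_combination (norm := module) h2

end Jack

/-! ### The operators `Ř` -/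

section RFamily

variable {n N : ℕ} {α : ℝ} {m : Fin N → ℤ}

lemma lt_of_antitone_lt (hm : Antitone m) {i j : Fin N} (h : m j < m i) : i < j := by
  by_contra h1
  exact absurd (hm (not_lt.1 h1)) (not_le.2 h)

/-- A recursion step of `S^m` creates a descent, since `m (σ j) < m (σ i)` forces `σ i < σ j`; so
the recursion is a special case of `Rperm_step`. -/
lemma isRFamily_Rperm (hα : 0 < α) (hm : Antitone m) :
    IsRFamily n α m fun σ => Rperm n (xi α m 1) σ.1 := by
  refine ⟨fun σ h => ?_, fun σ τ i j hij h hτ => ?_⟩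
  · simp only [h, Rperm_one]
  · have h1 : τ.1 j < τ.1 i := by
      rw [hτ]
      simpa using lt_of_antitone_lt hm h
    have h2 : τ.1 * Equiv.swap i j = σ.1 := by
      rw [hτ, mul_assoc, Equiv.swap_mul_self, mul_one]
    have h3 : xi α m 1 (τ.1 i) - xi α m 1 (τ.1 j) = -xi α m σ.1 i + xi α m σ.1 j := by
      rw [hτ, neg_add_eq_sub]
      simp [xi_eq m σ.1]
    have h4 := Rperm_step n (xi_one_injective hα hm) τ.1 i j hij h1
    rw [h2, h3] at h4
    exact h4

/-- Induction over `S^m`. -/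
lemma sortSet_induction (hm : Antitone m) {p : sortSet m → Prop}
    (one : p ⟨1, one_mem_sortSet hm⟩)
    (step : ∀ (σ τ : sortSet m) (i j : Fin N), Adj i j → m (σ.1 j) < m (σ.1 i) →
      τ.1 = σ.1 * Equiv.swap i j → p σ → p τ) (σ : sortSet m) : p σ := by
  induction hh : permHeight σ.1 using Nat.strong_induction_on generalizing σ with
  | _ h ih =>
  subst hh
  by_cases h1 : σ.1 = 1
  · have : σ = ⟨1, one_mem_sortSet hm⟩ := Subtype.ext h1
    rwa [this]
  · obtain ⟨i, j, hij, h2, h3⟩ := exists_ascent hm σ.2 h1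
    refine step ⟨σ.1 * Equiv.swap i j, mul_swap_mem_sortSet hm σ.2 hij h2.ne⟩ σ i j hij ?_ ?_
      (ih _ (permHeight_lt hij h3) _ rfl)
    · simpa using h2
    · rw [mul_assoc, Equiv.swap_mul_self, mul_one]

lemma IsRFamily.unique (hm : Antitone m) {R R' : sortSet m → Module.End ℂ (Spins n N)}
    (h : IsRFamily n α m R) (h' : IsRFamily n α m R') : R = R' := by
  funext σ
  induction σ using sortSet_induction hm with
  | one => rw [h.1 _ rfl, h'.1 _ rfl]
  | step σ τ i j hij hlt hτ ih => rw [h.2 σ τ i j hij hlt hτ, h'.2 σ τ i j hij hlt hτ, ih]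

theorem existsUnique_isRFamily (n : ℕ) (hα : 0 < α) (hm : Antitone m) :
    ∃! R : sortSet m → Module.End ℂ (Spins n N), IsRFamily n α m R :=
  ⟨_, isRFamily_Rperm hα hm, fun _ h => h.unique hm (isRFamily_Rperm hα hm)⟩

lemma Rfamily_spec (n : ℕ) (hα : 0 < α) (hm : Antitone m) :
    IsRFamily n α m (Rfamily n α m) :=
  Classical.epsilon_spec (existsUnique_isRFamily n hα hm).exists

lemma Rfamily_eq (hα : 0 < α) (hm : Antitone m) (σ : sortSet m) :
    Rfamily n α m σ = Rperm n (xi α m 1) σ.1 :=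
  congrFun ((Rfamily_spec n hα hm).unique hm (isRFamily_Rperm hα hm)) σ

lemma Rcheck_apply (i j : Fin N) (u : ℂ) (v : Spins n N) :
    Rcheck n i j u v = u⁻¹ • v + Pop n i j v := by
  rw [Rcheck, LinearMap.add_apply, Module.algebraMap_end_apply]

lemma inv_neg_one_smul_add_eq_zero {V : Type} [AddCommGroup V] [Module ℂ V] (x y : V) :
    (-1 : ℂ)⁻¹ • x + y = 0 ↔ y = x := by
  rw [inv_neg_one, neg_one_smul, neg_add_eq_zero, eq_comm]

/-- `Ř(σ)` maps `W` into the vectors symmetric in the positions `i`, `i + 1` if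
`m_{σ(i)} = m_{σ(i+1)}`. -/
theorem Pop_Rfamily (hα : 0 < α) (hm : Antitone m) (σ : sortSet m) {i j : Fin N} (hij : Adj i j)
    (h : m (σ.1 i) = m (σ.1 j)) {w : Spins n N} (hw : w ∈ Wspace n m) :
    Pop n i j (Rfamily n α m σ w) = Rfamily n α m σ w := by
  have hx := xi_one_injective hα hm
  have hkl := sortSet_apply_of_eq hm σ.2 hij h
  rw [Rfamily_eq hα hm]
  have e : Equiv.swap (σ.1 i) (σ.1 j) * σ.1 = σ.1 * Equiv.swap i j := by
    rw [Equiv.mul_swap_eq_swap_mul]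
  have hd : xi α m 1 (σ.1 j) - xi α m 1 (σ.1 i) = -1 := by
    rw [xi, xi, Equiv.Perm.one_apply, Equiv.Perm.one_apply, h]
    have : ((σ.1 j : ℕ) : ℂ) = (σ.1 i : ℕ) + 1 := by exact_mod_cast hkl.symm
    rw [this]
    ring
  -- Compute `Ř` at `σ (i,j) = (σ i, σ j) σ` in two ways, peeling a factor on the left or on the
  -- right. Both factors have spectral parameter `-1`, hence are `P - 1`. The right one kills `w`,
  -- so the left one kills `Ř(σ) w`; the permuted parameters of the other factor do not matter.
  have h1 := Rperm_swap_mul n hx hkl σ.1 (by simpa using hij.lt)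
  rw [e, Rperm_step n hx _ i j hij (by simpa using hkl.lt)] at h1
  have e2 : σ.1 * Equiv.swap i j * Equiv.swap i j = σ.1 := by
    rw [mul_assoc, Equiv.swap_mul_self, mul_one]
  rw [e2] at h1
  simp only [Equiv.Perm.mul_apply, Equiv.swap_apply_left, Equiv.swap_apply_right, hd] at h1
  have h2 := LinearMap.congr_fun h1 w
  rw [Module.End.mul_apply, Module.End.mul_apply, Rcheck_apply, Rcheck_apply,
    mem_Wspace.1 hw _ _ hkl h] at h2
  have h3 := (inv_neg_one_smul_add_eq_zero w w).2 rfl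
  rw [h3, map_zero] at h2
  exact (inv_neg_one_smul_add_eq_zero _ _).1 h2

end RFamily

/-! ### Expansion in non-symmetric Jack polynomials -/

section Expansion

lemma exists_dual_family {ι V : Type} [DecidableEq ι] [AddCommGroup V] [Module ℂ V] {v : ι → V}
    (h : LinearIndependent ℂ v) :
    ∃ φ : ι → V →ₗ[ℂ] ℂ, ∀ i j, φ i (v j) = if j = i then 1 else 0 := by
  choose φ hφ using fun i => LinearMap.exists_extend ((Module.Basis.span h).coord i)
  refine ⟨φ, fun i j => ?_⟩
  have h1 := LinearMap.congr_fun (hφ i) (Module.Basis.span h j)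
  rw [LinearMap.comp_apply, Module.Basis.coord_apply, Module.Basis.repr_self,
    Finsupp.single_apply, Submodule.subtype_apply, Module.Basis.span_apply] at h1
  exact h1

lemma sum_tmul_injective {ι V S : Type} [Fintype ι] [AddCommGroup V] [Module ℂ V]
    [AddCommGroup S] [Module ℂ S] {v : ι → V} (h : LinearIndependent ℂ v) {x y : ι → S}
    (hxy : ∑ i, v i ⊗ₜ[ℂ] x i = ∑ i, v i ⊗ₜ[ℂ] y i) : x = y := by
  classical
  obtain ⟨φ, hφ⟩ := exists_dual_family h
  funext i
  have h1 := congrArg (fun F => TensorProduct.lid ℂ S (LinearMap.rTensor S (φ i) F)) hxy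
  simpa [hφ, ite_smul] using h1

variable {n N : ℕ} {α : ℝ} {m : Fin N → ℤ}

theorem linearIndependent_nonsymJack (hα : 0 < α) (m : Fin N → ℤ) :
    LinearIndependent ℂ fun σ : sortSet m => nonsymJack α m σ.1 := by
  rw [Fintype.linearIndependent_iff]
  intro g hg
  by_contra! hne
  let r : sortSet m → sortSet m → Prop := fun σ τ => CompGT (m ∘ σ.1) (m ∘ τ.1)
  have : IsTrans (sortSet m) r := ⟨fun _ _ _ h h' => h.trans h'⟩
  have : Std.Irrefl r := ⟨fun _ => CompGT.irrefl _⟩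
  -- Minimal for `r` means that no larger composition has a non-zero coefficient; at its exponent
  -- only `Φ_σ` contributes.
  obtain ⟨σ, hσ, hmin⟩ := (Finite.wellFounded_of_trans_of_irrefl r).has_min {σ | g σ ≠ 0} hne
  have h1 := congrArg (fun f : Laurent N => f.coeff (m ∘ σ.1)) hg
  simp only [AddMonoidAlgebra.coeff_sum, Finsupp.finsetSum_apply,
    AddMonoidAlgebra.coeff_smul_apply] at h1
  rw [Finset.sum_eq_single σ, nonsymJack_coeff hα σ.2] at h1
  · exact hσ (by simpa using h1)
  · intro τ _ hτ
    by_cases hg0 : g τ = 0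
    · rw [hg0, zero_smul]
    by_contra h2
    have h3 : (nonsymJack α m τ.1).coeff (m ∘ σ.1) ≠ 0 := fun h => h2 (by rw [h, smul_zero])
    have h0 : nonsymJack α m τ.1 ≠ 0 := by
      intro h
      rw [h] at h3
      exact h3 rfl
    obtain ⟨b, hb, -, h4⟩ := (nonsymJack_isEig hα τ.2).leading hα h0
    rw [← spec_injective hα hb] at h4
    rcases h4 _ h3 with h5 | h5
    · refine hτ (Subtype.ext ?_)
      rw [← sortPerm_comp τ.2, ← sortPerm_comp σ.2, h5]
    · exact hmin τ hg0 h5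
  · intro h
    exact absurd (Finset.mem_univ _) h

/-- `∑_σ Φ_σ ⊗ v_σ`. -/
def jackSum (n : ℕ) {N : ℕ} (α : ℝ) (m : Fin N → ℤ) :
    (sortSet m → Spins n N) →ₗ[ℂ] States n N :=
  ∑ σ : sortSet m, TensorProduct.mk ℂ (Laurent N) (Spins n N) (nonsymJack α m σ.1) ∘ₗ
    LinearMap.proj σ

lemma jackSum_apply (v : sortSet m → Spins n N) :
    jackSum n α m v = ∑ σ : sortSet m, nonsymJack α m σ.1 ⊗ₜ[ℂ] v σ := by
  simp [jackSum, LinearMap.sum_apply]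

lemma Umap_eq (w : Spins n N) : Umap n α m w = jackSum n α m fun σ => Rfamily n α m σ w := by
  rw [jackSum_apply, Umap, LinearMap.sum_apply]
  rfl

lemma jackSum_injective (n : ℕ) (hα : 0 < α) (m : Fin N → ℤ) :
    Function.Injective (jackSum n α m) := by
  intro v w h
  rw [jackSum_apply, jackSum_apply] at h
  exact sum_tmul_injective (linearIndependent_nonsymJack hα m) h

lemma range_jackSum (n : ℕ) (α : ℝ) (m : Fin N → ℤ) :
    LinearMap.range (LinearMap.rTensor (Spins n N) (Espace α m).subtype) =
      LinearMap.range (jackSum n α m) := by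
  apply le_antisymm
  · rintro _ ⟨F, rfl⟩
    induction F using TensorProduct.induction_on with
    | zero => rw [map_zero]; exact zero_mem _
    | add F G hF hG => rw [map_add]; exact add_mem hF hG
    | tmul f v =>
      obtain ⟨f, hf⟩ := f
      rw [LinearMap.rTensor_tmul, Submodule.subtype_apply]
      change f ⊗ₜ[ℂ] v ∈ _
      induction hf using Submodule.span_induction with
      | zero => rw [TensorProduct.zero_tmul]; exact zero_mem _
      | add f g _ _ hf hg => rw [TensorProduct.add_tmul]; exact add_mem hf hg
      | smul c f _ hf => rw [← TensorProduct.smul_tmul']; exact Submodule.smul_mem _ _ hf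
      | mem f hf =>
        obtain ⟨σ, rfl⟩ := hf
        classical
        refine ⟨Pi.single σ v, ?_⟩
        rw [jackSum_apply, Finset.sum_eq_single σ]
        · rw [Pi.single_eq_same]
        · intro τ _ h
          rw [Pi.single_eq_of_ne h, TensorProduct.tmul_zero]
        · intro h
          exact absurd (Finset.mem_univ _) h
  · rintro _ ⟨v, rfl⟩
    rw [jackSum_apply]
    refine sum_mem fun σ _ => ?_
    exact ⟨(⟨_, Submodule.subset_span ⟨σ, rfl⟩⟩ : Espace α m) ⊗ₜ[ℂ] v σ, rfl⟩

end Expansion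

/-! ### The bosonic condition -/

section Bosonic

variable {n N : ℕ} {α : ℝ} {m : Fin N → ℤ}

lemma mul_swap_mem_sortSet_iff (hm : Antitone m) {σ : Equiv.Perm (Fin N)} (hσ : σ ∈ sortSet m)
    {i j : Fin N} (hij : Adj i j) :
    σ * Equiv.swap i j ∈ sortSet m ↔ m (σ i) ≠ m (σ j) := by
  refine ⟨fun h he => ?_, mul_swap_mem_sortSet hm hσ hij⟩
  have h1 := (mem_sortSet_iff hm).1 hσ i j hij.lt he
  have h2 := (mem_sortSet_iff hm).1 h i j hij.lt (by simpa using he.symm)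
  simp only [Equiv.Perm.mul_apply, Equiv.swap_apply_left, Equiv.swap_apply_right] at h2
  exact lt_asymm h1 h2

open Classical in
/-- `σ ↦ σ (i,j)`, where this lies in `S^m`. -/
def sortSwap (m : Fin N → ℤ) (i j : Fin N) (σ : sortSet m) : sortSet m :=
  if h : σ.1 * Equiv.swap i j ∈ sortSet m then ⟨_, h⟩ else σ

lemma sortSwap_involutive (m : Fin N → ℤ) (i j : Fin N) :
    Function.Involutive (sortSwap m i j) := by
  intro σ
  by_cases h : σ.1 * Equiv.swap i j ∈ sortSet m
  · have h1 : sortSwap m i j σ = ⟨_, h⟩ := dif_pos h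
    have h2 : σ.1 * Equiv.swap i j * Equiv.swap i j = σ.1 := by
      rw [mul_assoc, Equiv.swap_mul_self, mul_one]
    have h3 : (⟨_, h⟩ : sortSet m).1 * Equiv.swap i j ∈ sortSet m := by
      rw [h2]
      exact σ.2
    rw [h1, sortSwap, dif_pos h3]
    exact Subtype.ext h2
  · have h1 : sortSwap m i j σ = σ := dif_neg h
    rw [h1, h1]

lemma sortSwap_of_ne (hm : Antitone m) {i j : Fin N} (hij : Adj i j) {σ : sortSet m}
    (h : m (σ.1 i) ≠ m (σ.1 j)) : (sortSwap m i j σ).1 = σ.1 * Equiv.swap i j := by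
  rw [sortSwap, dif_pos ((mul_swap_mem_sortSet_iff hm σ.2 hij).2 h)]

lemma sortSwap_of_eq (hm : Antitone m) {i j : Fin N} (hij : Adj i j) {σ : sortSet m}
    (h : m (σ.1 i) = m (σ.1 j)) : sortSwap m i j σ = σ := by
  rw [sortSwap, dif_neg fun h1 => (mul_swap_mem_sortSet_iff hm σ.2 hij).1 h1 h]

/-- The coefficient of `Ř` in the step from `σ` to `σ (i,j)`. -/
def stepCoeff (α : ℝ) (m : Fin N → ℤ) (i j : Fin N) (σ : sortSet m) : ℂ :=
  if m (σ.1 i) = m (σ.1 j) then 0 else (-xi α m σ.1 i + xi α m σ.1 j)⁻¹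

lemma stepCoeff_sortSwap (hm : Antitone m) {i j : Fin N} (hij : Adj i j) (σ : sortSet m) :
    stepCoeff α m i j (sortSwap m i j σ) = -stepCoeff α m i j σ := by
  by_cases h : m (σ.1 i) = m (σ.1 j)
  · rw [sortSwap_of_eq hm hij h, stepCoeff, if_pos h, neg_zero]
  · have h1 := sortSwap_of_ne hm hij h
    rw [stepCoeff, stepCoeff, if_neg h, h1, if_neg (by simpa using Ne.symm h), xi_mul,
      Function.comp_apply, Function.comp_apply, Equiv.swap_apply_left, Equiv.swap_apply_right,
      ← inv_neg]
    congr 1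
    ring

/-- `K_{i,i+1}` in the basis of non-symmetric Jack polynomials. -/
theorem Kop_nonsymJack (hα : 0 < α) (hm : Antitone m) {i j : Fin N} (hij : Adj i j)
    (σ : sortSet m) :
    Kop i j (nonsymJack α m σ.1) =
      (if m (σ.1 j) < m (σ.1 i) then 1 - stepCoeff α m i j σ ^ 2 else 1) •
        nonsymJack α m (sortSwap m i j σ).1 - stepCoeff α m i j σ • nonsymJack α m σ.1 := by
  rcases lt_trichotomy (m (σ.1 j)) (m (σ.1 i)) with h | h | h
  · have h1 := Kop_nonsymJack_of_lt hα hm σ.2 hij h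
    -- Applying `K` once more and using `K² = 1` solves for `K Φ_σ`; this is the source of the
    -- factor `1 - c ^ 2`.
    have h2 := congrArg (Kop i j) h1
    rw [Kop_Kop, map_add, map_smul, h1] at h2
    rw [if_pos h, sortSwap_of_ne hm hij h.ne', stepCoeff, if_neg h.ne']
    linear_combination (norm := module) -h2
  · rw [if_neg h.not_lt, sortSwap_of_eq hm hij h.symm, stepCoeff, if_pos h.symm,
      Kop_nonsymJack_of_eq hα hm σ.2 hij h.symm]
    module
  · have h1 := sortSwap_of_ne hm hij h.ne
    have h2 : (sortSwap m i j σ).1 * Equiv.swap i j = σ.1 := by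
      rw [h1, mul_assoc, Equiv.swap_mul_self, mul_one]
    have h3 : m ((sortSwap m i j σ).1 j) < m ((sortSwap m i j σ).1 i) := by
      rw [h1]
      simpa using h
    have h4 := Kop_nonsymJack_of_lt hα hm (sortSwap m i j σ).2 hij h3
    have h5 := stepCoeff_sortSwap (α := α) hm hij σ
    rw [stepCoeff, if_neg h3.ne'] at h5
    rw [h2, h5] at h4
    rw [if_neg h.not_gt, h4]
    module

/-- The bosonic condition for the components in the basis of non-symmetric Jack polynomials. -/
def IsBosonic (α : ℝ) (m : Fin N → ℤ) (v : sortSet m → Spins n N) : Prop :=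
  ∀ (σ : sortSet m) (i j : Fin N), Adj i j →
    (m (σ.1 i) = m (σ.1 j) → Pop n i j (v σ) = v σ) ∧
    (m (σ.1 j) < m (σ.1 i) →
      v (sortSwap m i j σ) = Rcheck n i j (-xi α m σ.1 i + xi α m σ.1 j) (v σ))

lemma Pop_Pop (i j : Fin N) (v : Spins n N) : Pop n i j (Pop n i j v) = v := by
  rw [← Module.End.mul_apply, Pop_mul_self, Module.End.one_apply]

lemma exchange_eq_iff {V : Type} [AddCommGroup V] [Module ℂ V] {P : V →ₗ[ℂ] V}
    (hP : ∀ v, P (P v) = v) {c : ℂ} {x y : V} : P y - c • P x = x ↔ y = c • x + P x := by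
  constructor <;> intro h
  · have h1 := congrArg P h
    rw [map_sub, map_smul, hP, hP] at h1
    linear_combination (norm := module) h1
  · rw [h, map_add, map_smul, hP]
    module

lemma exchange_eq_of_eq {V : Type} [AddCommGroup V] [Module ℂ V] {P : V →ₗ[ℂ] V}
    (hP : ∀ v, P (P v) = v) {c : ℂ} {x y : V} (h : x = (-c) • y + P y) :
    (1 - c ^ 2) • P y - c • P x = x := by
  rw [h, map_add, map_smul, hP]
  module

lemma exchange_sum {ι L S : Type} [Fintype ι] [AddCommGroup L] [Module ℂ L] [AddCommGroup S]
    [Module ℂ S] {Φ : ι → L} {K : L →ₗ[ℂ] L} (P : S →ₗ[ℂ] S) {s : ι → ι}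
    (hs : Function.Involutive s) {a c : ι → ℂ} (hK : ∀ i, K (Φ i) = a i • Φ (s i) - c i • Φ i)
    (v : ι → S) :
    LinearMap.rTensor S K (LinearMap.lTensor L P (∑ i, Φ i ⊗ₜ[ℂ] v i)) =
      ∑ i, Φ i ⊗ₜ[ℂ] (a (s i) • P (v (s i)) - c i • P (v i)) := by
  simp only [map_sum, LinearMap.lTensor_tmul, LinearMap.rTensor_tmul, hK, TensorProduct.sub_tmul,
    TensorProduct.tmul_sub, Finset.sum_sub_distrib, TensorProduct.smul_tmul]
  congr 1
  refine Finset.sum_equiv (Function.Involutive.toPerm s hs) (by simp) fun i _ => ?_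
  have h1 : (Function.Involutive.toPerm s hs) i = s i := rfl
  rw [h1, hs i]

lemma exchange_jackSum (hα : 0 < α) (hm : Antitone m) {i j : Fin N} (hij : Adj i j)
    (v : sortSet m → Spins n N) :
    onPoly n (Kop i j) (onSpin (Pop n i j) (jackSum n α m v)) = jackSum n α m fun σ =>
      (if m (σ.1 i) < m (σ.1 j) then 1 - stepCoeff α m i j σ ^ 2 else 1) •
        Pop n i j (v (sortSwap m i j σ)) - stepCoeff α m i j σ • Pop n i j (v σ) := by
  rw [jackSum_apply, jackSum_apply]
  refine (exchange_sum (Pop n i j) (sortSwap_involutive m i j) (Kop_nonsymJack hα hm hij) v).trans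
    (Finset.sum_congr rfl fun σ _ => ?_)
  have h2 : m ((sortSwap m i j σ).1 j) < m ((sortSwap m i j σ).1 i) ↔
      m (σ.1 i) < m (σ.1 j) := by
    by_cases h : m (σ.1 i) = m (σ.1 j)
    · rw [sortSwap_of_eq hm hij h, h]
    · rw [sortSwap_of_ne hm hij h]
      simp
  simp only [h2, stepCoeff_sortSwap hm hij, neg_sq]

lemma mem_Hplus {F : States n N} : F ∈ Hplus n N ↔
    ∀ i j, Adj i j → onPoly n (Kop i j) (onSpin (Pop n i j) F) = F := by
  simp only [Hplus, Submodule.mem_iInf, LinearMap.mem_ker, LinearMap.sub_apply, sub_eq_zero,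
    Module.End.one_apply, Module.End.mul_apply]

/-- By linear independence the condition can be read off componentwise. The pair `σ`, `σ (i,j)`
yields two equations: at the member with the larger entry in position `i` it is the recursion
(`exchange_eq_iff`), and the other one then follows (`exchange_eq_of_eq`). -/
theorem jackSum_mem_Hplus_iff (hα : 0 < α) (hm : Antitone m) (v : sortSet m → Spins n N) :
    jackSum n α m v ∈ Hplus n N ↔ IsBosonic α m v := by
  have key : jackSum n α m v ∈ Hplus n N ↔ ∀ i j, Adj i j → ∀ σ : sortSet m,
      (if m (σ.1 i) < m (σ.1 j) then 1 - stepCoeff α m i j σ ^ 2 else 1) •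
        Pop n i j (v (sortSwap m i j σ)) - stepCoeff α m i j σ • Pop n i j (v σ) = v σ := by
    rw [mem_Hplus]
    refine forall_congr' fun i => forall_congr' fun j => forall_congr' fun hij => ?_
    rw [exchange_jackSum hα hm hij, (jackSum_injective n hα m).eq_iff, funext_iff]
  rw [key]
  constructor
  · intro h σ i j hij
    have h1 := h i j hij σ
    refine ⟨fun he => ?_, fun hlt => ?_⟩
    · rw [if_neg he.not_lt, sortSwap_of_eq hm hij he, stepCoeff, if_pos he, zero_smul, sub_zero,
        one_smul] at h1
      exact h1
    · rw [if_neg hlt.not_gt, stepCoeff, if_neg hlt.ne', one_smul] at h1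
      rw [Rcheck_apply]
      exact (exchange_eq_iff (Pop_Pop i j)).1 h1
  · intro h i j hij σ
    rcases lt_trichotomy (m (σ.1 j)) (m (σ.1 i)) with hlt | he | hlt
    · rw [if_neg hlt.not_gt, stepCoeff, if_neg hlt.ne', one_smul]
      refine (exchange_eq_iff (Pop_Pop i j)).2 ?_
      rw [(h σ i j hij).2 hlt, Rcheck_apply]
    · rw [if_neg he.not_gt, sortSwap_of_eq hm hij he.symm, stepCoeff, if_pos he.symm,
        (h σ i j hij).1 he.symm, one_smul, zero_smul, sub_zero]
    · rw [if_pos hlt]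
      have h1 := sortSwap_of_ne hm hij hlt.ne
      have h3 : m ((sortSwap m i j σ).1 j) < m ((sortSwap m i j σ).1 i) := by
        rw [h1]
        simpa using hlt
      have h5 := stepCoeff_sortSwap (α := α) hm hij σ
      rw [stepCoeff, if_neg h3.ne'] at h5
      have h4 := (h (sortSwap m i j σ) i j hij).2 h3
      rw [sortSwap_involutive m i j σ, Rcheck_apply, h5] at h4
      exact exchange_eq_of_eq (Pop_Pop i j) h4

theorem isBosonic_Rfamily (hα : 0 < α) (hm : Antitone m) {w : Spins n N} (hw : w ∈ Wspace n m) :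
    IsBosonic α m fun σ => Rfamily n α m σ w := by
  intro σ i j hij
  refine ⟨fun he => Pop_Rfamily hα hm σ hij he hw, fun hlt => ?_⟩
  exact LinearMap.congr_fun ((Rfamily_spec n hα hm).2 σ (sortSwap m i j σ) i j hij hlt
    (sortSwap_of_ne hm hij hlt.ne')) w

lemma Rfamily_one (hα : 0 < α) (hm : Antitone m) (w : Spins n N) :
    Rfamily n α m ⟨1, one_mem_sortSet hm⟩ w = w := by
  rw [(Rfamily_spec n hα hm).1 _ rfl, Module.End.one_apply]

/-- The recursion reaches every element of `S^m` from the identity, and at the identity the symmetry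
conditions are those defining `W`. -/
theorem IsBosonic.eq_Rfamily (hα : 0 < α) (hm : Antitone m) {v : sortSet m → Spins n N}
    (h : IsBosonic α m v) :
    v ⟨1, one_mem_sortSet hm⟩ ∈ Wspace n m ∧
      v = fun σ => Rfamily n α m σ (v ⟨1, one_mem_sortSet hm⟩) := by
  refine ⟨mem_Wspace.2 fun i j hij he => (h ⟨1, one_mem_sortSet hm⟩ i j hij).1 he, funext fun σ => ?_⟩
  induction σ using sortSet_induction hm with
  | one => rw [Rfamily_one hα hm]
  | step σ τ i j hij hlt hτ ih =>
    have h1 : τ = sortSwap m i j σ := Subtype.ext (hτ.trans (sortSwap_of_ne hm hij hlt.ne').symm)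
    rw [(Rfamily_spec n hα hm).2 σ τ i j hij hlt hτ, Module.End.mul_apply, ← ih, h1]
    exact (h σ i j hij).2 hlt

theorem Umap_mem (hα : 0 < α) (hm : Antitone m) {w : Spins n N} (hw : w ∈ Wspace n m) :
    Umap n α m w ∈ Bspace n α m := by
  rw [Bspace, range_jackSum, Umap_eq]
  exact ⟨⟨_, rfl⟩, (jackSum_mem_Hplus_iff hα hm _).2 (isBosonic_Rfamily hα hm hw)⟩

theorem exists_linearEquiv_Umap (n : ℕ) (hα : 0 < α) (hm : Antitone m) :
    ∃ e : Wspace n m ≃ₗ[ℂ] Bspace n α m,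
      ∀ w : Wspace n m, (e w : States n N) = Umap n α m (w : Spins n N) := by
  let f : Wspace n m →ₗ[ℂ] Bspace n α m :=
    (Umap n α m).restrict fun w hw => Umap_mem hα hm hw
  have hf : ∀ w : Wspace n m, (f w : States n N) = Umap n α m (w : Spins n N) := fun w => rfl
  refine ⟨LinearEquiv.ofBijective f ⟨fun w w' h => ?_, fun F => ?_⟩, hf⟩
  · have h1 := congrArg Subtype.val h
    rw [hf, hf, Umap_eq, Umap_eq] at h1
    -- As `Ř(id) = 1`, the component at the identity is the vector itself.
    have h2 := congrFun (jackSum_injective n hα m h1) ⟨1, one_mem_sortSet hm⟩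
    simp only [Rfamily_one hα hm] at h2
    exact Subtype.ext h2
  · obtain ⟨F, hF⟩ := F
    have hF' := hF
    rw [Bspace, range_jackSum] at hF'
    obtain ⟨⟨v, rfl⟩, h2⟩ := hF'
    obtain ⟨h3, h4⟩ := ((jackSum_mem_Hplus_iff hα hm v).1 h2).eq_Rfamily hα hm
    refine ⟨⟨_, h3⟩, Subtype.ext ?_⟩
    rw [hf, Umap_eq, ← h4]

end Bosonic

/-! ### The intertwining property -/

section Intertwining

section Eigenvectors

variable {n : ℕ} {L S : Type} [AddCommGroup L] [Module ℂ L] [AddCommGroup S] [Module ℂ S]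

lemma coeff_lMatrix_tmul (e : Fin n → Fin n → Module.End ℂ S) {d : Module.End ℂ L} {x : ℂ} {Φ : L}
    (h : d Φ = x • Φ) (a b : Fin n) (s : ℕ) (v : S) :
    PowerSeries.coeff s (lMatrix (A := Module.End ℂ (L ⊗[ℂ] S))
        (fun a b => LinearMap.lTensor L (e a b)) (LinearMap.rTensor S d) a b) (Φ ⊗ₜ v) =
      Φ ⊗ₜ PowerSeries.coeff s (lMatrix e (algebraMap ℂ _ x) a b) v := by
  have hp : ∀ (k : ℕ) (u : S),
      ((LinearMap.rTensor S d : Module.End ℂ (L ⊗[ℂ] S)) ^ k) (Φ ⊗ₜ u) = x ^ k • (Φ ⊗ₜ[ℂ] u) := by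
    intro k u
    induction k with
    | zero => simp
    | succ k ih =>
      rw [pow_succ, Module.End.mul_apply, LinearMap.rTensor_tmul, h, ← TensorProduct.smul_tmul',
        map_smul, ih, smul_smul, pow_succ, mul_comm]
  have hr : ∀ u : S, PowerSeries.coeff s
      (resolventSeries (LinearMap.rTensor S d : Module.End ℂ (L ⊗[ℂ] S))) (Φ ⊗ₜ u) =
        PowerSeries.coeff s (resolventSeries x) • (Φ ⊗ₜ[ℂ] u) := by
    intro u
    cases s with
    | zero => simp [resolventSeries]
    | succ k => simpa [resolventSeries] using hp k u
  rw [coeff_lMatrix, lMatrix, Matrix.of_apply, map_add, PowerSeries.coeff_C_mul,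
    LinearMap.add_apply, Module.End.mul_apply, hr, map_smul, LinearMap.lTensor_tmul,
    LinearMap.add_apply, TensorProduct.tmul_add, LinearMap.smul_apply, TensorProduct.tmul_smul]
  congr 1
  by_cases h1 : a = b <;> by_cases h2 : s = 0 <;> simp [h1, h2, PowerSeries.coeff_one]

/-- On a joint eigenvector, the operators `d_i` may be replaced by their eigenvalues. -/
lemma coeff_list_prod_tmul {ι : Type} (e : ι → Fin n → Fin n → Module.End ℂ S)
    {d : ι → Module.End ℂ L} {x : ι → ℂ} {Φ : L} (h : ∀ i, d i Φ = x i • Φ) (l : List ι)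
    (a b : Fin n) (s : ℕ) (v : S) :
    PowerSeries.coeff s ((l.map fun i => lMatrix (A := Module.End ℂ (L ⊗[ℂ] S))
        (fun a b => LinearMap.lTensor L (e i a b)) (LinearMap.rTensor S (d i))).prod a b) (Φ ⊗ₜ v) =
      Φ ⊗ₜ PowerSeries.coeff s
        ((l.map fun i => lMatrix (e i) (algebraMap ℂ (Module.End ℂ S) (x i))).prod a b) v := by
  induction l generalizing a b s v with
  | nil =>
    by_cases h1 : a = b <;> by_cases h2 : s = 0 <;> simp [h1, h2, PowerSeries.coeff_one]
  | cons i l ih =>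
    simp only [List.map_cons, List.prod_cons, Matrix.mul_apply, map_sum, LinearMap.sum_apply,
      PowerSeries.coeff_mul, Module.End.mul_apply, ih, coeff_lMatrix_tmul (e i) (h i),
      TensorProduct.tmul_sum]

end Eigenvectors

variable {n N : ℕ} {α : ℝ} {m : Fin N → ℤ}

/-- The monodromy matrix with spectral parameters `x`. -/
abbrev monodromy (n : ℕ) {N : ℕ} (x : Fin N → ℂ) :
    Matrix (Fin n) (Fin n) (PowerSeries (Module.End ℂ (Spins n N))) :=
  prefixMonodromy (A := Module.End ℂ (Spins n N)) siteE x N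

lemma coeff_monodromyH_jackSum (hα : 0 < α) (a b : Fin n) (s : ℕ) (v : sortSet m → Spins n N) :
    PowerSeries.coeff s (monodromyH n N α a b) (jackSum n α m v) =
      jackSum n α m fun σ => PowerSeries.coeff s (monodromy n (xi α m σ.1) a b) (v σ) := by
  rw [jackSum_apply, jackSum_apply, map_sum]
  refine Finset.sum_congr rfl fun σ _ => ?_
  have h := coeff_list_prod_tmul (L := Laurent N) (S := Spins n N) siteE
    (nonsymJack_spec hα σ.2).1 (List.finRange N) a b s (v σ)
  rw [monodromy, prefixMonodromy_full, List.ofFn_eq_map, monodromyH, List.ofFn_eq_map]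
  exact h

lemma mul_C_intertwining {A : Type} [Ring A] {F G H : PowerSeries A} {r t : A}
    (h1 : F * PowerSeries.C r = PowerSeries.C r * G)
    (h2 : G * PowerSeries.C t = PowerSeries.C t * H) :
    F * PowerSeries.C (r * t) = PowerSeries.C (r * t) * H := by
  rw [map_mul, ← mul_assoc, h1, mul_assoc, h2, mul_assoc]

/-- Each step of the recursion exchanges two neighbouring parameters, `ξ(σ (i,j)) = ξ(σ) ∘ (i,j)`,
and multiplies by the `Ř` that intertwines the two monodromy matrices. -/
theorem monodromy_mul_Rfamily (hα : 0 < α) (hm : Antitone m) (σ : sortSet m) (a b : Fin n) :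
    monodromy n (xi α m σ.1) a b * PowerSeries.C (Rfamily n α m σ) =
      PowerSeries.C (Rfamily n α m σ) * monodromy n (xi α m 1) a b := by
  induction σ using sortSet_induction hm with
  | one => rw [(Rfamily_spec n hα hm).1 _ rfl, map_one, mul_one, one_mul]
  | step σ τ i j hij hlt hτ ih =>
    have hx : xi α m σ.1 i ≠ xi α m σ.1 j :=
      ((xi_one_injective hα hm).comp σ.1.injective).ne hij.ne
    have h := prefixMonodromy_intertwining (A := Module.End ℂ (Spins n N)) (E := siteE)
      (P := spinPerm n N) spinPerm_mul_siteE (fun i j hij a b => sum_siteE_mul_siteE hij a b)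
      hij hx N j.2 le_rfl a b
    rw [(Rfamily_spec n hα hm).2 σ τ i j hij hlt hτ, hτ, xi_mul, neg_add_eq_sub]
    exact mul_C_intertwining (A := Module.End ℂ (Spins n N)) h ih

lemma prefixBlocks_full (α : ℝ) (m : Fin N → ℤ) :
    prefixBlocks (V := Spins n N) siteE α m (blockValues m) N = monodromyW n α m := by
  simp only [prefixBlocks, Fin.is_lt, and_true]
  rfl

lemma coeff_monodromy_of_mem_Wspace (hm : Antitone m) (a b : Fin n) (s : ℕ) {w : Spins n N}
    (hw : w ∈ Wspace n m) :
    PowerSeries.coeff s (monodromy n (xi α m 1) a b) w =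
      PowerSeries.coeff s (monodromyW n α m a b) w := by
  rw [← prefixBlocks_full]
  exact prefixMonodromy_fusion (V := Spins n N) (E := siteE) (P := spinPerm n N)
    spinPerm_mul_siteE (fun i j hij a b => sum_siteE_mul_siteE hij a b) α hm N le_rfl a b s w
    (mem_prefixSym_of_adj hm (mem_Wspace.1 hw))

theorem coeff_monodromyH_Umap (hα : 0 < α) (hm : Antitone m) (a b : Fin n) (s : ℕ)
    {w : Spins n N} (hw : w ∈ Wspace n m) :
    PowerSeries.coeff s (monodromyH n N α a b) (Umap n α m w) =
      Umap n α m (PowerSeries.coeff s (monodromyW n α m a b) w) := by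
  rw [Umap_eq, Umap_eq, coeff_monodromyH_jackSum hα, ← coeff_monodromy_of_mem_Wspace hm a b s hw]
  congr 1
  funext σ
  have h := congrArg (PowerSeries.coeff s) (monodromy_mul_Rfamily hα hm σ a b)
  rw [PowerSeries.coeff_mul_C, PowerSeries.coeff_C_mul] at h
  exact LinearMap.congr_fun h w

end Intertwining

end

end SpinCS

theorem mainTheorem4 (n N : ℕ) (α : ℝ) (hα : 0 < α) (m : Fin N → ℤ) (hm : Antitone m) :
    (∀ σ ∈ SpinCS.sortSet m, ∃! Φ : SpinCS.Laurent N, SpinCS.IsNonsymJack α m σ Φ) ∧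
    (∃! R : SpinCS.sortSet m → Module.End ℂ (SpinCS.Spins n N), SpinCS.IsRFamily n α m R) ∧
    ∃ (ρW : SpinCS.Yangian n →ₐ[ℂ] Module.End ℂ (SpinCS.Wspace n m))
      (ρB : SpinCS.Yangian n →ₐ[ℂ] Module.End ℂ (SpinCS.Bspace n α m)),
      SpinCS.IsYangianAction (SpinCS.Wspace n m) (SpinCS.monodromyW n α m) ρW ∧
      SpinCS.IsYangianAction (SpinCS.Bspace n α m) (SpinCS.monodromyH n N α) ρB ∧
      (∀ w ∈ SpinCS.Wspace n m, SpinCS.Umap n α m w ∈ SpinCS.Bspace n α m) ∧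
      ∃ e : SpinCS.Wspace n m ≃ₗ[ℂ] SpinCS.Bspace n α m,
        (∀ w : SpinCS.Wspace n m,
          (e w : SpinCS.States n N) = SpinCS.Umap n α m (w : SpinCS.Spins n N)) ∧
        ∀ (y : SpinCS.Yangian n) (w : SpinCS.Wspace n m), e (ρW y w) = ρB y (e w) := by
  obtain ⟨ρ, hρ⟩ := SpinCS.exists_yangianAction_Wspace (n := n) α m
  obtain ⟨e, he⟩ := SpinCS.exists_linearEquiv_Umap n hα hm
  -- The action on `B` is the conjugate by `e` of the action on `W`, so `e` is equivariant by
  -- construction. That it is the restriction of the monodromy matrix, which therefore preserves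
  -- `B`, is `coeff_monodromyH_Umap`.
  refine ⟨fun σ hσ => SpinCS.existsUnique_isNonsymJack hα hσ,
    SpinCS.existsUnique_isRFamily n hα hm, ρ, (e.conjAlgEquiv ℂ).toAlgHom.comp ρ, hρ, ?_,
    fun w hw => SpinCS.Umap_mem hα hm hw, e, he, fun y w => ?_⟩
  · intro a b s F
    obtain ⟨w, rfl⟩ := e.surjective F
    have h1 : (e.conjAlgEquiv ℂ).toAlgHom.comp ρ (SpinCS.yangianT n a b s) (e w) =
        e (ρ (SpinCS.yangianT n a b s) (e.symm (e w))) := rfl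
    rw [h1, e.symm_apply_apply, he, he, hρ, SpinCS.coeff_monodromyH_Umap hα hm a b s w.2]
  · have h1 : (e.conjAlgEquiv ℂ).toAlgHom.comp ρ y (e w) = e (ρ y (e.symm (e w))) := rfl
    rw [h1, e.symm_apply_apply]
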